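/- Consider concurrency-constrained scheduling. An instance $I$ consists of $n$ jobs $\{1,\dots,n\}$, a conflict graph $G=(\{1,\dots,n\},E)$ and, for each job $j$, an integer processing time $p_j\ge 1$, an integer weight $w_j\ge 0$ and an integer due date $d_j$, all these numbers being given in unary; $|I|$ denotes the total input length. A schedule $C:\{1,\dots,n\}\to\mathbb N$ assigns to each job its completion time $C_j$. It is feasible if $C_j-p_j\ge 0$ for all $j$ and $[C_i-p_i,C_i)\cap[C_j-p_j,C_j)=\emptyset$ for all $\{i,j\}\in E$. (The number of machines is unlimited.) A feasible schedule is optimal for an objective function if it minimizes that function among all feasible schedules. The problems $P_n|conc,p_j\le p|WL_{\max}$ and $P_n|conc,p_j\le p|\sum w_jT_j$ ask, for an instance with $p_j\le p$ for all $j$, for an optimal schedule with respect to $WL_{\max}=\max_j w_j(C_j-d_j)$ and to $\sum_j w_jT_j$ with $T_j=\max\{0,C_j-d_j\}$, respectively. **Theorem.** Both problems are solvable in $O^*\big((tw\cdot p\cdot\log n)^{O(tw)}\big)$ time, where $tw=tw(G)$ is the treewidth of $G$ and $O^*$ suppresses factors polynomial in $|I|$. That is, for each of the two objective functions there are a deterministic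 algorithm and a constant $c$ such that, for every instance $I$ and every $p$ with $p_j\le p$ for all $j$, the algorithm, given $I$ (and no tree decomposition), outputs an optimal schedule in time at most $$c\cdot(tw\cdot p\cdot\log_2 n)^{c\cdot tw}\cdot|I|^{c}$$ (with $0^0=1$, and treewidth $0$ for the empty graph). Time is the number of elementary operations of a first-order LISP program (with general recursion) on binary trees of cons cells, a model that is polynomially equivalent to random access machines and Turing machines. -/

import Mathlib

namespace ConcSched

/-! ### Treewidth -/

/-- `(T, bag)` is a tree decomposition of `G`: the tree `T` on the (nonempty) node set `Fin m`
carries bags of vertices such that every vertex and every edge of `G` lies in some bag, and for each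
vertex `v` the nodes whose bags contain `v` induce a connected subgraph of `T`. -/
structure IsTreeDecomposition {V : Type*} (G : SimpleGraph V) {m : ℕ}
    (T : SimpleGraph (Fin m)) (bag : Fin m → Finset V) : Prop where
  isTree : T.IsTree
  vertex_mem : ∀ v : V, ∃ x, v ∈ bag x
  edge_mem : ∀ u v : V, G.Adj u v → ∃ x, u ∈ bag x ∧ v ∈ bag x
  connected : ∀ v : V, (T.induce {x | v ∈ bag x}).Connected

/-- The treewidth of a finite graph: the least `k` such that there is a tree decomposition all of
whose bags have at most `k + 1` vertices.  (The graph without vertices gets treewidth `0`.) -/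
noncomputable def treewidth {V : Type*} (G : SimpleGraph V) : ℕ :=
  sInf {k | ∃ (m : ℕ) (T : SimpleGraph (Fin m)) (bag : Fin m → Finset V),
    IsTreeDecomposition G T bag ∧ ∀ x, (bag x).card ≤ k + 1}

/-! ### Concurrency-constrained scheduling -/

/-- An instance: jobs `Fin n`, a conflict graph on the jobs, and for each job a positive integer
processing time `p`, a weight `w` and an integer due date `d`. -/
structure Instance where
  n : ℕ
  graph : SimpleGraph (Fin n)
  p : Fin n → ℕ
  p_pos : ∀ j, 1 ≤ p j
  w : Fin n → ℕ
  d : Fin n → ℤ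

/-- A schedule assigns to every job its completion time. -/
abbrev Instance.Schedule (I : Instance) : Type := Fin I.n → ℕ

/-- No job starts before time `0`, and the processing intervals `[C_i - p_i, C_i)` and
`[C_j - p_j, C_j)` of conflicting jobs are disjoint. -/
structure Instance.Feasible (I : Instance) (C : I.Schedule) : Prop where
  start_nonneg : ∀ j, 0 ≤ (C j : ℤ) - I.p j
  conflict : ∀ i j, I.graph.Adj i j →
    Set.Ico ((C i : ℤ) - I.p i) (C i) ∩ Set.Ico ((C j : ℤ) - I.p j) (C j) = ∅

/-- The lateness `L_j = C_j - d_j`. -/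
def Instance.lateness (I : Instance) (C : I.Schedule) (j : Fin I.n) : ℤ := (C j : ℤ) - I.d j

/-- The tardiness `T_j = max {0, C_j - d_j}`. -/
def Instance.tardiness (I : Instance) (C : I.Schedule) (j : Fin I.n) : ℤ :=
  max 0 ((C j : ℤ) - I.d j)

/-- The maximum weighted lateness `WL_max = max_j w_j L_j` (it is `⊥` if there are no jobs). -/
def Instance.maxWeightedLateness (I : Instance) (C : I.Schedule) : WithBot ℤ :=
  Finset.univ.sup fun j => (((I.w j : ℤ) * I.lateness C j : ℤ) : WithBot ℤ)

/-- The total weighted tardiness `∑ w_j T_j`. -/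
def Instance.totalWeightedTardiness (I : Instance) (C : I.Schedule) : ℤ :=
  ∑ j, (I.w j : ℤ) * I.tardiness C j

/-- `C` is feasible and minimizes the objective `f` among all feasible schedules. -/
def Instance.IsOptimal {α : Type*} [LE α] (I : Instance) (f : I.Schedule → α)
    (C : I.Schedule) : Prop :=
  I.Feasible C ∧ ∀ C' : I.Schedule, I.Feasible C' → f C ≤ f C'

/-! ### The machine model: first-order LISP programs

Data are binary trees built from cons cells.  A program is a finite list of function bodies that may
call one another (recursively).  Time counts the elementary operations.  Each of them (look up a
variable, allocate one cell, follow one pointer, test for `nil`, bind a variable, call a function)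
takes constant time on a pointer machine or random access machine, because values are passed as
pointers and cells are immutable and shared; so time in this model agrees up to a
polynomial with time on random access machines and on Turing machines. -/

/-- Data: binary trees of cons cells. -/
inductive Tree : Type
  | nil : Tree
  | cons : Tree → Tree → Tree

/-- The first component of a cell (`nil` for `nil`). -/
def Tree.hd : Tree → Tree
  | .nil => .nil
  | .cons a _ => a

/-- The second component of a cell (`nil` for `nil`). -/
def Tree.tl : Tree → Tree
  | .nil => .nil
  | .cons _ b => b

/-- The number of nodes of a tree (cells and `nil` leaves). -/
def Tree.size : Tree → ℕ
  | .nil => 1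
  | .cons a b => a.size + b.size + 1

/-- Program expressions. `var i` is the variable bound `i` levels up, `bind e b` evaluates `e`,
binds its value as a new variable `0` and evaluates `b`, `ite c a b` evaluates `a` if the value of
`c` is a cell and `b` if it is `nil`, and `call f e` calls function number `f` on the value of `e`. -/
inductive Code : Type
  | var : ℕ → Code
  | nil : Code
  | cons : Code → Code → Code
  | hd : Code → Code
  | tl : Code → Code
  | ite : Code → Code → Code → Code
  | bind : Code → Code → Code
  | call : ℕ → Code → Code

/-- A program: the list of the bodies of its (unary) functions; function `0` is the main one. -/
abbrev Program : Type := List Code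

/-- `Eval P env e v t`: in the program `P` and with the variables bound as in `env`, the expression
`e` evaluates to `v` in exactly `t` elementary operations.  (Nonterminating computations and calls
of undefined functions have no value.) -/
inductive Eval (P : Program) : List Tree → Code → Tree → ℕ → Prop
  | var (env : List Tree) (i : ℕ) : Eval P env (.var i) (env.getD i .nil) 1
  | nil (env : List Tree) : Eval P env .nil .nil 1
  | cons {env : List Tree} {e₁ e₂ : Code} {v₁ v₂ : Tree} {t₁ t₂ : ℕ} :
      Eval P env e₁ v₁ t₁ → Eval P env e₂ v₂ t₂ →
      Eval P env (.cons e₁ e₂) (.cons v₁ v₂) (t₁ + t₂ + 1)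
  | hd {env : List Tree} {e : Code} {v : Tree} {t : ℕ} :
      Eval P env e v t → Eval P env (.hd e) v.hd (t + 1)
  | tl {env : List Tree} {e : Code} {v : Tree} {t : ℕ} :
      Eval P env e v t → Eval P env (.tl e) v.tl (t + 1)
  | ite_cons {env : List Tree} {c a b : Code} {x y v : Tree} {t s : ℕ} :
      Eval P env c (.cons x y) t → Eval P env a v s → Eval P env (.ite c a b) v (t + s + 1)
  | ite_nil {env : List Tree} {c a b : Code} {v : Tree} {t s : ℕ} :
      Eval P env c .nil t → Eval P env b v s → Eval P env (.ite c a b) v (t + s + 1)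
  | bind {env : List Tree} {e b : Code} {u v : Tree} {t s : ℕ} :
      Eval P env e u t → Eval P (u :: env) b v s → Eval P env (.bind e b) v (t + s + 1)
  | call {env : List Tree} {f : ℕ} {e b : Code} {u v : Tree} {t s : ℕ} :
      P[f]? = some b → Eval P env e u t → Eval P [u] b v s →
      Eval P env (.call f e) v (t + s + 1)

/-- On input `x`, the program `P` halts with output `y` after exactly `t` elementary operations. -/
def Program.Outputs (P : Program) (x y : Tree) (t : ℕ) : Prop :=
  ∃ b, P[0]? = some b ∧ Eval P [x] b y t

/-! ### Input and output format: lists of cells, numbers in unary -/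

def encodeList (l : List Tree) : Tree := l.foldr .cons .nil

/-- Unary numbers. -/
def encodeNat (k : ℕ) : Tree := encodeList (List.replicate k .nil)

def encodeBool (b : Bool) : Tree := if b then .cons .nil .nil else .nil

/-- The sign bit together with the absolute value in unary. -/
def encodeInt (z : ℤ) : Tree := .cons (encodeBool (decide (z < 0))) (encodeNat z.natAbs)

open Classical in
/-- The list of all jobs `j`, each given by `p_j`, `w_j`, `d_j` and its row of the adjacency
matrix of the conflict graph. -/
noncomputable def Instance.encode (I : Instance) : Tree :=
  encodeList (List.ofFn fun j : Fin I.n =>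
    encodeList [encodeNat (I.p j), encodeNat (I.w j), encodeInt (I.d j),
      encodeList (List.ofFn fun i : Fin I.n => encodeBool (decide (I.graph.Adj j i)))])

/-- The total input length `|I|`. -/
noncomputable def Instance.size (I : Instance) : ℕ := I.encode.size

/-- The list of the completion times. -/
def encodeSchedule {n : ℕ} (C : Fin n → ℕ) : Tree :=
  encodeList (List.ofFn fun j => encodeNat (C j))

/-- The program `P` minimizes the objective `f` within time `B`: on every instance `I` and for every
`p` with `p_j ≤ p` for all jobs `j`, it outputs an optimal schedule after at most `B I p` elementary
operations.  (`p` is not part of the input.) -/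
def Program.SolvesWithin {α : Type*} [LE α] (P : Program) (f : (I : Instance) → I.Schedule → α)
    (B : Instance → ℕ → ℝ) : Prop :=
  ∀ (I : Instance) (p : ℕ), (∀ j, I.p j ≤ p) →
    ∃ (C : I.Schedule) (t : ℕ), I.IsOptimal (f I) C ∧
      P.Outputs I.encode (encodeSchedule C) t ∧ (t : ℝ) ≤ B I p

end ConcSched

/-! The proof combines a bound on the length of some optimal schedule, dynamic programming over a
tree decomposition, and a search for a decomposition whose bags are larger than optimal by a
constant factor only.

Short schedules suffice. Both objectives are monotone in the completion times, so a schedule may be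
shifted to the left until no job can start earlier (`Instance.exists_shifted`). If all bags of a
decomposition have at most `w` vertices, let each vertex own its edges into the topmost bag that
contains it; then every edge has an owner and no vertex owns more than `w` edges
(`Dec.exists_orientation`). Now let `X` be the jobs that start at `s` or later and `X'` those that
start at `s + 12wp` or later. Each job of `X'` is kept from starting at `4w` well separated times
after `s`, by `4w` different neighbours in `X`. Double counting by owners gives `4w|X'| ≤ w|X'| +
w|X|`, hence `2|X'| ≤ |X|` (`Instance.card_late_le`). After about `log n` halvings no job is left,
so completion times of order `w p log n` are enough (`Instance.exists_short`).

Dynamic programming. With so few possible completion times a bag of `O(k)` jobs has `(k p log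
n)^{O(k)}` labelings. A table keeps one cheapest extension for each consistent labeling of the root
bag. It is sound (`Problem.isSol_of_mem_table`) and optimal (`Problem.exists_mem_table`) for costs
in any ordered commutative monoid. The natural numbers with `+` give the weighted tardiness, and
with `max`, after adding an offset, the maximum weighted lateness.

Finding the decomposition. Vertices are added one by one (iterative compression): the new vertex
joins all bags of the current decomposition, which is then rebuilt with bags of at most `3k + 6`
vertices along separators that are balanced on the vertices prescribed for the root. If the
treewidth is at most `k`, a balanced separator of at most `k + 1` vertices exists
(`Dec.exists_isSplit`); the same dynamic program, with four labels on the current decomposition,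
finds one (`exists_findSep`).

The values `k = 0, 1, …` are tried until an attempt succeeds. Every success is optimal
(`attempt_eq_some`), and `k = tw` succeeds (`attempt_ne_none`), so the treewidth need not be known.
The cap on the number of labelings is handed over as a unary number, which makes an attempt an
ordinary polynomial time computation in its input and the cap; `exists_time_bound` turns this into
the claimed bound. Polynomial time is proved compositionally, by `fun_prop` from closure rules for
`PT`; recursions need an explicit bound on the sizes of intermediate values. -/

namespace ConcSched
open Polynomial

/-! ### Programs with time bounds -/

/-- Data types with a representation as trees of cons cells. -/
class Enc (α : Type) where
  enc : α → Tree

open Enc (enc)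

instance : Enc Unit := ⟨fun _ => .nil⟩
instance : Enc Bool := ⟨encodeBool⟩
instance : Enc ℕ := ⟨encodeNat⟩
instance {α β : Type} [Enc α] [Enc β] : Enc (α × β) := ⟨fun p => .cons (enc p.1) (enc p.2)⟩
instance {α : Type} [Enc α] : Enc (List α) := ⟨fun l => encodeList (l.map enc)⟩
instance {α : Type} [Enc α] : Enc (Option α) :=
  ⟨fun o => o.elim .nil fun a => .cons (enc a) .nil⟩

/-- The number of nodes of the representation. -/
def sz {α : Type} [Enc α] (a : α) : ℕ := (enc a).size

/-- Functions are called by position, and appending leaves the positions of the old ones unchanged.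
This is why programs are linked by extending them at the end. -/
theorem Eval.append {P : Program} {env : List Tree} {e : Code} {v : Tree} {t : ℕ} (Q : Program)
    (h : Eval P env e v t) : Eval (P ++ Q) env e v t := by
  induction h with
  | var env i => exact .var env i
  | nil env => exact .nil env
  | cons _ _ h1 h2 => exact .cons h1 h2
  | hd _ h => exact .hd h
  | tl _ h => exact .tl h
  | ite_cons _ _ h1 h2 => exact .ite_cons h1 h2
  | ite_nil _ _ h1 h2 => exact .ite_nil h1 h2
  | bind _ _ h1 h2 => exact .bind h1 h2
  | call hb _ _ h1 h2 =>
    refine .call ?_ h1 h2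
    rw [List.getElem?_append_left (List.getElem?_eq_some_iff.1 hb).1]
    exact hb

variable {α β γ δ σ : Type} [Enc α] [Enc β] [Enc γ] [Enc δ] [Enc σ]

/-- Every program can be extended so that `f` is computed by some expression within time `τ`. -/
def RunsIn (f : α → β) (τ : α → ℕ) : Prop :=
  ∀ Q : Program, ∃ (R : Program) (e : Code), ∀ x, ∃ t ≤ τ x,
    Eval (Q ++ R) [enc x] e (enc (f x)) t

/-- Makes the expression callable: it is appended as the last function body and called by its
position. -/
theorem RunsIn.exists_function {f : α → β} {τ : α → ℕ} (h : RunsIn f τ) (Q : Program) :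
    ∃ (R : Program) (m : ℕ) (b : Code), (Q ++ R)[m]? = some b ∧ ∀ x, ∃ t ≤ τ x,
      Eval (Q ++ R) [enc x] b (enc (f x)) t := by
  obtain ⟨R, e, he⟩ := h Q
  refine ⟨R ++ [e], (Q ++ R).length, e, by simp [← List.append_assoc], fun x => ?_⟩
  obtain ⟨t, ht, h⟩ := he x
  exact ⟨t, ht, by simpa [List.append_assoc] using h.append [e]⟩

theorem RunsIn.mono {f : α → β} {τ τ' : α → ℕ} (h : RunsIn f τ) (hτ : ∀ x, τ x ≤ τ' x) :
    RunsIn f τ' := fun Q => by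
  obtain ⟨R, e, he⟩ := h Q
  refine ⟨R, e, fun x => ?_⟩
  obtain ⟨t, ht, h⟩ := he x
  exact ⟨t, ht.trans (hτ x), h⟩

theorem RunsIn.of_code {f : α → β} {τ : α → ℕ} (e : Code)
    (h : ∀ P x, ∃ t ≤ τ x, Eval P [enc x] e (enc (f x)) t) : RunsIn f τ :=
  fun _ => ⟨[], e, fun x => h _ x⟩

theorem RunsIn.comp {g : β → γ} {f : α → β} {τ : β → ℕ} {τ' : α → ℕ} (hg : RunsIn g τ)
    (hf : RunsIn f τ') : RunsIn (fun x => g (f x)) (fun x => τ' x + τ (f x) + 1) := fun Q => by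
  obtain ⟨R, e, he⟩ := hf Q
  obtain ⟨R', m, b, hb, hm⟩ := hg.exists_function (Q ++ R)
  refine ⟨R ++ R', .call m e, fun x => ?_⟩
  obtain ⟨t, ht, h⟩ := he x
  obtain ⟨t', ht', h'⟩ := hm (f x)
  rw [← List.append_assoc]
  exact ⟨t + t' + 1, by dsimp only; omega, .call hb (h.append R') h'⟩

theorem RunsIn.pair {f : α → β} {g : α → γ} {τ τ' : α → ℕ} (hf : RunsIn f τ)
    (hg : RunsIn g τ') : RunsIn (fun x => (f x, g x)) (fun x => τ x + τ' x + 1) := fun Q => by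
  obtain ⟨R, e, he⟩ := hf Q
  obtain ⟨R', e', he'⟩ := hg (Q ++ R)
  refine ⟨R ++ R', .cons e e', fun x => ?_⟩
  obtain ⟨t, ht, h⟩ := he x
  obtain ⟨t', ht', h'⟩ := he' x
  rw [← List.append_assoc]
  exact ⟨t + t' + 1, by dsimp only; omega, .cons (h.append R') h'⟩

/-- Case distinction on whether the value of `c` is a cell; only one branch is evaluated. -/
theorem RunsIn.branch {c : α → β} {f g h : α → γ} {τc τ τ' τ'' : α → ℕ} (hc : RunsIn c τc)
    (hf : RunsIn f τ) (hg : RunsIn g τ')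
    (h1 : ∀ x, (enc (c x) ≠ .nil ∧ h x = f x ∧ τ x ≤ τ'' x) ∨
      (enc (c x) = .nil ∧ h x = g x ∧ τ' x ≤ τ'' x)) :
    RunsIn h (fun x => τc x + τ'' x + 1) := fun Q => by
  obtain ⟨R, e, he⟩ := hc Q
  obtain ⟨R', e', he'⟩ := hf (Q ++ R)
  obtain ⟨R'', e'', he''⟩ := hg (Q ++ R ++ R')
  refine ⟨R ++ R' ++ R'', .ite e e' e'', fun x => ?_⟩
  obtain ⟨t, ht, h⟩ := he x
  rw [← List.append_assoc, ← List.append_assoc]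
  rcases h1 x with ⟨hx, hh, hle⟩ | ⟨hx, hh, hle⟩ <;> rw [hh]
  · obtain ⟨t', ht', h'⟩ := he' x
    cases hcx : enc (c x) with
    | nil => exact absurd hcx hx
    | cons a b =>
      rw [hcx] at h
      exact ⟨t + t' + 1, by dsimp only; omega, .ite_cons ((h.append R').append R'') (h'.append R'')⟩
  · obtain ⟨t', ht', h'⟩ := he'' x
    rw [hx] at h
    exact ⟨t + t' + 1, by dsimp only; omega, .ite_nil ((h.append R').append R'') h'⟩

theorem RunsIn.foldr {h : α → β → σ → σ} {τ : α × β × σ → ℕ}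
    (hh : RunsIn (fun p : α × β × σ => h p.1 p.2.1 p.2.2) τ) (T : α × σ → List β → ℕ)
    (hT0 : ∀ p, 10 ≤ T p [])
    (hT : ∀ p b l, T p l + τ (p.1, b, l.foldr (h p.1) p.2) + 30 ≤ T p (b :: l)) :
    RunsIn (fun p : (α × σ) × List β => p.2.foldr (h p.1.1) p.1.2) (fun p => T p.1 p.2) :=
  fun Q => by
  obtain ⟨R, m, b, hb, hm⟩ := hh.exists_function Q
  -- The position that `body` will have once it is appended, so that it can call itself.
  set k := (Q ++ R).length with hk
  set body : Code := .ite (.tl (.var 0))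
    (.call m (.cons (.hd (.hd (.var 0))) (.cons (.hd (.tl (.var 0)))
      (.call k (.cons (.hd (.var 0)) (.tl (.tl (.var 0)))))))) (.tl (.hd (.var 0))) with hbody
  have hkb : (Q ++ (R ++ [body]))[k]? = some body := by simp [← List.append_assoc, hk]
  have hmb : (Q ++ (R ++ [body]))[m]? = some b := by
    rw [← List.append_assoc, List.getElem?_append_left (List.getElem?_eq_some_iff.1 hb).1, hb]
  refine ⟨R ++ [body], body, fun ⟨p, l⟩ => ?_⟩
  induction l with
  | nil =>
    refine ⟨_, ?_, .ite_nil (.tl (.var _ _)) (.tl (.hd (.var _ _)))⟩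
    exact le_trans (by norm_num) (hT0 p)
  | cons c l ih =>
    obtain ⟨t, ht, ih⟩ := ih
    obtain ⟨t', ht', h'⟩ := hm (p.1, c, l.foldr (h p.1) p.2)
    refine ⟨_, ?_, .ite_cons (.tl (.var _ _)) (.call hmb (.cons (.hd (.hd (.var _ _))) (.cons
      (.hd (.tl (.var _ _))) (.call hkb (.cons (.hd (.var _ _)) (.tl (.tl (.var _ _)))) ih)))
      (by rw [← List.append_assoc]; exact h'.append [body]))⟩
    have := hT p c l
    simp only at ht ⊢
    omega

/-! ### Polynomial time -/

theorem monotone_eval (q : ℕ[X]) : Monotone fun n => q.eval n := fun a b hab => by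
  simp only [eval_eq_sum_range]
  gcongr

theorem eval_le_eval (q : ℕ[X]) {a b : ℕ} (hab : a ≤ b) : q.eval a ≤ q.eval b :=
  monotone_eval q hab

/-- `f` is computable in polynomial time and has values of polynomial size. -/
@[fun_prop]
def PT (f : α → β) : Prop :=
  ∃ q : ℕ[X], (∀ x, sz (f x) ≤ q.eval (sz x)) ∧ RunsIn f fun x => q.eval (sz x)

theorem PT.of_runsIn {f : α → β} {τ : α → ℕ} (h : RunsIn f τ) (q q' : ℕ[X])
    (hq : ∀ x, sz (f x) ≤ q.eval (sz x)) (hq' : ∀ x, τ x ≤ q'.eval (sz x)) : PT f :=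
  ⟨q + q', fun x => (hq x).trans (by simp), h.mono fun x => (hq' x).trans (by simp)⟩

@[simp] theorem sz_pair (a : α) (b : β) : sz (a, b) = sz a + sz b + 1 := rfl
theorem sz_prod (p : α × β) : sz p = sz p.1 + sz p.2 + 1 := rfl
theorem sz_pos (a : α) : 1 ≤ sz a := by unfold sz; cases enc a <;> simp [Tree.size]
@[simp] theorem sz_nil : sz ([] : List α) = 1 := rfl
@[simp] theorem sz_cons (a : α) (l : List α) : sz (a :: l) = sz a + sz l + 1 := rfl
@[simp] theorem sz_none : sz (none : Option α) = 1 := rfl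
@[simp] theorem sz_some (a : α) : sz (some a) = sz a + 2 := rfl
@[simp] theorem sz_unit (a : Unit) : sz a = 1 := rfl
@[simp] theorem sz_zero : sz (0 : ℕ) = 1 := rfl
theorem sz_bool_le (b : Bool) : sz b ≤ 3 := by cases b <;> decide
@[simp] theorem sz_nat (n : ℕ) : sz n = 2 * n + 1 := by
  change (encodeNat n).size = _
  induction n with
  | zero => rfl
  | succ n ih =>
    rw [show encodeNat (n + 1) = .cons .nil (encodeNat n) from rfl]
    simp only [Tree.size, ih]
    ring


theorem PT.congr {f g : α → β} (h : PT f) (hfg : ∀ x, f x = g x) : PT g :=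
  funext hfg ▸ h

@[fun_prop]
theorem PT.id : PT (fun x : α => x) :=
  .of_runsIn (τ := fun _ => 1) (.of_code (.var 0) fun _ _ => ⟨1, le_rfl, .var _ _⟩) X 1
    (by simp) (by simp)

/-- The program that builds a given tree. -/
def constCode : Tree → Code
  | .nil => .nil
  | .cons a b => .cons (constCode a) (constCode b)

theorem eval_constCode (P : Program) (env : List Tree) (v : Tree) :
    Eval P env (constCode v) v v.size := by
  induction v with
  | nil => exact .nil _
  | cons a b ha hb => exact .cons ha hb

@[fun_prop]
theorem PT.const (b : β) : PT (fun _ : α => b) :=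
  .of_runsIn (τ := fun _ => sz b)
    (.of_code (constCode (enc b)) fun _ _ => ⟨_, le_rfl, eval_constCode _ _ _⟩)
    (C (sz b)) (C (sz b)) (by simp) (by simp)

@[fun_prop]
theorem PT.comp {g : β → γ} {f : α → β} (hg : PT g) (hf : PT f) : PT (fun x => g (f x)) := by
  obtain ⟨q, hq, h⟩ := hf
  obtain ⟨q', hq', h'⟩ := hg
  refine .of_runsIn (h'.comp h) (q'.comp q) (q + q'.comp q + 1) (fun x => ?_) fun x => ?_
  · rw [eval_comp]
    exact (hq' _).trans (eval_le_eval _ (hq x))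
  · simp only [eval_add, eval_comp, eval_one]
    gcongr
    exact eval_le_eval _ (hq x)

@[fun_prop]
theorem PT.prodMk {f : α → β} {g : α → γ} (hf : PT f) (hg : PT g) :
    PT (fun x => (f x, g x)) := by
  obtain ⟨q, hq, h⟩ := hf
  obtain ⟨q', hq', h'⟩ := hg
  refine .of_runsIn (h.pair h') (q + q' + 1) (q + q' + 1) (fun x => ?_) fun x => ?_
  · simpa using add_le_add (hq x) (hq' x)
  · simp

/-- Functions given by an expression without calls and cells. -/
theorem PT.of_code {f : α → β} (e : Code) (t : ℕ)
    (h : ∀ P x, Eval P [enc x] e (enc (f x)) t) (hs : ∀ x, sz (f x) ≤ sz x + t) : PT f :=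
  .of_runsIn (τ := fun _ => t) (.of_code e fun P x => ⟨t, le_rfl, h P x⟩) (X + C t) (C t)
    (by simpa using hs) (by simp)

theorem PT.fst' : PT (fun p : α × β => p.1) :=
  .of_code (.hd (.var 0)) 2 (fun _ _ => .hd (.var _ _)) fun x => by rw [sz_prod]; omega

theorem PT.snd' : PT (fun p : α × β => p.2) :=
  .of_code (.tl (.var 0)) 2 (fun _ _ => .tl (.var _ _)) fun x => by rw [sz_prod]; omega

@[fun_prop]
theorem PT.fst {f : α → β × γ} (hf : PT f) : PT (fun x => (f x).1) := PT.fst'.comp hf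

@[fun_prop]
theorem PT.snd {f : α → β × γ} (hf : PT f) : PT (fun x => (f x).2) := PT.snd'.comp hf

theorem PT.branch {c : α → β} {f g h : α → γ} (hc : PT c) (hf : PT f) (hg : PT g)
    (h1 : ∀ x, (enc (c x) ≠ .nil ∧ h x = f x) ∨ (enc (c x) = .nil ∧ h x = g x)) : PT h := by
  obtain ⟨q, -, h⟩ := hc
  obtain ⟨q', hq', h'⟩ := hf
  obtain ⟨q'', hq'', h''⟩ := hg
  refine .of_runsIn (h.branch h' h'' (τ'' := fun x => q'.eval (sz x) + q''.eval (sz x))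
    fun x => ?_) (q' + q'') (q + (q' + q'') + 1) (fun x => ?_) fun x => ?_
  · rcases h1 x with ⟨a, b⟩ | ⟨a, b⟩
    · exact .inl ⟨a, b, by omega⟩
    · exact .inr ⟨a, b, by omega⟩
  · rw [eval_add]
    rcases h1 x with ⟨a, b⟩ | ⟨a, b⟩ <;> rw [b]
    · exact (hq' x).trans (by omega)
    · exact (hq'' x).trans (by omega)
  · simp

@[fun_prop]
theorem PT.cond {c : α → Bool} {f g : α → γ} (hc : PT c) (hf : PT f) (hg : PT g) :
    PT (fun x => bif c x then f x else g x) :=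
  hc.branch hf hg fun x => by cases hx : c x <;> simp [enc, encodeBool]

@[fun_prop]
theorem PT.not {c : α → Bool} (hc : PT c) : PT (fun x => !c x) :=
  hc.branch (.const false) (.const true) fun x => by cases hx : c x <;> simp [enc, encodeBool]

@[fun_prop]
theorem PT.and {c d : α → Bool} (hc : PT c) (hd : PT d) : PT (fun x => c x && d x) :=
  hc.branch hd (.const false) fun x => by cases hx : c x <;> simp [enc, encodeBool]

@[fun_prop]
theorem PT.or {c d : α → Bool} (hc : PT c) (hd : PT d) : PT (fun x => c x || d x) :=
  hc.branch (.const true) hd fun x => by cases hx : c x <;> simp [enc, encodeBool]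

@[fun_prop]
theorem PT.optionSome {f : α → β} (hf : PT f) : PT (fun x => some (f x)) :=
  (PT.of_code (f := fun b : β => some b) (.cons (.var 0) .nil) 3
    (fun _ _ => .cons (.var _ _) (.nil _)) (fun _ => by rw [sz_some]; omega)).comp hf

@[fun_prop]
theorem PT.get {f : α → Option β} {d : α → β} (hf : PT f) (hd : PT d) :
    PT (fun x => (f x).getD (d x)) := by
  have h1 : PT (fun p : Option β × β => p.1.getD p.2) :=
    .of_runsIn (τ := fun _ => 7) (.of_code (.ite (.hd (.var 0)) (.hd (.hd (.var 0))) (.tl (.var 0)))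
      fun P ⟨o, d⟩ => by
        cases o with
        | none => exact ⟨_, by norm_num, .ite_nil (.hd (.var _ _)) (.tl (.var _ _))⟩
        | some b => exact ⟨_, by norm_num, .ite_cons (.hd (.var _ _)) (.hd (.hd (.var _ _)))⟩) X 7
      (fun ⟨o, d⟩ => by cases o <;> simp <;> omega) (fun _ => by simp)
  exact h1.comp (hf.prodMk hd)

@[fun_prop]
theorem PT.option_elim [Inhabited β] {o : α → Option β} {f : α → γ} {g : α → β → γ} (ho : PT o)
    (hf : PT f) (hg : PT fun p : α × β => g p.1 p.2) :
    PT (fun x => (o x).elim (f x) fun y => g x y) :=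
  -- The branch for a cell must be a total function, so the missing value is replaced by `default`;
  -- that branch is never taken for `none`.
  ho.branch (hg.comp (PT.id.prodMk (ho.get (.const default)))) hf fun x => by
    cases hx : o x <;> simp [enc]

@[fun_prop]
theorem PT.option_bind [Inhabited β] {o : α → Option β} {g : α → β → Option γ} (ho : PT o)
    (hg : PT fun p : α × β => g p.1 p.2) : PT (fun x => (o x).bind fun y => g x y) :=
  (ho.option_elim (.const none) hg).congr fun x => by cases o x <;> rfl

end ConcSched

namespace ConcSched
open Polynomial
open Enc (enc)
variable {α β γ δ σ : Type} [Enc α] [Enc β] [Enc γ] [Enc δ] [Enc σ]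

/-! ### Lists -/

/-- The running time of a right fold whose step takes time `τ`. -/
def foldTime (h : β → σ → σ) (τ : β → σ → ℕ) (s : σ) : List β → ℕ
  | [] => 10
  | b :: l => foldTime h τ s l + τ b (l.foldr h s) + 30

theorem RunsIn.list_foldr {h : α → β → σ → σ} {τ : α × β × σ → ℕ}
    (hh : RunsIn (fun p : α × β × σ => h p.1 p.2.1 p.2.2) τ) :
    RunsIn (fun p : (α × σ) × List β => p.2.foldr (h p.1.1) p.1.2)
      (fun p => foldTime (h p.1.1) (fun b s => τ (p.1.1, b, s)) p.1.2 p.2) :=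
  hh.foldr (fun p l => foldTime (h p.1) (fun b s => τ (p.1, b, s)) p.2 l) (fun _ => le_rfl)
    fun _ _ _ => le_rfl

omit [Enc β] [Enc σ] in
theorem foldTime_le {h : β → σ → σ} {τ : β → σ → ℕ} {s : σ} {l : List β} {c : ℕ}
    (hc : ∀ b l', (b :: l') <:+ l → τ b (l'.foldr h s) ≤ c) :
    foldTime h τ s l ≤ l.length * (c + 30) + 10 := by
  induction l with
  | nil => simp [foldTime]
  | cons b l ih =>
    have h1 := ih fun b l' hl => hc b l' (hl.trans (List.suffix_cons _ _))
    have h2 := hc b l List.suffix_rfl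
    simp only [foldTime, List.length_cons]
    nlinarith

theorem sz_le_of_mem {b : β} {l : List β} (h : b ∈ l) : sz b ≤ sz l := by
  induction l with
  | nil => cases h
  | cons c l ih =>
    rw [sz_cons]
    rcases List.mem_cons.1 h with rfl | h
    · omega
    · have := ih h; omega

theorem sz_le_of_sublist {l l' : List β} (h : l.Sublist l') : sz l ≤ sz l' := by
  induction h with
  | slnil => rfl
  | cons _ _ ih => rw [sz_cons]; omega
  | cons_cons _ _ ih => simp only [sz_cons]; omega

theorem length_le_sz (l : List β) : l.length ≤ sz l := by
  induction l with
  | nil => simp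
  | cons _ _ ih => simp only [sz_cons, List.length_cons]; omega

@[simp] theorem sz_append (l l' : List β) : sz (l ++ l') + 1 = sz l + sz l' := by
  induction l with
  | nil => simp; omega
  | cons _ _ ih => simp only [List.cons_append, sz_cons]; omega

theorem sz_le_of_forall {l : List β} {c : ℕ} (h : ∀ b ∈ l, sz b ≤ c) :
    sz l ≤ l.length * (c + 1) + 1 := by
  induction l with
  | nil => simp
  | cons b l ih =>
    have h1 := ih fun b hb => h b (List.mem_cons_of_mem _ hb)
    have h2 := h b List.mem_cons_self
    simp only [sz_cons, List.length_cons]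
    nlinarith

/-- Iterating a polynomial time step can square the size each time, so a bound `r` for the
accumulator is assumed. It is asked for all lists, which covers the suffixes met during the fold. -/
theorem PT.foldr {f : α → List β} {g : α → σ} {h : α → β → σ → σ}
    (hh : PT fun p : α × β × σ => h p.1 p.2.1 p.2.2) (hf : PT f) (hg : PT g) (r : ℕ[X])
    (hr : ∀ a (l : List β), sz (l.foldr (h a) (g a)) ≤ r.eval (sz a + sz l)) :
    PT (fun a => (f a).foldr (h a) (g a)) := by
  obtain ⟨q, hq, hf⟩ := hf
  obtain ⟨q', hq', hg⟩ := hg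
  obtain ⟨q'', hq'', hh⟩ := hh
  obtain ⟨qi, hqi, hi⟩ := PT.id (α := α)
  have key := hh.list_foldr.comp ((hi.pair hg).pair hf)
  refine .of_runsIn key (r.comp (X + q))
    (qi + q' + q + 3 + (q * (q''.comp (X + q + r.comp (X + q) + 2) + 30) + 10)) ?_ ?_
  · intro a
    refine (hr a (f a)).trans ?_
    rw [eval_comp]
    exact eval_le_eval _ (by simpa using hq a)
  · intro a
    have h1 := foldTime_le (h := h a) (τ := fun b s => q''.eval (sz (a, b, s))) (s := g a) (l := f a)
      (c := q''.eval (sz a + q.eval (sz a) + r.eval (sz a + q.eval (sz a)) + 2)) (by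
      intro b l' hl
      apply eval_le_eval
      have h1 := sz_le_of_mem (hl.subset List.mem_cons_self)
      have h2 := hr a l'
      have h3 := sz_le_of_sublist ((List.suffix_cons b l').trans hl).sublist
      have h4 := hq a
      have h5 := eval_le_eval r (show sz a + sz l' ≤ sz a + q.eval (sz a) by omega)
      simp only [sz_pair]
      omega)
    have h2 : (f a).length ≤ q.eval (sz a) := (length_le_sz _).trans (hq a)
    have h3 := Nat.mul_le_mul_right
      (q''.eval (sz a + q.eval (sz a) + r.eval (sz a + q.eval (sz a)) + 2) + 30) h2
    simp only [eval_add, eval_mul, eval_comp, eval_X, eval_ofNat] at *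
    omega

omit [Enc β] in
theorem sz_foldr_le {h : β → σ → σ} {s : σ} {l : List β} {c : ℕ}
    (hc : ∀ b ∈ l, ∀ s, sz (h b s) ≤ sz s + c) : sz (l.foldr h s) ≤ sz s + l.length * c := by
  induction l with
  | nil => simp
  | cons b l ih =>
    have h1 := ih fun b hb => hc b (List.mem_cons_of_mem _ hb)
    have h2 := hc b List.mem_cons_self (l.foldr h s)
    simp only [List.foldr_cons, List.length_cons]
    nlinarith

/-- The usual case: a step enlarges the accumulator by an amount that does not depend on the
accumulator, so the growth is at most linear in the number of steps. -/
theorem PT.foldr_of_add {f : α → List β} {g : α → σ} {h : α → β → σ → σ}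
    (hh : PT fun p : α × β × σ => h p.1 p.2.1 p.2.2) (hf : PT f) (hg : PT g) (r : ℕ[X])
    (hr : ∀ a b s, sz (h a b s) ≤ sz s + r.eval (sz a + sz b)) :
    PT (fun a => (f a).foldr (h a) (g a)) := by
  obtain ⟨q', hq', -⟩ := _root_.id hg
  refine PT.foldr hh hf hg (q' + X * r) fun a l => ?_
  refine (sz_foldr_le (c := r.eval (sz a + sz l)) fun b hb s => ?_).trans ?_
  · have := eval_le_eval r (show sz a + sz b ≤ sz a + sz l by have := sz_le_of_mem hb; omega)
    have := hr a b s
    omega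
  · rw [eval_add, eval_mul, eval_X]
    have h1 := (hq' a).trans (eval_le_eval q' (show sz a ≤ sz a + sz l by omega))
    have h2 := length_le_sz l
    gcongr
    omega

theorem PT.exists_bound {f : α × β → γ} (hf : PT f) :
    ∃ r : ℕ[X], ∀ a b, sz (f (a, b)) ≤ r.eval (sz a + sz b) := by
  obtain ⟨q, hq, -⟩ := hf
  refine ⟨q.comp (X + 1), fun a b => (hq _).trans ?_⟩
  rw [eval_comp]
  exact eval_le_eval _ (by simp)

@[fun_prop]
theorem PT.list_cons {f : α → β} {g : α → List β} (hf : PT f) (hg : PT g) :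
    PT (fun x => f x :: g x) :=
  (PT.of_code (f := fun p : β × List β => p.1 :: p.2) (.var 0) 1 (fun _ _ => .var _ _)
    fun x => by rw [sz_cons, sz_prod]; omega).comp (hf.prodMk hg)

@[fun_prop]
theorem PT.tail {f : α → List β} (hf : PT f) : PT (fun x => (f x).tail) :=
  (PT.of_code (f := fun l : List β => l.tail) (.tl (.var 0)) 2
    (fun P l => by
      have h : enc l.tail = (enc l).tl := by cases l <;> rfl
      rw [h]
      exact .tl (.var _ _)) fun l => by
      cases l <;> simp only [List.tail_nil, List.tail_cons, sz_cons] <;> omega).comp hf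

@[fun_prop]
theorem PT.head? {f : α → List β} (hf : PT f) : PT (fun x => (f x).head?) := by
  have h1 : PT (fun l : List β => l.head?) :=
    .of_runsIn (τ := fun _ => 8) (.of_code (.ite (.var 0) (.cons (.hd (.var 0)) .nil) .nil)
      fun P l => by
        cases l with
        | nil => exact ⟨_, by norm_num, .ite_nil (.var _ _) (.nil _)⟩
        | cons b l => exact ⟨_, by norm_num, .ite_cons (.var _ _) (.cons (.hd (.var _ _)) (.nil _))⟩)
      (X + 1) 8 (fun l => by cases l <;> simp) (fun _ => by simp)
  exact h1.comp hf

@[fun_prop]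
theorem PT.append {f g : α → List β} (hf : PT f) (hg : PT g) : PT (fun x => f x ++ g x) := by
  have h := PT.foldr_of_add (f := f) (g := g) (h := fun _ b s => b :: s) (by fun_prop) hf hg (X + 1)
    fun a b s => by simp; omega
  exact h.congr fun x => by simp

@[fun_prop]
theorem PT.map {f : α → List β} {g : α → β → γ} (hf : PT f) (hg : PT fun p : α × β => g p.1 p.2) :
    PT (fun x => (f x).map fun y => g x y) := by
  obtain ⟨r, hr⟩ := hg.exists_bound
  have h := PT.foldr_of_add (f := f) (g := fun _ => ([] : List γ)) (h := fun a b s => g a b :: s)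
    ((hg.comp (g := fun p : α × β => g p.1 p.2) (f := fun p : α × β × List γ => (p.1, p.2.1))
      (by fun_prop)).list_cons (by fun_prop)) hf (by fun_prop) (r + 1)
    fun a b s => by have := hr a b; simp at *; omega
  exact h.congr fun x => by induction f x <;> simp_all

@[fun_prop]
theorem PT.filter {f : α → List β} {g : α → β → Bool} (hf : PT f)
    (hg : PT fun p : α × β => g p.1 p.2) : PT (fun x => (f x).filter fun y => g x y) := by
  have h := PT.foldr_of_add (f := f) (g := fun _ => ([] : List β))
    (h := fun a b s => bif g a b then b :: s else s)
    (PT.cond (hg.comp (g := fun p : α × β => g p.1 p.2) (f := fun p : α × β × List β => (p.1, p.2.1))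
      (by fun_prop)) (by fun_prop) (by fun_prop)) hf (by fun_prop) (X + 1)
    fun a b s => by cases g a b <;> simp; omega
  exact h.congr fun x => by induction f x <;> simp_all [List.filter_cons, Bool.cond_eq_ite]

@[fun_prop]
theorem PT.flatMap {f : α → List β} {g : α → β → List γ} (hf : PT f)
    (hg : PT fun p : α × β => g p.1 p.2) : PT (fun x => (f x).flatMap fun y => g x y) := by
  obtain ⟨r, hr⟩ := hg.exists_bound
  have h := PT.foldr_of_add (f := f) (g := fun _ => ([] : List γ)) (h := fun a b s => g a b ++ s)
    ((hg.comp (g := fun p : α × β => g p.1 p.2) (f := fun p : α × β × List γ => (p.1, p.2.1))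
      (by fun_prop)).append (by fun_prop)) hf (by fun_prop) r
    fun a b s => by have := hr a b; have := sz_append (g a b) s; dsimp only at *; omega
  exact h.congr fun x => by induction f x <;> simp_all

@[fun_prop]
theorem PT.filterMap [Inhabited γ] {f : α → List β} {g : α → β → Option γ} (hf : PT f)
    (hg : PT fun p : α × β => g p.1 p.2) : PT (fun x => (f x).filterMap fun y => g x y) := by
  have h : PT fun x => (f x).flatMap fun y => (g x y).elim [] fun z => [z] :=
    hf.flatMap (hg.option_elim (by fun_prop) (by fun_prop))
  refine h.congr fun x => ?_
  induction f x with
  | nil => rfl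
  | cons b l ih => cases hb : g x b <;> simp_all

@[fun_prop]
theorem PT.all {f : α → List β} {g : α → β → Bool} (hf : PT f)
    (hg : PT fun p : α × β => g p.1 p.2) : PT (fun x => (f x).all fun y => g x y) := by
  have h := PT.foldr_of_add (f := f) (g := fun _ => true) (h := fun a b s => g a b && s)
    (PT.and (hg.comp (g := fun p : α × β => g p.1 p.2) (f := fun p : α × β × Bool => (p.1, p.2.1))
      (by fun_prop)) (by fun_prop)) hf (by fun_prop) 3
    fun a b s => (sz_bool_le _).trans (by simp)
  exact h.congr fun x => by induction f x <;> simp_all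

@[fun_prop]
theorem PT.any {f : α → List β} {g : α → β → Bool} (hf : PT f)
    (hg : PT fun p : α × β => g p.1 p.2) : PT (fun x => (f x).any fun y => g x y) := by
  have h : PT fun x => !((f x).all fun y => !(g x y)) := (hf.all hg.not).not
  exact h.congr fun x => by induction f x <;> simp_all

/-! ### Natural numbers -/

@[fun_prop]
theorem PT.succ {f : α → ℕ} (hf : PT f) : PT (fun x => f x + 1) :=
  (PT.of_code (f := fun n : ℕ => n + 1) (.cons .nil (.var 0)) 3
    (fun P n => .cons (.nil _) (.var _ _)) fun n => by simp; omega).comp hf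

@[fun_prop]
theorem PT.length {f : α → List β} (hf : PT f) : PT (fun x => (f x).length) := by
  have h := PT.foldr_of_add (f := f) (g := fun _ => 0) (h := fun _ _ s => s + 1) (by fun_prop) hf
    (by fun_prop) 2 fun a b s => by simp; omega
  exact h.congr fun x => by induction f x <;> simp_all

-- A unary number and the list of that many units are the same tree. Folds over lists thereby serve
-- as loops over numbers.
@[fun_prop]
theorem PT.replicate {f : α → ℕ} (hf : PT f) : PT (fun x => List.replicate (f x) ()) :=
  (PT.of_code (f := fun n : ℕ => List.replicate n ()) (.var 0) 1
    (fun P n => by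
      have h : enc (List.replicate n ()) = enc n := by simp [enc, encodeNat]
      rw [h]
      exact .var _ _) fun n => by
      have h : sz (List.replicate n ()) = sz n := by simp [sz, enc, encodeNat]
      rw [h]; omega).comp hf

@[fun_prop]
theorem PT.add {f g : α → ℕ} (hf : PT f) (hg : PT g) : PT (fun x => f x + g x) := by
  have h : PT fun x => (List.replicate (f x) () ++ List.replicate (g x) ()).length := by fun_prop
  exact h.congr fun x => by simp

@[fun_prop]
theorem PT.mul {f g : α → ℕ} (hf : PT f) (hg : PT g) : PT (fun x => f x * g x) := by
  have h : PT fun x => ((List.replicate (f x) ()).flatMap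
    fun _ => List.replicate (g x) ()).length := by fun_prop
  exact h.congr fun x => by simp

@[fun_prop]
theorem PT.sub {f g : α → ℕ} (hf : PT f) (hg : PT g) : PT (fun x => f x - g x) := by
  have h := PT.foldr_of_add (f := fun x => List.replicate (g x) ())
    (g := fun x => List.replicate (f x) ())
    (h := fun _ _ s => s.tail) (by fun_prop) (by fun_prop) (by fun_prop) 0
    fun a b s => by simpa using sz_le_of_sublist (List.tail_sublist s)
  refine h.length.congr fun x => ?_
  induction g x with
  | zero => simp
  | succ n ih => simp_all [List.replicate_succ]; omega

-- Truncated subtraction yields the tree `nil` exactly when `f x ≤ g x`, so a branch on the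
-- difference decides the comparison.
@[fun_prop]
theorem PT.ble {f g : α → ℕ} (hf : PT f) (hg : PT g) : PT (fun x => (f x).ble (g x)) := by
  have h : PT (fun x => f x - g x) := by fun_prop
  refine h.branch (.const false) (.const true) fun x => ?_
  rcases Nat.lt_or_ge (g x) (f x) with hx | hx
  · refine .inl ⟨?_, by rw [Bool.eq_false_iff, Ne, Nat.ble_eq]; omega⟩
    obtain ⟨m, hm⟩ := Nat.exists_eq_succ_of_ne_zero (Nat.sub_ne_zero_of_lt hx)
    rw [hm]
    exact fun h => Tree.noConfusion h
  · refine .inr ⟨?_, by simpa using hx⟩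
    rw [Nat.sub_eq_zero_of_le hx]
    rfl

@[fun_prop]
theorem PT.beq {f g : α → ℕ} (hf : PT f) (hg : PT g) : PT (fun x => f x == g x) := by
  have h : PT (fun x => (f x).ble (g x) && (g x).ble (f x)) := by fun_prop
  refine h.congr fun x => ?_
  rw [Bool.eq_iff_iff]
  simp
  omega

@[fun_prop]
theorem PT.max {f g : α → ℕ} (hf : PT f) (hg : PT g) : PT (fun x => max (f x) (g x)) := by
  have h : PT (fun x => f x + (g x - f x)) := by fun_prop
  exact h.congr fun x => by omega

@[fun_prop]
theorem PT.elem {f : α → ℕ} {g : α → List ℕ} (hf : PT f) (hg : PT g) :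
    PT (fun x => (g x).elem (f x)) := by
  have h : PT (fun x => (g x).any fun y => y == f x) := by fun_prop
  exact h.congr fun x => by rw [Bool.eq_iff_iff]; simp

@[fun_prop]
theorem PT.range {f : α → ℕ} (hf : PT f) : PT (fun x => List.range (f x)) := by
  have key : ∀ n, (List.replicate n ()).foldr (fun _ s => s ++ [s.length]) [] = List.range n := by
    intro n
    induction n with
    | zero => rfl
    | succ n ih => simp [List.replicate_succ, ih, List.range_succ]
  have h := PT.foldr (f := fun x => List.replicate (f x) ()) (g := fun _ => ([] : List ℕ))
    (h := fun _ _ s => s ++ [s.length]) (by fun_prop) (by fun_prop) (by fun_prop)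
    (X * (2 * X + 1 + 1) + 1) fun a l => by
      obtain ⟨n, rfl⟩ : ∃ n, l = List.replicate n () :=
        ⟨l.length, List.eq_replicate_iff.2 ⟨rfl, fun _ _ => rfl⟩⟩
      rw [key]
      refine (sz_le_of_forall (c := 2 * n + 1) fun b hb => ?_).trans ?_
      · have := List.mem_range.1 hb
        simp; omega
      · have h1 := length_le_sz (List.replicate n ())
        simp only [List.length_replicate, eval_add, eval_mul, eval_X, eval_ofNat, eval_one,
          List.length_range] at h1 ⊢
        have : n ≤ sz a + sz (List.replicate n ()) := by omega
        gcongr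
  exact h.congr fun x => key (f x)

@[fun_prop]
theorem PT.getD {f : α → List β} {g : α → ℕ} (d : β) (hf : PT f) (hg : PT g) :
    PT (fun x => (f x).getD (g x) d) := by
  have h := PT.foldr_of_add (f := fun x => List.replicate (g x) ())
    (g := f) (h := fun _ _ s => s.tail) (by fun_prop) (by fun_prop) (by fun_prop) 0
    fun a b s => by simpa using sz_le_of_sublist (List.tail_sublist s)
  refine (h.head?.get (.const d)).congr fun x => ?_
  rw [List.getD_eq_getElem?_getD, ← List.head?_drop]
  congr 2
  induction g x with
  | zero => simp
  | succ n ih => simp [List.replicate_succ, ih]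

end ConcSched

namespace ConcSched
open Polynomial
open Enc (enc)
variable {α β γ δ σ : Type} [Enc α] [Enc β] [Enc γ] [Enc δ] [Enc σ]

/-! ### Rooted binary tree decompositions -/

/-- Rooted binary trees of bags; `leaf` is the empty tree. -/
inductive Dec : Type
  | leaf : Dec
  | node : List ℕ → Dec → Dec → Dec

instance : Inhabited Dec := ⟨.leaf⟩

/-- The representation of a tree of bags. -/
def Dec.enc : Dec → Tree
  | .leaf => .nil
  | .node B l r => .cons (Enc.enc B) (.cons l.enc r.enc)

instance : Enc Dec := ⟨Dec.enc⟩

@[simp] theorem sz_leaf : sz Dec.leaf = 1 := rfl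
@[simp] theorem sz_node (B : List ℕ) (l r : Dec) :
    sz (Dec.node B l r) = sz B + (sz l + sz r + 1) + 1 := rfl

/-- Structural recursion on a tree of bags. -/
def Dec.fold {σ : Type} (s : σ) (h : List ℕ → σ → σ → σ) : Dec → σ
  | .leaf => s
  | .node B l r => h B (l.fold s h) (r.fold s h)

@[fun_prop]
theorem PT.node {B : α → List ℕ} {l r : α → Dec} (hB : PT B) (hl : PT l) (hr : PT r) :
    PT fun x => Dec.node (B x) (l x) (r x) :=
  (PT.of_code (f := fun p : List ℕ × Dec × Dec => Dec.node p.1 p.2.1 p.2.2) (.var 0) 1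
    (fun _ _ => .var _ _) fun x => by simp only [sz_node, sz_prod]; omega).comp
    (hB.prodMk (hl.prodMk hr))

/-- The running time of a structural recursion whose step takes time `τ`. -/
def decTime {σ : Type} (s : σ) (h : List ℕ → σ → σ → σ) (τ : List ℕ → σ → σ → ℕ) : Dec → ℕ
  | .leaf => 10
  | .node B l r => decTime s h τ l + decTime s h τ r + τ B (l.fold s h) (r.fold s h) + 50

omit [Enc σ] in
theorem decTime_le {s : σ} {h : List ℕ → σ → σ → σ} {τ : List ℕ → σ → σ → ℕ} {n c : ℕ}
    (hc : ∀ B l r, sz (Dec.node B l r) ≤ n → τ B (l.fold s h) (r.fold s h) ≤ c) (t : Dec)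
    (ht : sz t ≤ n) : decTime s h τ t ≤ sz t * (c + 60) := by
  induction t with
  | leaf => simp [decTime]
  | node B l r hl hr =>
    have h1 := hc B l r ht
    rw [sz_node] at ht ⊢
    have h2 := hl (by omega)
    have h3 := hr (by omega)
    simp only [decTime]
    nlinarith [sz_pos B]

theorem RunsIn.dec_fold {h : α → List ℕ → σ → σ → σ} {τ : α × List ℕ × σ × σ → ℕ}
    (hh : RunsIn (fun p : α × List ℕ × σ × σ => h p.1 p.2.1 p.2.2.1 p.2.2.2) τ) :
    RunsIn (fun p : (α × σ) × Dec => p.2.fold p.1.2 (h p.1.1))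
      (fun p => decTime p.1.2 (h p.1.1) (fun B s s' => τ (p.1.1, B, s, s')) p.2) := fun Q => by
  obtain ⟨R, m, b, hb, hm⟩ := hh.exists_function Q
  set k := (Q ++ R).length with hk
  set body : Code := .ite (.tl (.var 0))
    (.call m (.cons (.hd (.hd (.var 0))) (.cons (.hd (.tl (.var 0)))
      (.cons (.call k (.cons (.hd (.var 0)) (.hd (.tl (.tl (.var 0))))))
        (.call k (.cons (.hd (.var 0)) (.tl (.tl (.tl (.var 0)))))))))) (.tl (.hd (.var 0))) with hbody
  have hkb : (Q ++ (R ++ [body]))[k]? = some body := by simp [← List.append_assoc, hk]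
  have hmb : (Q ++ (R ++ [body]))[m]? = some b := by
    rw [← List.append_assoc, List.getElem?_append_left (List.getElem?_eq_some_iff.1 hb).1, hb]
  refine ⟨R ++ [body], body, fun ⟨p, t⟩ => ?_⟩
  induction t with
  | leaf =>
    refine ⟨_, ?_, .ite_nil (.tl (.var _ _)) (.tl (.hd (.var _ _)))⟩
    norm_num [decTime]
  | node B l r hl hr =>
    obtain ⟨t₁, ht₁, e₁⟩ := hl
    obtain ⟨t₂, ht₂, e₂⟩ := hr
    obtain ⟨t', ht', h'⟩ := hm (p.1, B, l.fold p.2 (h p.1), r.fold p.2 (h p.1))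
    refine ⟨_, ?_, .ite_cons (.tl (.var _ _)) (.call hmb (.cons (.hd (.hd (.var _ _))) (.cons
      (.hd (.tl (.var _ _))) (.cons
        (.call hkb (.cons (.hd (.var _ _)) (.hd (.tl (.tl (.var _ _))))) e₁)
        (.call hkb (.cons (.hd (.var _ _)) (.tl (.tl (.tl (.var _ _))))) e₂))))
      (by rw [← List.append_assoc]; exact h'.append [body]))⟩
    simp only [decTime] at ht₁ ht₂ ⊢
    omega

theorem PT.dec_fold {h : α → List ℕ → σ → σ → σ} {f : α → Dec} {g : α → σ}
    (hh : PT fun p : α × List ℕ × σ × σ => h p.1 p.2.1 p.2.2.1 p.2.2.2) (hf : PT f) (hg : PT g)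
    (r : ℕ[X]) (hr : ∀ a (t : Dec), sz (t.fold (g a) (h a)) ≤ r.eval (sz a + sz t)) :
    PT fun a => (f a).fold (g a) (h a) := by
  obtain ⟨q, hq, hf⟩ := hf
  obtain ⟨q', hq', hg⟩ := hg
  obtain ⟨q'', hq'', hh⟩ := hh
  obtain ⟨qi, hqi, hi⟩ := PT.id (α := α)
  refine .of_runsIn (hh.dec_fold.comp ((hi.pair hg).pair hf)) (r.comp (X + q))
    (qi + q' + q + 3 + (q * (q''.comp (X + q + 2 * r.comp (X + q) + 3) + 60))) ?_ ?_
  · intro a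
    refine (hr a (f a)).trans ?_
    rw [eval_comp]
    exact eval_le_eval _ (by simpa using hq a)
  · intro a
    have h1 := decTime_le (h := h a) (τ := fun B s s' => q''.eval (sz (a, B, s, s'))) (s := g a)
      (n := q.eval (sz a))
      (c := q''.eval (sz a + q.eval (sz a) + 2 * r.eval (sz a + q.eval (sz a)) + 3)) (by
      intro B t t' hl
      apply eval_le_eval
      rw [sz_node] at hl
      have h2 := (hr a t).trans (eval_le_eval r (show _ ≤ sz a + q.eval (sz a) by omega))
      have h3 := (hr a t').trans (eval_le_eval r (show _ ≤ sz a + q.eval (sz a) by omega))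
      simp only [sz_pair]
      omega) (f a) (hq a)
    have h3 := Nat.mul_le_mul_right
      (q''.eval (sz a + q.eval (sz a) + 2 * r.eval (sz a + q.eval (sz a)) + 3) + 60) (hq a)
    simp only [eval_add, eval_mul, eval_comp, eval_X, eval_ofNat] at *
    omega

/-! ### Recursion along a decreasing measure -/

/-- Recursion with three recursive calls, up to a given depth. -/
def treeRec {β γ σ : Type} (g : β → Option (γ × β × β × β)) (base : β → σ)
    (comb : γ → σ → σ → σ → σ) : ℕ → β → σ
  | 0, b => base b
  | n + 1, b => (g b).elim (base b) fun c =>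
      comb c.1 (treeRec g base comb n c.2.1) (treeRec g base comb n c.2.2.1)
        (treeRec g base comb n c.2.2.2)

/-- The measures of the three subproblems together drop by at least one. Hence there are at most `3
* μ b + 1` calls, since `(3x + 1) + (3y + 1) + (3z + 1) + 1 = 3(x + y + z + 1) + 1`, although the
depth may be as large as `μ b`. Arguments do not grow, so each call costs at most a fixed polynomial
in the size of the first argument. -/
theorem PT.treeRec {g : β → Option (γ × β × β × β)} {base : β → σ} {comb : γ → σ → σ → σ → σ}
    (hg : PT g) (hb : PT base) (hc : PT fun p : γ × σ × σ × σ => comb p.1 p.2.1 p.2.2.1 p.2.2.2)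
    (μ : β → ℕ) (hμ : ∀ b, μ b ≤ sz b)
    (hgμ : ∀ b c, g b = some c → μ c.2.1 + μ c.2.2.1 + μ c.2.2.2 + 1 ≤ μ b)
    (hgs : ∀ b c, g b = some c → sz c.2.1 ≤ sz b ∧ sz c.2.2.1 ≤ sz b ∧ sz c.2.2.2 ≤ sz b)
    (r : ℕ[X]) (hr : ∀ n b, sz (treeRec g base comb n b) ≤ r.eval (sz b)) :
    PT fun b => treeRec g base comb (μ b) b := by
  obtain ⟨qg, hqg, hg⟩ := hg
  obtain ⟨qb, hqb, hb⟩ := hb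
  obtain ⟨qc, hqc, hc⟩ := hc
  set K : ℕ[X] := qg + qb + qc.comp (qg + 3 * r + 3) + 60 with hK
  refine .of_runsIn (τ := fun b => (3 * μ b + 1) * K.eval (sz b)) ?_ r ((3 * X + 1) * K)
    (fun b => hr _ b) fun b => ?_
  swap
  · simp only [eval_mul, eval_add, eval_X, eval_ofNat, eval_one]
    have := hμ b
    gcongr
  intro Q
  obtain ⟨R₁, m₁, b₁, h₁, hg⟩ := hg.exists_function Q
  obtain ⟨R₂, m₂, b₂, h₂, hb⟩ := hb.exists_function (Q ++ R₁)
  obtain ⟨R₃, m₃, b₃, h₃, hc⟩ := hc.exists_function (Q ++ R₁ ++ R₂)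
  set k := (Q ++ R₁ ++ R₂ ++ R₃).length with hk
  set body : Code := .bind (.call m₁ (.var 0)) (.ite (.var 0)
    (.call m₃ (.cons (.hd (.hd (.var 0))) (.cons (.call k (.hd (.tl (.hd (.var 0)))))
      (.cons (.call k (.hd (.tl (.tl (.hd (.var 0)))))) (.call k (.tl (.tl (.tl (.hd (.var 0))))))))))
    (.call m₂ (.var 1))) with hbody
  have ext : ∀ {P P' : Program} {m : ℕ} {b : Code}, P[m]? = some b → (P ++ P')[m]? = some b :=
    fun {P P' m b} h => by
      rw [List.getElem?_append_left (List.getElem?_eq_some_iff.1 h).1, h]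
  have hk' : (Q ++ R₁ ++ R₂ ++ R₃ ++ [body])[k]? = some body := by simp [hk]
  refine ⟨R₁ ++ R₂ ++ R₃ ++ [body], body, ?_⟩
  simp only [← List.append_assoc]
  -- The program has no depth counter: it stops when `g` returns `none`, which happens at measure
  -- `0` at the latest. Therefore it computes `treeRec` for every depth `n ≥ μ b`. The number `c` is
  -- the size of the outermost argument and stays fixed in the induction.
  suffices H : ∀ n b c, μ b ≤ n → sz b ≤ c → ∃ t ≤ (3 * μ b + 1) * K.eval c,
      Eval (Q ++ R₁ ++ R₂ ++ R₃ ++ [body]) [enc b] body (enc (ConcSched.treeRec g base comb n b)) t from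
    fun b => H _ b _ le_rfl le_rfl
  have hnone : ∀ n b c, g b = none → sz b ≤ c → ∃ t ≤ (3 * μ b + 1) * K.eval c,
      Eval (Q ++ R₁ ++ R₂ ++ R₃ ++ [body]) [enc b] body (enc (ConcSched.treeRec g base comb n b)) t := by
    intro n b c hgb hsz
    have h0 : ConcSched.treeRec g base comb n b = base b := by
      cases n <;> simp [ConcSched.treeRec, hgb]
    rw [h0]
    obtain ⟨t₁, ht₁, e₁⟩ := hg b
    obtain ⟨t₂, ht₂, e₂⟩ := hb b
    rw [hgb] at e₁
    refine ⟨_, ?_, .bind (.call (ext (ext (ext h₁))) (.var _ _)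
      (((e₁.append R₂).append R₃).append [body])) (.ite_nil (.var _ _)
        (.call (ext (ext h₂)) (.var _ _) ((e₂.append R₃).append [body])))⟩
    have h1 := eval_le_eval qg hsz
    have h2 := eval_le_eval qb hsz
    have h3 : qg.eval c + qb.eval c + 60 ≤ K.eval c := by
      simp only [hK, eval_add, eval_ofNat]; omega
    nlinarith
  intro n
  induction n with
  | zero =>
    intro b c hb0 hsz
    refine hnone 0 b c ?_ hsz
    cases hgb : g b with
    | none => rfl
    | some c => have := hgμ b c hgb; omega
  | succ n ih =>
    intro b c hbn hsz
    cases hgb : g b with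
    | none => exact hnone _ b c hgb hsz
    | some d =>
      obtain ⟨d₀, d₁, d₂, d₃⟩ := d
      have hμd := hgμ b _ hgb
      have hsd := hgs b _ hgb
      dsimp only at hμd hsd
      obtain ⟨s₁, hs₁, f₁⟩ := ih d₁ c (by omega) (by omega)
      obtain ⟨s₂, hs₂, f₂⟩ := ih d₂ c (by omega) (by omega)
      obtain ⟨s₃, hs₃, f₃⟩ := ih d₃ c (by omega) (by omega)
      obtain ⟨t₁, ht₁, e₁⟩ := hg b
      obtain ⟨t₃, ht₃, e₃⟩ := hc (d₀, ConcSched.treeRec g base comb n d₁,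
        ConcSched.treeRec g base comb n d₂, ConcSched.treeRec g base comb n d₃)
      rw [hgb] at e₁
      have h0 : ConcSched.treeRec g base comb (n + 1) b = comb d₀ (ConcSched.treeRec g base comb n d₁)
        (ConcSched.treeRec g base comb n d₂) (ConcSched.treeRec g base comb n d₃) := by
        simp [ConcSched.treeRec, hgb]
      rw [h0]
      refine ⟨_, ?_, .bind (.call (ext (ext (ext h₁))) (.var _ _)
        (((e₁.append R₂).append R₃).append [body])) (.ite_cons (.var _ _)
          (.call (ext h₃) (.cons (.hd (.hd (.var _ _))) (.cons
            (.call hk' (.hd (.tl (.hd (.var _ _)))) f₁) (.cons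
            (.call hk' (.hd (.tl (.tl (.hd (.var _ _))))) f₂)
            (.call hk' (.tl (.tl (.tl (.hd (.var _ _))))) f₃)))) (e₃.append [body])))⟩
      have h1 := eval_le_eval qg hsz
      have hd0 : sz d₀ ≤ qg.eval c := by
        have := hqg b
        rw [hgb, sz_some, sz_prod] at this
        dsimp only at this
        omega
      have r₁ := (hr n d₁).trans (eval_le_eval r (hsd.1.trans hsz))
      have r₂ := (hr n d₂).trans (eval_le_eval r (hsd.2.1.trans hsz))
      have r₃ := (hr n d₃).trans (eval_le_eval r (hsd.2.2.trans hsz))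
      have h2 := ht₃.trans (eval_le_eval qc (b := (qg + 3 * r + 3).eval c) (by
        simp only [sz_pair, eval_add, eval_mul, eval_ofNat]
        omega))
      have h3 : qg.eval c + qc.eval ((qg + 3 * r + 3).eval c) + 60 ≤ K.eval c := by
        simp only [hK, eval_add, eval_comp, eval_ofNat]
        omega
      have h4 : (3 * μ b + 1) * K.eval c ≥ (3 * μ d₁ + 1) * K.eval c + (3 * μ d₂ + 1) * K.eval c +
        (3 * μ d₃ + 1) * K.eval c + K.eval c := by nlinarith
      omega

end ConcSched

namespace ConcSched
open Polynomial
open Enc (enc)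
variable {α β γ δ σ : Type} [Enc α] [Enc β] [Enc γ] [Enc δ] [Enc σ]

/-! ### Dynamic programming over a tree of bags -/

/-- The list `l` if it has at most `N` elements, and otherwise nothing. -/
def capped {β : Type} (N : ℕ) (l : List β) : List β := bif l.length.ble N then l else []

theorem capped_of_le {β : Type} {N : ℕ} {l : List β} (h : l.length ≤ N) : capped N l = l := by
  simp [capped, Nat.ble_eq_true_of_le h]

theorem mem_of_mem_capped {β : Type} {N : ℕ} {l : List β} {b : β} (h : b ∈ capped N l) : b ∈ l := by
  unfold capped at h
  cases h' : l.length.ble N <;> simp_all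

theorem length_capped_le {β : Type} (N : ℕ) (l : List β) : (capped N l).length ≤ N := by
  unfold capped
  cases h' : l.length.ble N
  · simp
  · simpa using h'

@[fun_prop]
theorem PT.capped {N : α → ℕ} {l : α → List β} (hN : PT N) (hl : PT l) :
    PT fun x => capped (N x) (l x) := by
  unfold ConcSched.capped
  fun_prop

/-- All assignments of labels from `L` to the elements of `B`, provided there are at most `N`. -/
def enum (L : List ℕ) (N : ℕ) (B : List ℕ) : List (List (ℕ × ℕ)) :=
  B.foldr (fun v s => capped N (s.flatMap fun ψ => L.map fun x => (v, x) :: ψ)) [[]]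

@[simp] theorem enum_nil (L : List ℕ) (N : ℕ) : enum L N [] = [[]] := rfl

theorem enum_cons (L : List ℕ) (N : ℕ) (v : ℕ) (B : List ℕ) : enum L N (v :: B) =
    capped N ((enum L N B).flatMap fun ψ => L.map fun x => (v, x) :: ψ) := rfl

/-- The cap keeps the enumeration polynomial, as `N` is part of the input in unary; if it is
exceeded, solutions are lost but no time. The extra `1` is for the empty bag with `N = 0`. -/
theorem length_enum_le (L : List ℕ) (N : ℕ) (B : List ℕ) : (enum L N B).length ≤ N + 1 := by
  cases B with
  | nil => simp
  | cons v B => exact (length_capped_le _ _).trans (by omega)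

theorem enum_cons_subset {L : List ℕ} {N : ℕ} {v : ℕ} {B : List ℕ} {ψ : List (ℕ × ℕ)}
    (h : ψ ∈ enum L N (v :: B)) : ∃ x ∈ L, ∃ ψ' ∈ enum L N B, ψ = (v, x) :: ψ' := by
  have := mem_of_mem_capped (enum_cons L N v B ▸ h)
  simp only [List.mem_flatMap, List.mem_map] at this
  obtain ⟨ψ', h', x, hx, rfl⟩ := this
  exact ⟨x, hx, ψ', h', rfl⟩

theorem sz_le_of_mem_enum {L : List ℕ} {N : ℕ} {B : List ℕ} {ψ : List (ℕ × ℕ)}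
    (h : ψ ∈ enum L N B) : sz ψ ≤ sz B * (sz L + 4) := by
  induction B generalizing ψ with
  | nil => simp at h; simp [h]
  | cons v B ih =>
    obtain ⟨x, hx, ψ', h', rfl⟩ := enum_cons_subset h
    have h1 := ih h'
    have h2 := sz_le_of_mem hx
    rw [sz_cons, sz_cons, sz_pair]
    nlinarith [sz_pos L, sz_pos v]

theorem map_fst_of_mem_enum {L : List ℕ} {N : ℕ} {B : List ℕ} {ψ : List (ℕ × ℕ)}
    (h : ψ ∈ enum L N B) : ψ.map Prod.fst = B ∧ ∀ e ∈ ψ, e.2 ∈ L := by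
  induction B generalizing ψ with
  | nil => simp at h; simp [h]
  | cons v B ih =>
    obtain ⟨x, hx, ψ', h', rfl⟩ := enum_cons_subset h
    obtain ⟨h1, h2⟩ := ih h'
    exact ⟨by simp [h1], List.forall_mem_cons.2 ⟨hx, h2⟩⟩

theorem length_enum_le_pow {L : List ℕ} {N : ℕ} {B : List ℕ} :
    (enum L N B).length ≤ L.length ^ B.length := by
  induction B with
  | nil => simp
  | cons v B ih =>
    rw [enum_cons]
    have : ∀ l : List (List (ℕ × ℕ)), (capped N l).length ≤ l.length := fun l => by
      unfold capped
      cases l.length.ble N <;> simp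
    refine (this _).trans ?_
    simp only [List.length_flatMap, List.length_map, List.map_const', List.sum_replicate,
      List.length_cons, pow_succ, smul_eq_mul]
    gcongr

/-- Since there is at least one label, the powers for the shorter lists are bounded by `N` as well,
and the cap never takes effect. -/
theorem mem_enum {L : List ℕ} {N : ℕ} {B : List ℕ} (hL : L ≠ []) (hN : L.length ^ B.length ≤ N)
    (φ : ℕ → ℕ) (h : ∀ v ∈ B, φ v ∈ L) : (B.map fun v => (v, φ v)) ∈ enum L N B := by
  induction B with
  | nil => simp
  | cons v B ih =>
    have hpos : 0 < L.length := List.length_pos_of_ne_nil hL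
    have h1 : L.length ^ B.length ≤ N :=
      (Nat.pow_le_pow_right hpos (by simp)).trans hN
    have h2 := ih h1 fun v hv => h v (List.mem_cons_of_mem _ hv)
    rw [enum_cons, capped_of_le]
    · simp only [List.mem_flatMap, List.mem_map, List.map_cons]
      exact ⟨_, h2, φ v, h v List.mem_cons_self, rfl⟩
    · refine le_trans ?_ hN
      simp only [List.length_flatMap, List.length_map, List.map_const', List.sum_replicate,
        List.length_cons, pow_succ, smul_eq_mul]
      gcongr
      exact length_enum_le_pow

@[fun_prop]
theorem PT.enum {L : α → List ℕ} {N : α → ℕ} {B : α → List ℕ} (hL : PT L) (hN : PT N)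
    (hB : PT B) : PT fun x => enum (L x) (N x) (B x) := by
  refine PT.foldr (g := fun _ => [[]])
    (h := fun x v s => ConcSched.capped (N x) (s.flatMap fun ψ => (L x).map fun y => (v, y) :: ψ))
    (by fun_prop) hB (by fun_prop)
    (r := ?_) ?_
  · exact (hN.choose + 1) * (X * (hL.choose + 4) + 1) + 1
  · intro a l
    have h1 := hL.choose_spec.1 a
    have h2 := hN.choose_spec.1 a
    have h3 := eval_le_eval hL.choose (show sz a ≤ sz a + sz l by omega)
    have h4 := eval_le_eval hN.choose (show sz a ≤ sz a + sz l by omega)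
    refine (sz_le_of_forall fun ψ hψ => sz_le_of_mem_enum hψ).trans ?_
    simp only [eval_add, eval_mul, eval_X, eval_one, eval_ofNat]
    have h5 := length_enum_le (L a) (N a) l
    rw [sz_nat] at h2
    gcongr
    · refine h5.trans ?_
      omega
    · omega
    · omega

/-- Costs: an ordered commutative monoid with polynomial time operations. -/
class CostMonoid (M : Type) [AddCommMonoid M] [LinearOrder M] [Enc M] : Prop extends
    IsOrderedAddMonoid M where
  pt_add : PT fun p : M × M => p.1 + p.2
  pt_le : PT fun p : M × M => decide (p.1 ≤ p.2)
  sz_add_le : ∀ a b : M, sz (a + b) ≤ sz a + sz b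

variable {M : Type} [AddCommMonoid M] [LinearOrder M] [Enc M]

/-- An element of `l` with minimum cost. -/
def minBy {β : Type} (f : β → M) (l : List β) : Option β :=
  l.foldr (fun b s => s.elim (some b) fun c => bif decide (f b ≤ f c) then some b else some c) none

omit [AddCommMonoid M] [Enc M] in
theorem exists_minBy {β : Type} (f : β → M) {l : List β} {b : β} (hb : b ∈ l) :
    ∃ c, minBy f l = some c ∧ f c ≤ f b := by
  induction l generalizing b with
  | nil => cases hb
  | cons d l ih =>
    rw [minBy, List.foldr_cons, ← minBy]
    cases hl : minBy f l with
    | none =>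
      rcases List.mem_cons.1 hb with rfl | hb
      · exact ⟨_, rfl, le_rfl⟩
      · obtain ⟨c, hc, -⟩ := ih hb
        simp [hl] at hc
    | some c =>
      have hc : b ∈ l → f c ≤ f b := fun hb => by
        obtain ⟨c', hc', h⟩ := ih hb
        simp_all
      by_cases hdc : f d ≤ f c
      · refine ⟨d, by simp [hdc], ?_⟩
        rcases List.mem_cons.1 hb with rfl | hb
        · rfl
        · exact hdc.trans (hc hb)
      · refine ⟨c, by simp [hdc], ?_⟩
        rcases List.mem_cons.1 hb with rfl | hb
        · exact (not_le.1 hdc).le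
        · exact hc hb

omit [AddCommMonoid M] [Enc M] in
theorem minBy_mem {β : Type} {f : β → M} {l : List β} {c : β} (hc : minBy f l = some c) :
    c ∈ l := by
  induction l generalizing c with
  | nil => cases hc
  | cons d l ih =>
    rw [minBy, List.foldr_cons, ← minBy] at hc
    cases hl : minBy f l with
    | none => simp_all
    | some c' =>
      have := ih hl
      by_cases hdc : f d ≤ f c' <;> simp_all

theorem CostMonoid.le [CostMonoid M] {f g : α → M} (hf : PT f) (hg : PT g) :
    PT fun x => decide (f x ≤ g x) :=
  CostMonoid.pt_le.comp (hf.prodMk hg)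

theorem PT.minBy [CostMonoid M] [Inhabited β] {f : α → List β} {c : α → β → M} (hf : PT f)
    (hc : PT fun p : α × β => c p.1 p.2) : PT fun x => minBy (c x) (f x) := by
  refine PT.foldr_of_add (g := fun _ => none)
    (h := fun x b s => s.elim (some b) fun c' => bif decide (c x b ≤ c x c') then some b else some c')
    ?_ hf (by fun_prop) (X + 2) fun a b s => ?_
  · refine PT.option_elim (by fun_prop) (by fun_prop) (.cond (CostMonoid.le ?_ ?_) (by fun_prop)
      (by fun_prop))
    · exact hc.comp (f := fun p : (α × β × Option β) × β => (p.1.1, p.1.2.1)) (by fun_prop)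
    · exact hc.comp (f := fun p : (α × β × Option β) × β => (p.1.1, p.2)) (by fun_prop)
  · cases s with
    | none => simp; omega
    | some c' => cases h : decide (c a b ≤ c a c') <;> simp [h]; omega

/-! ### Labeling problems and their tables -/

/-- A labeling problem: `ok` tells which pairs of labeled vertices are compatible, `cost` is the
cost of a labeled vertex, `lab` the list of labels and `cap` a bound for the number of labelings of
a bag.  All depend on a context. -/
structure Problem (α M : Type) where
  ok : α × (ℕ × ℕ) × (ℕ × ℕ) → Bool
  cost : α × (ℕ × ℕ) → M
  lab : α → List ℕ
  cap : α → ℕ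

/-- All parts of the problem are computable in polynomial time. -/
structure Problem.IsPT (p : Problem α M) : Prop where
  ok : PT p.ok
  cost : PT p.cost
  lab : PT p.lab
  cap : PT p.cap

namespace Problem

variable (p : Problem α M) (a : α)

/-- The total cost of an assignment. -/
def total {α : Type} (p : Problem α M) (a : α) (s : List (ℕ × ℕ)) : M :=
  (s.map fun e => p.cost (a, e)).sum

end Problem

/-- The part of an assignment outside of `B`. -/
def dropOn (B : List ℕ) (s : List (ℕ × ℕ)) : List (ℕ × ℕ) := s.filter fun e => !B.elem e.1

/-- The assignments agree on the common part of their domains. -/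
def agree (s s' : List (ℕ × ℕ)) : Bool :=
  s.all fun e => s'.all fun e' => !(e.1 == e'.1) || e.2 == e'.2

namespace Problem

/-- All pairs in an assignment are compatible. -/
def consistent {α : Type} (p : Problem α M) (a : α) (s : List (ℕ × ℕ)) : Bool :=
  s.all fun e => s.all fun e' => p.ok (a, e, e')

/-- The cheapest assignment in `tab`, outside of `B`, among those that agree with `s`. -/
def best {α : Type} (p : Problem α M) (a : α) (B : List ℕ) (s : List (ℕ × ℕ))
    (tab : List (List (ℕ × ℕ))) : Option (List (ℕ × ℕ)) :=
  minBy (fun s' => p.total a (dropOn B s')) (tab.filter fun s' => agree s' s)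

/-- One step of the dynamic program. -/
def step {α : Type} (p : Problem α M) (a : α) (B : List ℕ) (tl tr : List (List (ℕ × ℕ))) :
    List (List (ℕ × ℕ)) :=
  ((enum (p.lab a) (p.cap a) B).filter fun s => p.consistent a s).filterMap fun s =>
    (p.best a B s tl).bind fun sl => (p.best a B s tr).bind fun sr =>
      some (s ++ dropOn B sl ++ dropOn B sr)

/-- For each consistent labeling of the root bag, a best extension to all vertices. -/
def table {α : Type} (p : Problem α M) (a : α) (t : Dec) : List (List (ℕ × ℕ)) :=
  t.fold [[]] (p.step a)

/-- A best assignment. -/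
def solve {α : Type} (p : Problem α M) (a : α) (t : Dec) : Option (List (ℕ × ℕ)) :=
  minBy (p.total a) (p.table a t)

end Problem

@[fun_prop]
theorem PT.dropOn {B : α → List ℕ} {s : α → List (ℕ × ℕ)} (hB : PT B) (hs : PT s) :
    PT fun x => dropOn (B x) (s x) := by
  unfold ConcSched.dropOn
  fun_prop

@[fun_prop]
theorem PT.agree {s s' : α → List (ℕ × ℕ)} (hs : PT s) (hs' : PT s') :
    PT fun x => agree (s x) (s' x) := by
  unfold ConcSched.agree
  fun_prop

theorem Problem.IsPT.total [CostMonoid M] {p : Problem α M} (hp : p.IsPT) {a : β → α}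
    {s : β → List (ℕ × ℕ)} (ha : PT a) (hs : PT s) : PT fun x => p.total (a x) (s x) := by
  obtain ⟨r, hr⟩ := hp.cost.exists_bound
  have h1 : PT fun x : α × List (ℕ × ℕ) => p.total x.1 x.2 := by
    have h := PT.foldr_of_add (f := fun x : α × List (ℕ × ℕ) => x.2) (g := fun _ => (0 : M))
      (h := fun a e c => p.cost (a.1, e) + c)
      (CostMonoid.pt_add.comp ((hp.cost.comp (by fun_prop)).prodMk (by fun_prop))) (by fun_prop)
      (by fun_prop) r fun a e c => by
        refine (CostMonoid.sz_add_le _ _).trans ?_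
        have h1 := hr a.1 e
        have h2 := eval_le_eval r (show sz a.1 + sz e ≤ sz a + sz e by rw [sz_prod a]; omega)
        omega
    refine h.congr fun x => ?_
    unfold Problem.total
    induction x.2 <;> simp_all
  exact h1.comp (ha.prodMk hs)

omit [AddCommMonoid M] [LinearOrder M] in
theorem Problem.IsPT.consistent {p : Problem α M} (hp : p.IsPT) {a : β → α}
    {s : β → List (ℕ × ℕ)} (ha : PT a) (hs : PT s) : PT fun x => p.consistent (a x) (s x) := by
  have := hp.ok
  unfold Problem.consistent
  fun_prop

theorem Problem.IsPT.best [CostMonoid M] {p : Problem α M} (hp : p.IsPT) {a : β → α}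
    {B : β → List ℕ} {s : β → List (ℕ × ℕ)} {tab : β → List (List (ℕ × ℕ))} (ha : PT a) (hB : PT B)
    (hs : PT s) (ht : PT tab) : PT fun x => p.best (a x) (B x) (s x) (tab x) := by
  unfold Problem.best
  exact PT.minBy (by fun_prop) (hp.total (by fun_prop) (by fun_prop))

theorem sz_dropOn_le (B : List ℕ) (s : List (ℕ × ℕ)) : sz (dropOn B s) ≤ sz s :=
  sz_le_of_sublist List.filter_sublist

omit [AddCommMonoid M] [LinearOrder M] [Enc M] [Enc α] in
theorem Problem.mem_step [AddCommMonoid M] [LinearOrder M] {p : Problem α M} {a : α} {B : List ℕ}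
    {tl tr : List (List (ℕ × ℕ))}
    {s : List (ℕ × ℕ)} : s ∈ p.step a B tl tr ↔ ∃ ψ ∈ enum (p.lab a) (p.cap a) B,
      p.consistent a ψ = true ∧ ∃ sl sr, p.best a B ψ tl = some sl ∧ p.best a B ψ tr = some sr ∧
      s = ψ ++ dropOn B sl ++ dropOn B sr := by
  simp only [Problem.step, List.mem_filterMap, List.mem_filter, Option.bind_eq_some_iff,
    Option.some.injEq]
  constructor
  · rintro ⟨ψ, ⟨h1, h2⟩, sl, hl, sr, hr, rfl⟩
    exact ⟨ψ, h1, h2, sl, sr, hl, hr, rfl⟩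
  · rintro ⟨ψ, h1, h2, sl, sr, hl, hr, rfl⟩
    exact ⟨ψ, ⟨h1, h2⟩, sl, hl, sr, hr, rfl⟩

omit [AddCommMonoid M] [LinearOrder M] [Enc M] [Enc α] in
theorem Problem.best_mem [AddCommMonoid M] [LinearOrder M] {p : Problem α M} {a : α} {B : List ℕ}
    {ψ s : List (ℕ × ℕ)}
    {tab : List (List (ℕ × ℕ))} (h : p.best a B ψ tab = some s) : s ∈ tab ∧ agree s ψ = true := by
  simpa using minBy_mem h

-- An entry has at most one label per occurrence of a vertex in a bag, so its size does not depend
-- on the number of entries in the tables below. Together with `length_table_le` this is the size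
-- bound that the fold over the tree requires.
omit [Enc M] [Enc α] in
theorem Problem.sz_le_of_mem_table {p : Problem α M} {a : α} {t : Dec} {s : List (ℕ × ℕ)}
    (hs : s ∈ p.table a t) : sz s ≤ sz t * (sz (p.lab a) + 4) := by
  induction t generalizing s with
  | leaf =>
    simp [table, Dec.fold] at hs
    simp [hs]
  | node B l r hl hr =>
    obtain ⟨ψ, hψ, -, sl, sr, h1, h2, rfl⟩ := Problem.mem_step.1 hs
    have h3 := hl (Problem.best_mem h1).1
    have h4 := hr (Problem.best_mem h2).1
    have h5 := sz_le_of_mem_enum hψ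
    have h6 := sz_append ψ (dropOn B sl)
    have h7 := sz_append (ψ ++ dropOn B sl) (dropOn B sr)
    have h8 := sz_dropOn_le B sl
    have h9 := sz_dropOn_le B sr
    rw [sz_node]
    nlinarith

omit [Enc M] [Enc α] in
theorem Problem.length_table_le (p : Problem α M) (a : α) (t : Dec) :
    (p.table a t).length ≤ p.cap a + 1 := by
  cases t with
  | leaf => simp [table, Dec.fold]
  | node B l r =>
    exact (List.length_filterMap_le _ _).trans ((List.length_filter_le _ _).trans
      (length_enum_le _ _ _))

theorem Problem.IsPT.step [CostMonoid M] {p : Problem α M} (hp : p.IsPT) {a : β → α}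
    {B : β → List ℕ} {tl tr : β → List (List (ℕ × ℕ))} (ha : PT a) (hB : PT B) (hl : PT tl)
    (hr : PT tr) : PT fun x => p.step (a x) (B x) (tl x) (tr x) := by
  have hlab := hp.lab
  have hcap := hp.cap
  unfold Problem.step
  have h1 : PT fun x : β => enum (p.lab (a x)) (p.cap (a x)) (B x) := by fun_prop
  have h2 : PT fun x : β => (enum (p.lab (a x)) (p.cap (a x)) (B x)).filter
      fun s => p.consistent (a x) s := PT.filter h1 (hp.consistent (by fun_prop) (by fun_prop))
  have h3 : PT fun z : β × List (ℕ × ℕ) => p.best (a z.1) (B z.1) z.2 (tl z.1) :=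
    hp.best (by fun_prop) (by fun_prop) (by fun_prop) (by fun_prop)
  have h4 : PT fun z : (β × List (ℕ × ℕ)) × List (ℕ × ℕ) =>
      p.best (a z.1.1) (B z.1.1) z.1.2 (tr z.1.1) :=
    hp.best (by fun_prop) (by fun_prop) (by fun_prop) (by fun_prop)
  have h5 : PT fun z : ((β × List (ℕ × ℕ)) × List (ℕ × ℕ)) × List (ℕ × ℕ) =>
      some (z.1.1.2 ++ dropOn (B z.1.1.1) z.1.2 ++ dropOn (B z.1.1.1) z.2) := by fun_prop
  exact h2.filterMap (h3.option_bind (h4.option_bind h5))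

omit [Enc M] in
theorem Problem.sz_table_le (p : Problem α M) {q q' : ℕ[X]} (hq : ∀ a, sz (p.lab a) ≤ q.eval (sz a))
    (hq' : ∀ a, sz (p.cap a) ≤ q'.eval (sz a)) (a : α) (t : Dec) {n : ℕ} (hn : sz a + sz t ≤ n) :
    sz (p.table a t) ≤ ((q' + 1) * (X * (q + 4) + 1) + 1).eval n := by
  have h1 := (hq a).trans (eval_le_eval q (show sz a ≤ n by omega))
  have h2 := (hq' a).trans (eval_le_eval q' (show sz a ≤ n by omega))
  refine (sz_le_of_forall fun s hs => Problem.sz_le_of_mem_table (p := p) (a := a) hs).trans ?_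
  have h3 := p.length_table_le a t
  rw [sz_nat] at h2
  simp only [eval_add, eval_mul, eval_X, eval_one, eval_ofNat]
  gcongr
  · refine h3.trans ?_
    omega
  · omega

theorem Problem.IsPT.table [CostMonoid M] {p : Problem α M} (hp : p.IsPT) {a : β → α}
    {t : β → Dec} (ha : PT a) (ht : PT t) : PT fun x => p.table (a x) (t x) := by
  obtain ⟨q, hq, -⟩ := hp.lab
  obtain ⟨q', hq', -⟩ := hp.cap
  have hstep : PT fun z : (α × Dec) × List ℕ × List (List (ℕ × ℕ)) × List (List (ℕ × ℕ)) =>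
      p.step z.1.1 z.2.1 z.2.2.1 z.2.2.2 :=
    hp.step (by fun_prop) (by fun_prop) (by fun_prop) (by fun_prop)
  have h1 : PT fun x : α × Dec => x.2.fold [[]] (p.step x.1) := by
    refine PT.dec_fold (h := fun x : α × Dec => p.step x.1) (f := fun x => x.2)
      (g := fun _ => [[]]) hstep (by fun_prop) (by fun_prop)
      ((q' + 1) * (X * (q + 4) + 1) + 1) fun x t => ?_
    have := p.sz_table_le hq hq' x.1 t (n := sz x + sz t) (by rw [sz_prod x]; omega)
    exact this
  have h2 := h1.comp (ha.prodMk ht)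
  exact h2

theorem Problem.IsPT.solve [CostMonoid M] {p : Problem α M} (hp : p.IsPT) {a : β → α}
    {t : β → Dec} (ha : PT a) (ht : PT t) : PT fun x => p.solve (a x) (t x) :=
  PT.minBy (hp.table ha ht) (hp.total (by fun_prop) (by fun_prop))

end ConcSched

namespace ConcSched

/-! ### Correctness of the dynamic program -/

namespace Dec

/-- The bag of the root. -/
def root : Dec → List ℕ
  | leaf => []
  | node B _ _ => B

/-- All vertices in the bags. -/
def verts : Dec → Finset ℕ
  | leaf => ∅
  | node B l r => B.toFinset ∪ l.verts ∪ r.verts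

/-- The list of all bags. -/
def bags : Dec → List (List ℕ)
  | leaf => []
  | node B l r => B :: (l.bags ++ r.bags)

/-- The bags have no repetitions, and the nodes whose bags contain a given vertex are connected. -/
def Valid : Dec → Prop
  | leaf => True
  | node B l r => B.Nodup ∧ l.Valid ∧ r.Valid ∧ (∀ v ∈ l.verts, v ∈ r.verts → v ∈ B) ∧
      (∀ v ∈ l.verts, v ∈ B → v ∈ l.root) ∧ ∀ v ∈ r.verts, v ∈ B → v ∈ r.root

/-- Adjacent vertices lie in a common bag. -/
def Covers (t : Dec) (adj : ℕ → ℕ → Prop) : Prop :=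
  ∀ u ∈ t.verts, ∀ v ∈ t.verts, adj u v → ∃ b ∈ t.bags, u ∈ b ∧ v ∈ b

theorem mem_verts_node {B : List ℕ} {l r : Dec} {v : ℕ} :
    v ∈ (node B l r).verts ↔ v ∈ B ∨ v ∈ l.verts ∨ v ∈ r.verts := by
  simp [verts]

theorem mem_verts_of_mem_bag {t : Dec} {b : List ℕ} {v : ℕ} (hb : b ∈ t.bags) (hv : v ∈ b) :
    v ∈ t.verts := by
  induction t with
  | leaf => cases hb
  | node B l r hl hr =>
    rw [mem_verts_node]
    simp only [bags, List.mem_cons, List.mem_append] at hb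
    rcases hb with rfl | hb | hb
    · exact .inl hv
    · exact .inr (.inl (hl hb))
    · exact .inr (.inr (hr hb))

theorem root_mem_bags {t : Dec} {v : ℕ} (hv : v ∈ t.root) : t.root ∈ t.bags := by
  cases t with
  | leaf => cases hv
  | node B l r => simp [bags, root]

theorem Covers.left {B : List ℕ} {l r : Dec} {adj : ℕ → ℕ → Prop} (hv : (node B l r).Valid)
    (h : (node B l r).Covers adj) : l.Covers adj := by
  obtain ⟨-, -, -, h1, h2, -⟩ := hv
  intro u hu v hv huv
  obtain ⟨b, hb, hub, hvb⟩ := h u (mem_verts_node.2 (.inr (.inl hu))) v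
    (mem_verts_node.2 (.inr (.inl hv))) huv
  simp only [bags, List.mem_cons, List.mem_append] at hb
  rcases hb with rfl | hb | hb
  · exact ⟨_, root_mem_bags (h2 u hu hub), h2 u hu hub, h2 v hv hvb⟩
  · exact ⟨b, hb, hub, hvb⟩
  · have h3 := h2 u hu (h1 u hu (mem_verts_of_mem_bag hb hub))
    exact ⟨_, root_mem_bags h3, h3, h2 v hv (h1 v hv (mem_verts_of_mem_bag hb hvb))⟩

theorem Valid.swap {B : List ℕ} {l r : Dec} (h : (node B l r).Valid) : (node B r l).Valid :=
  ⟨h.1, h.2.2.1, h.2.1, fun v h1 h2 => h.2.2.2.1 v h2 h1, h.2.2.2.2.2, h.2.2.2.2.1⟩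

theorem Covers.swap {B : List ℕ} {l r : Dec} {adj : ℕ → ℕ → Prop} (h : (node B l r).Covers adj) :
    (node B r l).Covers adj := by
  intro u hu v hv huv
  obtain ⟨b, hb, h'⟩ := h u (by rw [mem_verts_node] at *; tauto) v
    (by rw [mem_verts_node] at *; tauto) huv
  exact ⟨b, by simp only [bags, List.mem_cons, List.mem_append] at *; tauto, h'⟩

theorem Covers.right {B : List ℕ} {l r : Dec} {adj : ℕ → ℕ → Prop} (hv : (node B l r).Valid)
    (h : (node B l r).Covers adj) : r.Covers adj :=
  Covers.left hv.swap h.swap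

end Dec

theorem mem_dropOn {B : List ℕ} {s : List (ℕ × ℕ)} {e : ℕ × ℕ} :
    e ∈ dropOn B s ↔ e ∈ s ∧ e.1 ∉ B := by
  simp [dropOn]

theorem agree_iff {s s' : List (ℕ × ℕ)} :
    agree s s' = true ↔ ∀ e ∈ s, ∀ e' ∈ s', e.1 = e'.1 → e.2 = e'.2 := by
  simp [agree, ← imp_iff_not_or]

namespace Problem

variable {α M : Type} [AddCommMonoid M] [LinearOrder M] {p : Problem α M} {a : α}

omit [AddCommMonoid M] [LinearOrder M] in
theorem consistent_iff {s : List (ℕ × ℕ)} :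
    p.consistent a s = true ↔ ∀ e ∈ s, ∀ e' ∈ s, p.ok (a, e, e') = true := by
  simp [consistent]

/-- `s` assigns labels to all vertices of `t`, and all pairs are compatible. -/
structure IsSol {α M : Type} (p : Problem α M) (a : α) (t : Dec) (s : List (ℕ × ℕ)) : Prop where
  nodup : (s.map Prod.fst).Nodup
  mem : ∀ v, v ∈ s.map Prod.fst ↔ v ∈ t.verts
  lab : ∀ e ∈ s, e.2 ∈ p.lab a
  ok : ∀ e ∈ s, ∀ e' ∈ s, p.ok (a, e, e') = true

omit [AddCommMonoid M] [LinearOrder M] in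
theorem IsSol.mem_verts {t : Dec} {s : List (ℕ × ℕ)} (h : p.IsSol a t s) {e : ℕ × ℕ} (he : e ∈ s) :
    e.1 ∈ t.verts :=
  (h.mem _).1 (List.mem_map_of_mem he)

/-- By `hok` and `Covers`, only pairs in a common bag can be incompatible. A vertex of one child
outside `B` and a vertex of the other child outside `B` share no bag. If a vertex of `B` shares a
bag with a vertex of a child outside `B`, it belongs to that child too, where it has the same label
because the entries agree; so the pair was checked inside the child. -/
theorem isSol_of_mem_table {adj : ℕ → ℕ → Prop}
    (hok : ∀ e e' : ℕ × ℕ, e.1 ≠ e'.1 → ¬adj e.1 e'.1 → p.ok (a, e, e') = true) {t : Dec}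
    (hv : t.Valid) (hc : t.Covers adj) {s : List (ℕ × ℕ)} (hs : s ∈ p.table a t) :
    p.IsSol a t s := by
  induction t generalizing s with
  | leaf =>
    simp [table, Dec.fold] at hs
    subst hs
    exact ⟨by simp, by simp [Dec.verts], by simp, by simp⟩
  | node B l r hl hr =>
    obtain ⟨ψ, hψ, hcon, sl, sr, h1, h2, rfl⟩ := mem_step.1 hs
    obtain ⟨hl1, hl2⟩ := best_mem h1
    obtain ⟨hr1, hr2⟩ := best_mem h2
    have hL := hl hv.2.1 (hc.left hv) hl1
    have hR := hr hv.2.2.1 (hc.right hv) hr1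
    obtain ⟨hB, hlab⟩ := map_fst_of_mem_enum hψ
    rw [consistent_iff] at hcon
    rw [agree_iff] at hl2 hr2
    have hψB : ∀ e ∈ ψ, e.1 ∈ B := fun e he => hB ▸ List.mem_map_of_mem he
    -- an entry of the root bag and an entry of a child
    have key : ∀ c sc, (c = l ∧ sc = sl ∨ c = r ∧ sc = sr) → p.IsSol a c sc →
        (∀ e ∈ sc, ∀ e' ∈ ψ, e.1 = e'.1 → e.2 = e'.2) → ∀ e ∈ ψ, ∀ e' ∈ dropOn B sc,
        p.ok (a, e, e') = true ∧ p.ok (a, e', e) = true := by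
      intro c sc hcc hsol hag e he e' he'
      obtain ⟨he', heB⟩ := mem_dropOn.1 he'
      have hne : e.1 ≠ e'.1 := fun h => heB (h ▸ hψB e he)
      have hadj : ∀ b ∈ (Dec.node B l r).bags, e.1 ∈ b → e'.1 ∈ b → e.1 ∈ c.verts := by
        intro b hb heb heb'
        simp only [Dec.bags, List.mem_cons, List.mem_append] at hb
        have hcv := hsol.mem_verts he'
        rcases hb with rfl | hb | hb
        · exact absurd heb' heB
        · rcases hcc with ⟨rfl, rfl⟩ | ⟨rfl, rfl⟩
          · exact Dec.mem_verts_of_mem_bag hb heb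
          · exact absurd (hv.2.2.2.1 _ (Dec.mem_verts_of_mem_bag hb heb') hcv) heB
        · rcases hcc with ⟨rfl, rfl⟩ | ⟨rfl, rfl⟩
          · exact absurd (hv.2.2.2.1 _ hcv (Dec.mem_verts_of_mem_bag hb heb')) heB
          · exact Dec.mem_verts_of_mem_bag hb heb
      have hev : e.1 ∈ (Dec.node B l r).verts := Dec.mem_verts_node.2 (.inl (hψB e he))
      have hev' : e'.1 ∈ (Dec.node B l r).verts := by
        have := hsol.mem_verts he'
        rw [Dec.mem_verts_node]
        rcases hcc with ⟨rfl, rfl⟩ | ⟨rfl, rfl⟩ <;> tauto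
      have hmem : e.1 ∈ c.verts → e ∈ sc := by
        intro h
        obtain ⟨e'', he'', h'⟩ := List.mem_map.1 ((hsol.mem _).2 h)
        have := hag e'' he'' e he h'
        rwa [show e = e'' from Prod.ext h'.symm this.symm]
      constructor
      · by_cases h : adj e.1 e'.1
        · obtain ⟨b, hb, hb1, hb2⟩ := hc _ hev _ hev' h
          exact hsol.ok e (hmem (hadj b hb hb1 hb2)) e' he'
        · exact hok _ _ hne h
      · by_cases h : adj e'.1 e.1
        · obtain ⟨b, hb, hb1, hb2⟩ := hc _ hev' _ hev h
          exact hsol.ok e' he' e (hmem (hadj b hb hb2 hb1))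
        · exact hok _ _ hne.symm h
    have key' : ∀ e ∈ dropOn B sl, ∀ e' ∈ dropOn B sr,
        p.ok (a, e, e') = true ∧ p.ok (a, e', e) = true := by
      intro e he e' he'
      obtain ⟨he, heB⟩ := mem_dropOn.1 he
      obtain ⟨he', heB'⟩ := mem_dropOn.1 he'
      have hel := hL.mem_verts he
      have her := hR.mem_verts he'
      have hadj : ∀ b ∈ (Dec.node B l r).bags, e.1 ∈ b → e'.1 ∈ b → False := by
        intro b hb heb heb'
        simp only [Dec.bags, List.mem_cons, List.mem_append] at hb
        rcases hb with rfl | hb | hb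
        · exact heB heb
        · exact heB' (hv.2.2.2.1 _ (Dec.mem_verts_of_mem_bag hb heb') her)
        · exact heB (hv.2.2.2.1 _ hel (Dec.mem_verts_of_mem_bag hb heb))
      have hne : e.1 ≠ e'.1 := fun h => heB (hv.2.2.2.1 _ hel (h ▸ her))
      have hev : e.1 ∈ (Dec.node B l r).verts := Dec.mem_verts_node.2 (.inr (.inl hel))
      have hev' : e'.1 ∈ (Dec.node B l r).verts := Dec.mem_verts_node.2 (.inr (.inr her))
      constructor
      · refine hok _ _ hne fun h => ?_
        obtain ⟨b, hb, hb1, hb2⟩ := hc _ hev _ hev' h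
        exact hadj b hb hb1 hb2
      · refine hok _ _ hne.symm fun h => ?_
        obtain ⟨b, hb, hb1, hb2⟩ := hc _ hev' _ hev h
        exact hadj b hb hb2 hb1
    have keyl := key l sl (.inl ⟨rfl, rfl⟩) hL hl2
    have keyr := key r sr (.inr ⟨rfl, rfl⟩) hR hr2
    refine ⟨?_, ?_, ?_, ?_⟩
    · rw [List.map_append, List.map_append, hB]
      refine List.nodup_append'.2 ⟨List.nodup_append'.2 ⟨hv.1, ?_, ?_⟩, ?_, ?_⟩
      · exact hL.nodup.sublist (List.filter_sublist.map _)
      · intro v hv hv'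
        obtain ⟨e, he, rfl⟩ := List.mem_map.1 hv'
        exact (mem_dropOn.1 he).2 hv
      · exact hR.nodup.sublist (List.filter_sublist.map _)
      · intro v hv1 hv'
        obtain ⟨e, he, rfl⟩ := List.mem_map.1 hv'
        obtain ⟨he, heB⟩ := mem_dropOn.1 he
        rcases List.mem_append.1 hv1 with h | h
        · exact heB h
        · obtain ⟨e', he', h⟩ := List.mem_map.1 h
          have := hL.mem_verts (mem_dropOn.1 he').1
          exact heB (hv.2.2.2.1 _ (h ▸ this) (hR.mem_verts he))
    · intro v
      rw [List.map_append, List.map_append, hB, Dec.mem_verts_node, List.mem_append,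
        List.mem_append, or_assoc, ← hL.mem, ← hR.mem]
      by_cases hvB : v ∈ B
      · simp [hvB]
      · have : ∀ s : List (ℕ × ℕ), v ∈ (dropOn B s).map Prod.fst ↔ v ∈ s.map Prod.fst := by
          intro s
          simp only [List.mem_map, mem_dropOn]
          constructor
          · rintro ⟨e, ⟨h, -⟩, rfl⟩
            exact ⟨e, h, rfl⟩
          · rintro ⟨e, h, rfl⟩
            exact ⟨e, ⟨h, hvB⟩, rfl⟩
        rw [this, this]
    · intro e he
      simp only [List.mem_append, mem_dropOn] at he
      rcases he with (he | he) | he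
      · exact hlab e he
      · exact hL.lab e he.1
      · exact hR.lab e he.1
    · intro e he e' he'
      rw [List.mem_append, List.mem_append] at he he'
      rcases he with (he | he) | he <;> rcases he' with (he' | he') | he'
      · exact hcon e he e' he'
      · exact (keyl e he e' he').1
      · exact (keyr e he e' he').1
      · exact (keyl e' he' e he).2
      · exact hL.ok e (mem_dropOn.1 he).1 e' (mem_dropOn.1 he').1
      · exact (key' e he e' he').1
      · exact (keyr e' he' e he).2
      · exact (key' e' he' e he).2
      · exact hR.ok e (mem_dropOn.1 he).1 e' (mem_dropOn.1 he').1

-- An entry of a child is cheap outside the child's root bag `R`, whereas the parent compares costs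
-- outside its own bag `B`. The difference comes from the vertices of `R` not in `B`, whose labels
-- are those of `φ`. It is stated as a sum because `M` has no subtraction.
omit [LinearOrder M] in
theorem total_dropOn {s : List (ℕ × ℕ)} (hs : (s.map Prod.fst).Nodup) {R B : List ℕ} {φ : ℕ → ℕ}
    (hR : ∀ e ∈ s, e.1 ∈ R → e.2 = φ e.1) (hB : ∀ e ∈ s, e.1 ∈ B → e.1 ∈ R) :
    p.total a (dropOn B s) = p.total a (dropOn R s) +
      ∑ v ∈ (s.map Prod.fst).toFinset with v ∈ R ∧ v ∉ B, p.cost (a, (v, φ v)) := by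
  induction s with
  | nil => simp [dropOn]
  | cons e s ih =>
    rw [List.map_cons, List.nodup_cons] at hs
    have ih := ih hs.2 (fun e he => hR e (List.mem_cons_of_mem _ he))
      fun e he => hB e (List.mem_cons_of_mem _ he)
    have h1 := hR e List.mem_cons_self
    have h2 := hB e List.mem_cons_self
    have h3 : e.1 ∉ (s.map Prod.fst).toFinset := by simpa using hs.1
    rw [List.map_cons, List.toFinset_cons, Finset.filter_insert]
    unfold dropOn at *
    rw [List.filter_cons, List.filter_cons]
    by_cases hr : e.1 ∈ R
    · by_cases hb : e.1 ∈ B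
      · simpa [hr, hb] using ih
      · rw [if_pos (by simpa using hb), if_neg (by simpa using hr), if_pos ⟨hr, hb⟩,
          Finset.sum_insert fun h => h3 (Finset.mem_filter.1 h).1, ← h1 hr]
        simp only [total, List.map_cons, List.sum_cons] at *
        rw [ih]
        abel
    · have hb : e.1 ∉ B := fun h => hr (h2 h)
      rw [if_pos (by simpa using hb), if_pos (by simpa using hr), if_neg (by tauto)]
      simp only [total, List.map_cons, List.sum_cons] at *
      rw [ih]
      abel

-- The induction compares with one fixed solution `φ`: some entry coincides with `φ` on the root bag
-- and is at most as expensive elsewhere. The root bag is left out of the cost because the parent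
-- may share these vertices and must not count them twice.
set_option maxHeartbeats 400000 in
theorem exists_mem_table [IsOrderedAddMonoid M] {adj : ℕ → ℕ → Prop}
    (hok : ∀ e e' : ℕ × ℕ, e.1 ≠ e'.1 → ¬adj e.1 e'.1 → p.ok (a, e, e') = true) {t : Dec}
    (hv : t.Valid) (hc : t.Covers adj) (hlab : p.lab a ≠ [])
    (hcap : ∀ b ∈ t.bags, (p.lab a).length ^ b.length ≤ p.cap a) {φ : ℕ → ℕ}
    (hφ : ∀ v ∈ t.verts, φ v ∈ p.lab a)
    (hφok : ∀ u ∈ t.verts, ∀ v ∈ t.verts, p.ok (a, (u, φ u), (v, φ v)) = true) :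
    ∃ s ∈ p.table a t, (∀ e ∈ s, e.1 ∈ t.root → e.2 = φ e.1) ∧
      p.total a (dropOn t.root s) ≤ ∑ v ∈ t.verts with v ∉ t.root, p.cost (a, (v, φ v)) := by
  induction t with
  | leaf => exact ⟨[], by simp [table, Dec.fold], by simp, by simp [Dec.verts, dropOn, total]⟩
  | node B l r hl hr =>
    have hsubl : ∀ v ∈ l.verts, v ∈ (Dec.node B l r).verts := fun v h =>
      Dec.mem_verts_node.2 (.inr (.inl h))
    have hsubr : ∀ v ∈ r.verts, v ∈ (Dec.node B l r).verts := fun v h =>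
      Dec.mem_verts_node.2 (.inr (.inr h))
    have hl := hl hv.2.1 (hc.left hv) (fun b hb => hcap b (by simp [Dec.bags, hb]))
      (fun v h => hφ v (hsubl v h)) fun u hu v hv => hφok u (hsubl u hu) v (hsubl v hv)
    have hr := hr hv.2.2.1 (hc.right hv) (fun b hb => hcap b (by simp [Dec.bags, hb]))
      (fun v h => hφ v (hsubr v h)) fun u hu v hv => hφok u (hsubr u hu) v (hsubr v hv)
    set ψ := B.map fun v => (v, φ v) with hψ
    have hψmem : ψ ∈ enum (p.lab a) (p.cap a) B :=
      mem_enum hlab (hcap B (by simp [Dec.bags])) φ fun v hv => hφ v (Dec.mem_verts_node.2 (.inl hv))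
    have hψcon : p.consistent a ψ = true := by
      rw [consistent_iff]
      simp only [hψ, List.mem_map]
      rintro _ ⟨u, hu, rfl⟩ _ ⟨v, hv, rfl⟩
      exact hφok u (Dec.mem_verts_node.2 (.inl hu)) v (Dec.mem_verts_node.2 (.inl hv))
    have key : ∀ c : Dec, c.Valid → c.Covers adj → (∀ v ∈ c.verts, v ∈ B → v ∈ c.root) →
        (∃ s ∈ p.table a c, (∀ e ∈ s, e.1 ∈ c.root → e.2 = φ e.1) ∧
          p.total a (dropOn c.root s) ≤ ∑ v ∈ c.verts with v ∉ c.root, p.cost (a, (v, φ v))) →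
        ∃ s, p.best a B ψ (p.table a c) = some s ∧
          p.total a (dropOn B s) ≤ ∑ v ∈ c.verts with v ∉ B, p.cost (a, (v, φ v)) := by
      rintro c hcv hcc hcB ⟨s, hs, hsφ, hle⟩
      have hsol := isSol_of_mem_table hok hcv hcc hs
      have hag : agree s ψ = true := by
        rw [agree_iff]
        simp only [hψ, List.mem_map]
        rintro e he _ ⟨v, hv, rfl⟩ h
        simp only at h
        subst h
        exact hsφ e he (hcB _ (hsol.mem_verts he) hv)
      -- The entry chosen by `best` may differ from `φ` on the child's root bag outside `B`; only
      -- its cost outside `B` matters from here on.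
      obtain ⟨s', hs', hle'⟩ := exists_minBy (fun s' => p.total a (dropOn B s'))
        (List.mem_filter.2 ⟨hs, hag⟩ : s ∈ (p.table a c).filter fun s' => agree s' ψ)
      refine ⟨s', hs', hle'.trans ?_⟩
      rw [total_dropOn hsol.nodup hsφ fun e he => hcB e.1 (hsol.mem_verts he)]
      have h1 : (s.map Prod.fst).toFinset = c.verts := by
        ext v
        rw [List.mem_toFinset, hsol.mem]
      rw [h1]
      have h2 : (c.verts.filter fun v => v ∉ B) = (c.verts.filter fun v => v ∉ c.root) ∪
          c.verts.filter fun v => v ∈ c.root ∧ v ∉ B := by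
        ext v
        simp only [Finset.mem_filter, Finset.mem_union]
        have := hcB v
        tauto
      rw [h2, Finset.sum_union]
      · gcongr
      · rw [Finset.disjoint_left]
        intro v h h'
        simp only [Finset.mem_filter] at h h'
        exact h.2 h'.2.1
    obtain ⟨sl, hsl, hlel⟩ := key l hv.2.1 (hc.left hv) hv.2.2.2.2.1 hl
    obtain ⟨sr, hsr, hler⟩ := key r hv.2.2.1 (hc.right hv) hv.2.2.2.2.2 hr
    refine ⟨ψ ++ dropOn B sl ++ dropOn B sr,
      mem_step.2 ⟨ψ, hψmem, hψcon, sl, sr, hsl, hsr, rfl⟩, ?_, ?_⟩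
    · intro e he heB
      simp only [List.mem_append, mem_dropOn] at he
      rcases he with (he | he) | he
      · obtain ⟨v, -, rfl⟩ := List.mem_map.1 he
        rfl
      · exact absurd heB he.2
      · exact absurd heB he.2
    · have h1 : dropOn B (ψ ++ dropOn B sl ++ dropOn B sr) = dropOn B sl ++ dropOn B sr := by
        have : dropOn B ψ = [] := by
          simp [dropOn, hψ]
        simp only [dropOn, List.filter_append, List.filter_filter, Bool.and_self] at this ⊢
        rw [this, List.nil_append]
      have h2 : ((Dec.node B l r).verts.filter fun v => v ∉ B) =
          (l.verts.filter fun v => v ∉ B) ∪ r.verts.filter fun v => v ∉ B := by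
        ext v
        simp only [Finset.mem_filter, Finset.mem_union, Dec.mem_verts_node]
        tauto
      change p.total a (dropOn B _) ≤ ∑ v ∈ (Dec.node B l r).verts with v ∉ B, _
      have h3 : ∀ s s', p.total a (s ++ s') = p.total a s + p.total a s' := fun s s' => by
        rw [total, List.map_append, List.sum_append, total, total]
      rw [h1, h2, Finset.sum_union, h3]
      · exact add_le_add hlel hler
      · rw [Finset.disjoint_left]
        intro v h h'
        simp only [Finset.mem_filter] at h h'
        exact h.2 (hv.2.2.2.1 v h.1 h'.1)

theorem isSol_of_solve {adj : ℕ → ℕ → Prop}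
    (hok : ∀ e e' : ℕ × ℕ, e.1 ≠ e'.1 → ¬adj e.1 e'.1 → p.ok (a, e, e') = true) {t : Dec}
    (hv : t.Valid) (hc : t.Covers adj) {s : List (ℕ × ℕ)} (hs : p.solve a t = some s) :
    p.IsSol a t s :=
  isSol_of_mem_table hok hv hc (minBy_mem hs)

theorem exists_solve [IsOrderedAddMonoid M] {adj : ℕ → ℕ → Prop}
    (hok : ∀ e e' : ℕ × ℕ, e.1 ≠ e'.1 → ¬adj e.1 e'.1 → p.ok (a, e, e') = true) {t : Dec}
    (hv : t.Valid) (hc : t.Covers adj) (hlab : p.lab a ≠ [])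
    (hcap : ∀ b ∈ t.bags, (p.lab a).length ^ b.length ≤ p.cap a) {φ : ℕ → ℕ}
    (hφ : ∀ v ∈ t.verts, φ v ∈ p.lab a)
    (hφok : ∀ u ∈ t.verts, ∀ v ∈ t.verts, p.ok (a, (u, φ u), (v, φ v)) = true) :
    ∃ s, p.solve a t = some s ∧ p.total a s ≤ ∑ v ∈ t.verts, p.cost (a, (v, φ v)) := by
  obtain ⟨s, hs, hsφ, hle⟩ := exists_mem_table hok hv hc hlab hcap hφ hφok
  have hsol := isSol_of_mem_table hok hv hc hs
  obtain ⟨s', hs', hle'⟩ := exists_minBy (p.total a) hs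
  refine ⟨s', hs', hle'.trans ?_⟩
  have h0 : dropOn [] s = s := by simp [dropOn]
  have h1 : (s.map Prod.fst).toFinset = t.verts := by
    ext v
    rw [List.mem_toFinset, hsol.mem]
  have h2 := total_dropOn (p := p) (a := a) hsol.nodup (B := []) hsφ (by simp)
  rw [h0, h1] at h2
  rw [h2, ← Finset.sum_filter_add_sum_filter_not t.verts (fun v => v ∉ t.root)]
  simp only [List.not_mem_nil, not_false_eq_true, and_true, not_not]
  gcongr

omit [LinearOrder M] in
theorem IsSol.total_eq {t : Dec} {s : List (ℕ × ℕ)} (h : p.IsSol a t s) {φ : ℕ → ℕ}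
    (hφ : ∀ e ∈ s, e.2 = φ e.1) : p.total a s = ∑ v ∈ t.verts, p.cost (a, (v, φ v)) := by
  have h1 : t.verts = (s.map Prod.fst).toFinset := by
    ext v
    rw [List.mem_toFinset, h.mem]
  rw [h1, List.sum_toFinset _ h.nodup, total, List.map_map]
  congr 1
  refine List.map_congr_left fun e he => ?_
  simp [← hφ e he]

end Problem

end ConcSched

namespace ConcSched
open Polynomial
open Enc (enc)
variable {α β γ δ σ : Type} [Enc α] [Enc β] [Enc γ] [Enc δ] [Enc σ]

/-! ### Finding tree decompositions -/

instance : CostMonoid ℕ where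
  pt_add := by fun_prop
  pt_le := by
    have h : PT fun p : ℕ × ℕ => p.1.ble p.2 := by fun_prop
    exact h.congr fun p => by rw [Bool.eq_iff_iff]; simp
  sz_add_le a b := by simp; omega

/-- The adjacency matrix given by a list of rows. -/
def adjB (rows : List (List Bool)) (u v : ℕ) : Bool := (rows.getD u []).getD v false

@[fun_prop]
theorem PT.adjB {rows : α → List (List Bool)} {u v : α → ℕ} (hr : PT rows) (hu : PT u)
    (hv : PT v) : PT fun x => adjB (rows x) (u x) (v x) := by
  unfold ConcSched.adjB
  fun_prop

/-- The label of `v`. -/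
def lbl (s : List (ℕ × ℕ)) (v : ℕ) : ℕ := ((s.filter fun e => e.1 == v).head?.getD (0, 0)).2

@[fun_prop]
theorem PT.lbl {s : α → List (ℕ × ℕ)} {v : α → ℕ} (hs : PT s) (hv : PT v) :
    PT fun x => lbl (s x) (v x) := by
  unfold ConcSched.lbl
  fun_prop

/-- The elements of `l` with label `c`. -/
def part (s : List (ℕ × ℕ)) (c : ℕ) (l : List ℕ) : List ℕ := l.filter fun v => lbl s v == c

@[fun_prop]
theorem PT.part {s : α → List (ℕ × ℕ)} {c : α → ℕ} {l : α → List ℕ} (hs : PT s) (hc : PT c)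
    (hl : PT l) : PT fun x => part (s x) (c x) (l x) := by
  unfold ConcSched.part
  fun_prop

/-- Separations into three parts, labeled `1`, `2`, `3`, and a separator, labeled `0`, that extend a
given assignment.  The cost is the size of the separator.  The context consists of the adjacency
matrix, a bound for the number of labelings, and the given assignment. -/
def sepProblem : Problem ((List (List Bool) × ℕ) × List (ℕ × ℕ)) ℕ where
  ok z := (!(adjB z.1.1.1 z.2.1.1 z.2.2.1) || (z.2.1.2 == 0 || (z.2.2.2 == 0 || z.2.1.2 == z.2.2.2))) &&
    (!(z.2.1.1 == z.2.2.1) || agree [z.2.1] z.1.2)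
  cost z := bif z.2.2 == 0 then 1 else 0
  lab _ := List.range 4
  cap a := a.1.2

theorem sepProblem_isPT : sepProblem.IsPT where
  ok := by unfold sepProblem; fun_prop
  cost := by unfold sepProblem; fun_prop
  lab := by unfold sepProblem; fun_prop
  cap := by unfold sepProblem; fun_prop

/-- None of the three parts contains more than half of the vertices. -/
def balanced (s : List (ℕ × ℕ)) : Bool :=
  [1, 2, 3].all fun c => (2 * (s.filter fun e => e.2 == c).length).ble s.length

@[fun_prop]
theorem PT.balanced {s : α → List (ℕ × ℕ)} (hs : PT s) : PT fun x => balanced (s x) := by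
  unfold ConcSched.balanced
  fun_prop

/-- A separation with at most `k + 1` vertices in the separator and balanced on `W`, found by means
of the tree decomposition `D`.  The context consists of the adjacency matrix, a bound for the
number of labelings, the number `k`, and `D`. -/
def findSep (c : (List (List Bool) × ℕ) × ℕ × Dec) (W : List ℕ) : Option (List (ℕ × ℕ)) :=
  (((enum (List.range 4) c.1.2 W).filter fun s => balanced s).filterMap fun s =>
    (sepProblem.solve (c.1, s) c.2.2).bind fun s' =>
      bif (sepProblem.total (c.1, s) s').ble (c.2.1 + 1) then some s' else none).head?

@[fun_prop]
theorem PT.findSep {c : α → (List (List Bool) × ℕ) × ℕ × Dec} {W : α → List ℕ} (hc : PT c)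
    (hW : PT W) : PT fun x => findSep (c x) (W x) := by
  unfold ConcSched.findSep
  have h1 : PT fun z : α × List (ℕ × ℕ) => sepProblem.solve ((c z.1).1, z.2) (c z.1).2.2 :=
    sepProblem_isPT.solve (by fun_prop) (by fun_prop)
  have h2 : PT fun z : (α × List (ℕ × ℕ)) × List (ℕ × ℕ) =>
      sepProblem.total ((c z.1.1).1, z.1.2) z.2 :=
    sepProblem_isPT.total (by fun_prop) (by fun_prop)
  have h3 : PT fun z : (α × List (ℕ × ℕ)) × List (ℕ × ℕ) =>
      bif (sepProblem.total ((c z.1.1).1, z.1.2) z.2).ble ((c z.1.1).2.1 + 1) then some z.2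
        else none := by fun_prop
  have h4 : PT fun x => (ConcSched.enum (List.range 4) (c x).1.2 (W x)).filter fun s =>
      ConcSched.balanced s := by
    fun_prop
  exact (h4.filterMap (h1.option_bind h3)).head?

/-- A task: the vertices in the second list have to be decomposed, together with the ones in the
third list, which have to be in the root bag. -/
abbrev Task : Type := ((List (List Bool) × ℕ) × ℕ × Dec) × List ℕ × List ℕ

/-- The subtask for part `c` of a separation of the task `b`, where `u` joins the root bag. -/
def subtask (b : Task) (u : ℕ) (s : List (ℕ × ℕ)) (c : ℕ) : Task :=
  (b.1, part s c b.2.1.tail,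
    part s c (u :: b.2.2) ++ (part s 0 (u :: b.2.2) ++ part s 0 b.2.1.tail))

/-- The root bag for a task and its three subtasks. -/
def expand (b : Task) : Option (List ℕ × Task × Task × Task) :=
  b.2.1.head?.bind fun u => (findSep b.1 (u :: b.2.2)).bind fun s =>
    some ((u :: b.2.2) ++ part s 0 b.2.1.tail, subtask b u s 1, subtask b u s 2, subtask b u s 3)

/-- The result of a task that cannot be expanded. -/
def baseCase (b : Task) : Option Dec :=
  b.2.1.head?.elim (some (.node b.2.2 .leaf .leaf)) fun _ => none

/-- The tree with root bag `B` and three subtrees. -/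
def join (B : List ℕ) (t₁ t₂ t₃ : Option Dec) : Option Dec :=
  t₁.bind fun t₁ => t₂.bind fun t₂ => t₃.bind fun t₃ => some (.node B t₁ (.node B t₂ t₃))

/-- Recursive decomposition along balanced separators. -/
def build (n : ℕ) (b : Task) : Option Dec := treeRec expand baseCase join n b

theorem sz_part_le (s : List (ℕ × ℕ)) {c : ℕ} (hc : c ≠ 0) (l : List ℕ) :
    sz (part s c l) + sz (part s 0 l) ≤ sz l + 1 := by
  induction l with
  | nil => simp [part]
  | cons v l ih =>
    unfold part at *
    rw [List.filter_cons, List.filter_cons]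
    by_cases h1 : lbl s v = c
    · have h2 : lbl s v ≠ 0 := by omega
      rw [if_pos (by simpa using h1), if_neg (by simpa using h2), sz_cons, sz_cons]
      omega
    · rw [if_neg (by simpa using h1)]
      split_ifs <;> simp only [sz_cons] <;> omega

/-- Makes the number of vertices still to be decomposed a measure for `PT.treeRec`; the strict
decrease comes from the vertex `u` that leaves the list. -/
theorem length_part_le (s : List (ℕ × ℕ)) (l : List ℕ) :
    (part s 1 l).length + (part s 2 l).length + (part s 3 l).length ≤ l.length := by
  induction l with
  | nil => simp [part]
  | cons v l ih =>
    unfold part at *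
    simp only [List.filter_cons, List.length_cons]
    split_ifs with h1 h2 h3 h3 h2 h3 h3 <;> simp at * <;> omega

theorem expand_eq_some {b : Task} {c : List ℕ × Task × Task × Task} :
    expand b = some c ↔ ∃ u U' s, b.2.1 = u :: U' ∧ findSep b.1 (u :: b.2.2) = some s ∧
      c = ((u :: b.2.2) ++ part s 0 U', subtask b u s 1, subtask b u s 2, subtask b u s 3) := by
  simp only [expand, Option.bind_eq_some_iff, Option.some.injEq]
  constructor
  · rintro ⟨u, hu, s, hs, rfl⟩
    obtain ⟨U', hU⟩ := List.head?_eq_some_iff.1 hu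
    exact ⟨u, U', s, hU, hs, by simp [hU]⟩
  · rintro ⟨u, U', s, hU, hs, rfl⟩
    exact ⟨u, by simp [hU], s, hs, by simp [hU]⟩

/-- The parts `c` and `0` are disjoint for `c ≠ 0`, so a subtask lists no position of the task
twice. Hence tasks do not grow along the recursion. -/
theorem sz_subtask_le {b : Task} {u : ℕ} {U' : List ℕ} (s : List (ℕ × ℕ)) (hU : b.2.1 = u :: U')
    {c : ℕ} (hc : c ≠ 0) :
    sz (subtask b u s c).2.1 + sz (subtask b u s c).2.2 ≤ sz b.2.1 + sz b.2.2 := by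
  have h1 := sz_part_le s hc U'
  have h2 := sz_part_le s hc (u :: b.2.2)
  have h3 := sz_append (part s c (u :: b.2.2)) (part s 0 (u :: b.2.2) ++ part s 0 U')
  have h4 := sz_append (part s 0 (u :: b.2.2)) (part s 0 U')
  simp only [subtask, hU, List.tail_cons, sz_cons] at *
  omega

/-- At most `3 * b.2.1.length + 1` tasks arise, and each contributes at most two copies of a bag
that is no larger than the task. The second copy appears because `join` makes a node with three
children out of binary ones. -/
theorem sz_build_le (n : ℕ) (b : Task) :
    sz (build n b) ≤ (3 * b.2.1.length + 1) * (2 * (sz b.2.1 + sz b.2.2) + 10) := by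
  have hbase : ∀ b : Task, sz (baseCase b) ≤
      (3 * b.2.1.length + 1) * (2 * (sz b.2.1 + sz b.2.2) + 10) := by
    intro b
    unfold baseCase
    cases b.2.1 with
    | nil => simp; omega
    | cons u U' => simp only [List.head?_cons, Option.elim_some, sz_none]; nlinarith
  unfold build
  induction n generalizing b with
  | zero => exact hbase b
  | succ n ih =>
    rw [treeRec]
    cases hb : expand b with
    | none => exact hbase b
    | some c =>
      obtain ⟨u, U', s, hU, -, rfl⟩ := expand_eq_some.1 hb
      have hj : ∀ B t₁ t₂ t₃, sz (join B t₁ t₂ t₃) ≤ 2 * sz B + sz t₁ + sz t₂ + sz t₃ + 4 := by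
        intro B t₁ t₂ t₃
        cases t₁ <;> cases t₂ <;> cases t₃ <;> (simp [join]; try omega)
      refine (hj _ _ _ _).trans ?_
      have h1 := ih (subtask b u s 1)
      have h2 := ih (subtask b u s 2)
      have h3 := ih (subtask b u s 3)
      have s1 := sz_subtask_le s hU (c := 1) (by norm_num)
      have s2 := sz_subtask_le s hU (c := 2) (by norm_num)
      have s3 := sz_subtask_le s hU (c := 3) (by norm_num)
      have hlen := length_part_le s U'
      have hl : ∀ c, (subtask b u s c).2.1.length = (part s c U').length := fun c => by
        simp [subtask, hU]
      rw [hl] at h1 h2 h3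
      have h4 := sz_append (u :: b.2.2) (part s 0 U')
      have h5 : sz (part s 0 U') ≤ sz U' := sz_le_of_sublist List.filter_sublist
      have h6 : sz b.2.1 = sz u + sz U' + 1 := by rw [hU, sz_cons]
      have h7 : b.2.1.length = U'.length + 1 := by rw [hU, List.length_cons]
      rw [h7]
      set S := 2 * (sz b.2.1 + sz b.2.2) + 10 with hS
      have h1 := h1.trans (Nat.mul_le_mul_left _ (by omega : _ ≤ S))
      have h2 := h2.trans (Nat.mul_le_mul_left _ (by omega : _ ≤ S))
      have h3 := h3.trans (Nat.mul_le_mul_left _ (by omega : _ ≤ S))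
      have h8 := Nat.mul_le_mul_right S (Nat.mul_le_mul_left 3 hlen)
      rw [sz_cons] at h4
      dsimp only
      have h9 : 2 * sz ((u :: b.2.2) ++ part s 0 U') + 4 ≤ S := by omega
      nlinarith

@[fun_prop]
theorem PT.subtask {b : α → Task} {u : α → ℕ} {s : α → List (ℕ × ℕ)} {c : α → ℕ} (hb : PT b)
    (hu : PT u) (hs : PT s) (hc : PT c) : PT fun x => subtask (b x) (u x) (s x) (c x) := by
  unfold ConcSched.subtask
  fun_prop

theorem pt_expand : PT expand := by
  unfold expand
  have h1 : PT fun b : Task => b.2.1.head? := by fun_prop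
  have h2 : PT fun z : Task × ℕ => findSep z.1.1 (z.2 :: z.1.2.2) := by fun_prop
  have h3 : PT fun z : (Task × ℕ) × List (ℕ × ℕ) =>
      some ((z.1.2 :: z.1.1.2.2) ++ part z.2 0 z.1.1.2.1.tail, ConcSched.subtask z.1.1 z.1.2 z.2 1,
        ConcSched.subtask z.1.1 z.1.2 z.2 2, ConcSched.subtask z.1.1 z.1.2 z.2 3) := by fun_prop
  exact h1.option_bind (h2.option_bind h3)

theorem pt_build : PT fun b : Task => build b.2.1.length b := by
  refine PT.treeRec (g := expand) (base := baseCase) (comb := join) pt_expand ?_ ?_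
    (fun b => b.2.1.length) ?_ ?_ ?_ ((3 * X + 1) * (2 * X + 10)) ?_
  · unfold baseCase
    fun_prop
  · unfold join
    fun_prop
  · intro b
    have := length_le_sz b.2.1
    rw [sz_prod b, sz_prod b.2]
    omega
  · intro b c hb
    obtain ⟨u, U', s, hU, -, rfl⟩ := expand_eq_some.1 hb
    have := length_part_le s U'
    simp only [subtask, hU, List.tail_cons, List.length_cons]
    omega
  · intro b c hb
    obtain ⟨u, U', s, hU, -, rfl⟩ := expand_eq_some.1 hb
    have h : ∀ c, c ≠ 0 → sz (subtask b u s c) ≤ sz b := fun c hc => by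
      have := sz_subtask_le s hU hc
      rw [sz_prod, sz_prod b, sz_prod b.2, sz_prod (subtask b u s c).2]
      simp only [subtask] at *
      omega
    exact ⟨h 1 (by norm_num), h 2 (by norm_num), h 3 (by norm_num)⟩
  · intro n b
    refine (sz_build_le n b).trans ?_
    have h1 := length_le_sz b.2.1
    have h2 : sz b.2.1 + sz b.2.2 ≤ sz b := by
      rw [sz_prod b, sz_prod b.2]; omega
    simp only [eval_add, eval_mul, eval_X, eval_ofNat, eval_one]
    gcongr
    omega

/-- Adds `v` to all bags. -/
def addVertex (v : ℕ) (t : Dec) : Dec := t.fold .leaf fun B l r => .node (v :: B) l r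

@[fun_prop]
theorem PT.addVertex {v : α → ℕ} {t : α → Dec} (hv : PT v) (ht : PT t) :
    PT fun x => addVertex (v x) (t x) := by
  have h1 : PT fun z : ℕ × Dec => z.2.fold Dec.leaf fun B l r => Dec.node (z.1 :: B) l r := by
    refine PT.dec_fold (h := fun z : ℕ × Dec => fun B l r => Dec.node (z.1 :: B) l r)
      (f := fun z => z.2) (g := fun _ => Dec.leaf) (by fun_prop) (by fun_prop) (by fun_prop)
      (X * (X + 2)) fun z t => ?_
    have h : ∀ t : Dec, sz (t.fold Dec.leaf fun B l r => Dec.node (z.1 :: B) l r) ≤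
        sz t * (sz z.1 + 2) := by
      intro t
      induction t with
      | leaf => simp [Dec.fold]
      | node B l r hl hr =>
        rw [Dec.fold, sz_node, sz_node, sz_cons]
        nlinarith [sz_pos B]
    refine (h t).trans ?_
    simp only [eval_add, eval_mul, eval_X, eval_ofNat]
    have : sz z.1 ≤ sz z := by rw [sz_prod z]; omega
    gcongr <;> omega
  exact h1.comp (hv.prodMk ht)

/-- One round of iterative compression: the vertex `v` joins the list of vertices and their
decomposition. -/
def addStep (c : (List (List Bool) × ℕ) × ℕ) (v : ℕ) (s : List ℕ × Option Dec) :
    List ℕ × Option Dec :=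
  (v :: s.1, s.2.bind fun t =>
    build (v :: s.1).length ((c.1, c.2, addVertex v t), v :: s.1, []))

/-- A tree decomposition for the vertices in `l`. -/
def decompose (c : (List (List Bool) × ℕ) × ℕ) (l : List ℕ) : List ℕ × Option Dec :=
  l.foldr (addStep c) ([], some (.node [] .leaf .leaf))

theorem decompose_fst (c : (List (List Bool) × ℕ) × ℕ) (l : List ℕ) : (decompose c l).1 = l := by
  induction l with
  | nil => rfl
  | cons v l ih => rw [decompose, List.foldr_cons, ← decompose, addStep, ih]

/-- Every round rebuilds the decomposition from the list of vertices, so its size is bounded in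
terms of that list and does not compound over the rounds. -/
theorem sz_decompose_le (c : (List (List Bool) × ℕ) × ℕ) (l : List ℕ) :
    sz (decompose c l) ≤ sz l + (3 * sz l + 1) * (2 * sz l + 12) + 1 := by
  cases l with
  | nil => norm_num [decompose]
  | cons v l =>
    rw [decompose, List.foldr_cons, ← decompose, addStep, decompose_fst, sz_pair]
    cases (decompose c l).2 with
    | none =>
      rw [Option.bind_none, sz_none]
      have : 0 < (3 * sz (v :: l) + 1) * (2 * sz (v :: l) + 12) := by positivity
      omega
    | some t =>
      rw [Option.bind_some]
      have h1 := sz_build_le (v :: l).length ((c.1, c.2, addVertex v t), v :: l, [])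
      have h2 := length_le_sz (v :: l)
      dsimp only at h1
      rw [sz_nil] at h1
      have h3 : (3 * (v :: l).length + 1) * (2 * (sz (v :: l) + 1) + 10) ≤
        (3 * sz (v :: l) + 1) * (2 * sz (v :: l) + 12) := by
        apply Nat.mul_le_mul <;> omega
      omega

theorem pt_addStep : PT fun p : ((List (List Bool) × ℕ) × ℕ) × ℕ × List ℕ × Option Dec =>
    addStep p.1 p.2.1 p.2.2 := by
  unfold addStep
  have h1 : PT fun p : (((List (List Bool) × ℕ) × ℕ) × ℕ × List ℕ × Option Dec) × Dec =>
      build (p.1.2.1 :: p.1.2.2.1).length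
        ((p.1.1.1, p.1.1.2, addVertex p.1.2.1 p.2), p.1.2.1 :: p.1.2.2.1, []) :=
    pt_build.comp (f := fun p : (((List (List Bool) × ℕ) × ℕ) × ℕ × List ℕ × Option Dec) × Dec =>
      ((p.1.1.1, p.1.1.2, addVertex p.1.2.1 p.2), p.1.2.1 :: p.1.2.2.1, []))
      (by fun_prop)
  have h2 : PT fun p : ((List (List Bool) × ℕ) × ℕ) × ℕ × List ℕ × Option Dec => p.2.2.2 := by
    fun_prop
  exact PT.prodMk (by fun_prop) (h2.option_bind h1)

@[fun_prop]
theorem PT.decompose {c : α → (List (List Bool) × ℕ) × ℕ} {l : α → List ℕ} (hc : PT c)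
    (hl : PT l) : PT fun x => decompose (c x) (l x) := by
  have h0 : PT fun p : (((List (List Bool) × ℕ) × ℕ) × List ℕ) × ℕ × List ℕ × Option Dec =>
      addStep p.1.1 p.2.1 p.2.2 :=
    pt_addStep.comp (f := fun p : (((List (List Bool) × ℕ) × ℕ) × List ℕ) × ℕ × List ℕ × Option Dec =>
      (p.1.1, p.2)) (by fun_prop)
  have h : PT fun z : ((List (List Bool) × ℕ) × ℕ) × List ℕ => z.2.foldr (addStep z.1)
      ([], some (.node [] .leaf .leaf)) := by
    refine PT.foldr (h := fun z : ((List (List Bool) × ℕ) × ℕ) × List ℕ => addStep z.1)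
      (f := fun z => z.2) (g := fun _ => ([], some (.node [] .leaf .leaf))) h0 (by fun_prop)
      (by fun_prop) (X + (3 * X + 1) * (2 * X + 12) + 1) fun z l => ?_
    refine (sz_decompose_le z.1 l).trans ?_
    simp only [eval_add, eval_mul, eval_X, eval_ofNat, eval_one]
    gcongr <;> omega
  have h2 := h.comp (hc.prodMk hl)
  exact h2

end ConcSched

namespace ConcSched

/-! ### Correctness of the decomposition algorithm -/

namespace Dec

/-- `φ` separates the vertices into parts along a bag of `t` (labeled `0`), and no part contains
more than half of `W`; the vertices outside of `t` are in part `1`. -/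
structure IsSplit (t : Dec) (W : Finset ℕ) (φ : ℕ → ℕ) : Prop where
  bag : ∃ b ∈ t.bags, ∀ v, φ v = 0 ↔ v ∈ b
  lt : ∀ v, φ v < 4
  out : ∀ v, v ∉ t.verts → φ v = 1
  root : ∀ v ∈ t.root, φ v = 0 ∨ φ v = 1
  compat : ∀ b ∈ t.bags, ∀ u ∈ b, ∀ v ∈ b, φ u = 0 ∨ φ v = 0 ∨ φ u = φ v
  balanced : ∀ c, c ≠ 0 → 2 * (W.filter fun v => φ v = c).card ≤ W.card

/-- A separation of a subtree extends upwards unchanged, everything outside the subtree lying in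
part `1`. This is what the fields `out` and `root` are for: vertices of `B` and of the other subtree
that occur in `l` lie in the root bag of `l`, so they are labeled `0` or `1`. -/
theorem IsSplit.node_left {B : List ℕ} {l r : Dec} {W : Finset ℕ} {φ : ℕ → ℕ}
    (hv : (node B l r).Valid) (h : l.IsSplit W φ) : (node B l r).IsSplit W φ := by
  obtain ⟨⟨b, hb, hb0⟩, h4, hout, hroot, hcomp, hbal⟩ := h
  have hB : ∀ v ∈ B, φ v = 0 ∨ φ v = 1 := fun v hvB => by
    by_cases h : v ∈ l.verts
    · exact hroot v (hv.2.2.2.2.1 v h hvB)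
    · exact .inr (hout v h)
  have hd : ∀ v ∈ r.verts, φ v = 0 ∨ φ v = 1 := fun v hvr => by
    by_cases h : v ∈ l.verts
    · exact hB v (hv.2.2.2.1 v h hvr)
    · exact .inr (hout v h)
  refine ⟨⟨b, by simp [bags, hb], hb0⟩, h4, fun v hv => hout v fun h => hv
    (mem_verts_node.2 (.inr (.inl h))), hB, ?_, hbal⟩
  intro b hb u hu v hvb
  simp only [bags, List.mem_cons, List.mem_append] at hb
  rcases hb with rfl | hb | hb
  · have := hB u hu
    have := hB v hvb
    omega
  · exact hcomp b hb u hu v hvb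
  · have := hd u (mem_verts_of_mem_bag hb hu)
    have := hd v (mem_verts_of_mem_bag hb hvb)
    omega

theorem IsSplit.swap {B : List ℕ} {l r : Dec} {W : Finset ℕ} {φ : ℕ → ℕ}
    (h : (node B l r).IsSplit W φ) : (node B r l).IsSplit W φ := by
  have hb : ∀ b, b ∈ (node B r l).bags ↔ b ∈ (node B l r).bags := fun b => by
    simp only [bags, List.mem_cons, List.mem_append]
    tauto
  obtain ⟨⟨b, hb', hb0⟩, h4, hout, hroot, hcomp, hbal⟩ := h
  refine ⟨⟨b, (hb b).2 hb', hb0⟩, h4, fun v hv => hout v fun h => hv ?_, hroot,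
    fun b h => hcomp b ((hb b).1 h), hbal⟩
  rw [mem_verts_node] at *
  tauto

/-- The separator is `B`; the two subtrees become parts `2` and `3`, and all vertices outside the
tree part `1`. The last part contains less than half of `W` because the tree contains more than
half. -/
theorem isSplit_node {B : List ℕ} {l r : Dec} {W : Finset ℕ} (hv : (node B l r).Valid)
    (hW : W.card < 2 * (W ∩ (node B l r).verts).card) (h1 : 2 * (W ∩ l.verts).card ≤ W.card)
    (h2 : 2 * (W ∩ r.verts).card ≤ W.card) : ∃ φ, (node B l r).IsSplit W φ := by
  obtain ⟨φ, f0, f2, f3, f1⟩ : ∃ φ : ℕ → ℕ, (∀ v, v ∈ B → φ v = 0) ∧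
      (∀ v, v ∉ B → v ∈ l.verts → φ v = 2) ∧ (∀ v, v ∉ B → v ∉ l.verts → v ∈ r.verts → φ v = 3) ∧
      ∀ v, v ∉ (node B l r).verts → φ v = 1 := by
    refine ⟨fun v => if v ∈ B then 0 else if v ∈ l.verts then 2 else if v ∈ r.verts then 3 else 1,
      fun v h => if_pos h, fun v h h' => ?_, fun v h h' h'' => ?_, fun v h => ?_⟩
    · simp only [if_neg h, if_pos h']
    · simp only [if_neg h, if_neg h', if_pos h'']
    · rw [mem_verts_node] at h
      push Not at h
      simp only [if_neg h.1, if_neg h.2.1, if_neg h.2.2]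
  have f : ∀ v, (v ∈ B ∧ φ v = 0) ∨ (v ∉ B ∧ v ∈ l.verts ∧ φ v = 2) ∨
      (v ∉ B ∧ v ∉ l.verts ∧ v ∈ r.verts ∧ φ v = 3) ∨ (v ∉ (node B l r).verts ∧ v ∉ B ∧ φ v = 1) := by
    intro v
    by_cases hB : v ∈ B
    · exact .inl ⟨hB, f0 v hB⟩
    by_cases hl : v ∈ l.verts
    · exact .inr (.inl ⟨hB, hl, f2 v hB hl⟩)
    by_cases hr : v ∈ r.verts
    · exact .inr (.inr (.inl ⟨hB, hl, hr, f3 v hB hl hr⟩))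
    have h : v ∉ (node B l r).verts := by
      rw [mem_verts_node]
      tauto
    exact .inr (.inr (.inr ⟨h, hB, f1 v h⟩))
  refine ⟨φ, ⟨B, by simp [bags], fun v => ⟨fun h => ?_, f0 v⟩⟩, fun v => ?_, f1,
    fun v hv => .inl (f0 v hv), ?_, ?_⟩
  · by_contra hB
    rcases f v with h | h | h | h
    · exact hB h.1
    all_goals omega
  · rcases f v with h | h | h | h <;> omega
  · intro b hb u hu v hv'
    by_cases huB : u ∈ B
    · exact .inl (f0 u huB)
    by_cases hvB : v ∈ B
    · exact .inr (.inl (f0 v hvB))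
    simp only [bags, List.mem_cons, List.mem_append] at hb
    rcases hb with rfl | hb | hb
    · exact absurd hu huB
    · exact .inr (.inr ((f2 u huB (mem_verts_of_mem_bag hb hu)).trans
        (f2 v hvB (mem_verts_of_mem_bag hb hv')).symm))
    · have h5 := mem_verts_of_mem_bag hb hu
      have h6 := mem_verts_of_mem_bag hb hv'
      exact .inr (.inr ((f3 u huB (fun h => huB (hv.2.2.2.1 u h h5)) h5).trans
        (f3 v hvB (fun h => hvB (hv.2.2.2.1 v h h6)) h6).symm))
  · intro c hc
    by_cases hc2 : c = 2
    · refine le_trans (Nat.mul_le_mul_left 2 (Finset.card_le_card fun v hv => ?_)) h1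
      rw [Finset.mem_filter] at hv
      refine Finset.mem_inter.2 ⟨hv.1, ?_⟩
      rcases f v with h | h | h | h <;> first | exact h.2.1 | omega
    by_cases hc3 : c = 3
    · refine le_trans (Nat.mul_le_mul_left 2 (Finset.card_le_card fun v hv => ?_)) h2
      rw [Finset.mem_filter] at hv
      refine Finset.mem_inter.2 ⟨hv.1, ?_⟩
      rcases f v with h | h | h | h <;> first | exact h.2.2.1 | omega
    have h4 := Finset.card_le_card
      (show (W.filter fun v => φ v = c) ⊆ W \ (node B l r).verts from fun v hv => by
        rw [Finset.mem_filter] at hv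
        refine Finset.mem_sdiff.2 ⟨hv.1, ?_⟩
        rcases f v with h | h | h | h <;> first | exact h.1 | omega)
    have h5 := Finset.card_sdiff_add_card_inter W (node B l r).verts
    omega

/-- Descend as long as some subtree contains more than half of `W`. The root bag of the last such
subtree is a balanced separator. -/
theorem exists_isSplit {t : Dec} (hv : t.Valid) {W : Finset ℕ}
    (hW : W.card < 2 * (W ∩ t.verts).card) : ∃ φ, t.IsSplit W φ := by
  induction t with
  | leaf => simp [verts] at hW
  | node B l r hl hr =>
    by_cases h1 : W.card < 2 * (W ∩ l.verts).card
    · obtain ⟨φ, h⟩ := hl hv.2.1 h1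
      exact ⟨φ, h.node_left hv⟩
    by_cases h2 : W.card < 2 * (W ∩ r.verts).card
    · obtain ⟨φ, h⟩ := hr hv.2.2.1 h2
      exact ⟨φ, (h.node_left hv.swap).swap⟩
    exact isSplit_node hv hW (not_lt.1 h1) (not_lt.1 h2)

theorem exists_bag {t : Dec} {v : ℕ} (hv : v ∈ t.verts) : ∃ b ∈ t.bags, v ∈ b := by
  induction t with
  | leaf => simp [verts] at hv
  | node B l r hl hr =>
    simp only [bags, List.mem_cons, List.mem_append]
    rcases mem_verts_node.1 hv with h | h | h
    · exact ⟨B, .inl rfl, h⟩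
    · obtain ⟨b, hb, h⟩ := hl h
      exact ⟨b, .inr (.inl hb), h⟩
    · obtain ⟨b, hb, h⟩ := hr h
      exact ⟨b, .inr (.inr hb), h⟩

end Dec

/-! ### Adding a vertex to all bags -/

theorem bags_addVertex (v : ℕ) (t : Dec) : (addVertex v t).bags = t.bags.map (v :: ·) := by
  induction t with
  | leaf => rfl
  | node B l r hl hr =>
    unfold addVertex at *
    simp [Dec.fold, Dec.bags, hl, hr]

theorem mem_verts_addVertex {v w : ℕ} {t : Dec} :
    w ∈ (addVertex v t).verts ↔ w ∈ t.verts ∨ (w = v ∧ t ≠ .leaf) := by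
  induction t with
  | leaf => simp [addVertex, Dec.fold, Dec.verts]
  | node B l r hl hr =>
    unfold addVertex at *
    rw [Dec.fold, Dec.mem_verts_node, Dec.mem_verts_node, hl, hr, List.mem_cons]
    simp
    tauto

theorem root_addVertex {v w : ℕ} {t : Dec} :
    w ∈ (addVertex v t).root ↔ w ∈ t.root ∨ (w = v ∧ t ≠ .leaf) := by
  cases t with
  | leaf => simp [addVertex, Dec.fold, Dec.root]
  | node B l r => simp [addVertex, Dec.fold, Dec.root]; tauto

theorem valid_addVertex {v : ℕ} {t : Dec} (ht : t.Valid) (hv : v ∉ t.verts) :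
    (addVertex v t).Valid := by
  induction t with
  | leaf => trivial
  | node B l r hl hr =>
    rw [Dec.mem_verts_node] at hv
    push Not at hv
    obtain ⟨h1, h2, h3, h4, h5, h6⟩ := ht
    change (Dec.node (v :: B) (addVertex v l) (addVertex v r)).Valid
    refine ⟨List.nodup_cons.2 ⟨hv.1, h1⟩, hl h2 hv.2.1, hr h3 hv.2.2, ?_, ?_, ?_⟩ <;> intro w <;>
      simp only [mem_verts_addVertex, root_addVertex, List.mem_cons]
    · rintro (h | h) (h' | h')
      · exact .inr (h4 w h h')
      · exact .inl h'.1
      · exact .inl h.1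
      · exact .inl h.1
    · rintro (h | h) (h' | h')
      · exact absurd h (h' ▸ hv.2.1)
      · exact .inl (h5 w h h')
      · exact .inr h
      · exact .inr h
    · rintro (h | h) (h' | h')
      · exact absurd h (h' ▸ hv.2.2)
      · exact .inl (h6 w h h')
      · exact .inr h
      · exact .inr h

theorem covers_addVertex {v : ℕ} {t : Dec} {adj : ℕ → ℕ → Prop} (ht : t.Covers adj) :
    (addVertex v t).Covers adj := by
  intro x hx y hy hxy
  rw [mem_verts_addVertex] at hx hy
  rw [bags_addVertex]
  have h0 : t ≠ .leaf → ∃ b, b ∈ t.bags := by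
    cases t with
    | leaf => simp
    | node B l r => exact fun _ => ⟨B, by simp [Dec.bags]⟩
  suffices h : ∃ b ∈ t.bags, x ∈ v :: b ∧ y ∈ v :: b by
    obtain ⟨b, hb, h⟩ := h
    exact ⟨v :: b, List.mem_map_of_mem hb, h⟩
  rcases hx with hx | ⟨rfl, h⟩ <;> rcases hy with hy | ⟨rfl, h'⟩
  · obtain ⟨b, hb, h⟩ := ht x hx y hy hxy
    exact ⟨b, hb, List.mem_cons_of_mem _ h.1, List.mem_cons_of_mem _ h.2⟩
  · obtain ⟨b, hb, h⟩ := Dec.exists_bag hx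
    exact ⟨b, hb, List.mem_cons_of_mem _ h, List.mem_cons_self⟩
  · obtain ⟨b, hb, h⟩ := Dec.exists_bag hy
    exact ⟨b, hb, List.mem_cons_self, List.mem_cons_of_mem _ h⟩
  · obtain ⟨b, hb⟩ := h0 h
    exact ⟨b, hb, List.mem_cons_self, List.mem_cons_self⟩

/-! ### Separations found by the dynamic program -/

theorem lbl_eq {s : List (ℕ × ℕ)} (hs : (s.map Prod.fst).Nodup) {e : ℕ × ℕ} (he : e ∈ s) :
    lbl s e.1 = e.2 := by
  unfold lbl
  cases h : (s.filter fun e' => e'.1 == e.1).head? with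
  | none =>
    rw [List.head?_eq_none_iff, List.filter_eq_nil_iff] at h
    exact absurd (h e he) (by simp)
  | some e' =>
    have h' := List.mem_filter.1 (List.mem_of_mem_head? h)
    have : e' = e := List.inj_on_of_nodup_map hs h'.1 he (by simpa using h'.2)
    simp [this]

theorem mem_part {s : List (ℕ × ℕ)} {c v : ℕ} {l : List ℕ} :
    v ∈ part s c l ↔ v ∈ l ∧ lbl s v = c := by
  simp [part]

/-- Adjacency of vertices as a proposition. -/
def adjP (rows : List (List Bool)) (u v : ℕ) : Prop := adjB rows u v = true

/-- The requirement to extend the given assignment concerns single vertices; it is imposed through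
pairs with equal vertices, which are excluded here. -/
theorem sepProblem_ok (a : (List (List Bool) × ℕ) × List (ℕ × ℕ)) (e e' : ℕ × ℕ) (h : e.1 ≠ e'.1)
    (h' : ¬adjP a.1.1 e.1 e'.1) : sepProblem.ok (a, e, e') = true := by
  unfold adjP at h'
  simp [sepProblem, h, h']

/-- What the algorithm needs to know about a separation. -/
structure IsSep (c : (List (List Bool) × ℕ) × ℕ × Dec) (W : List ℕ) (s : List (ℕ × ℕ)) : Prop where
  compat : ∀ u ∈ c.2.2.verts, ∀ v ∈ c.2.2.verts, adjP c.1.1 u v →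
    lbl s u = 0 ∨ lbl s v = 0 ∨ lbl s u = lbl s v
  lt : ∀ v ∈ c.2.2.verts, lbl s v < 4
  sep : ∀ l : List ℕ, l.Nodup → (∀ v ∈ l, v ∈ c.2.2.verts) → (part s 0 l).length ≤ c.2.1 + 1
  balanced : ∀ d, d ≠ 0 → d < 4 → 2 * (part s d W).length ≤ W.length

theorem balanced_iff {s : List (ℕ × ℕ)} : balanced s = true ↔
    ∀ d, d ≠ 0 → d < 4 → 2 * (s.filter fun e => e.2 == d).length ≤ s.length := by
  simp only [ConcSched.balanced, List.all_cons, List.all_nil, Bool.and_true, Bool.and_eq_true,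
    Nat.ble_eq]
  constructor
  · rintro ⟨h1, h2, h3⟩ d h h'
    interval_cases d
    · exact absurd rfl h
    · exact h1
    · exact h2
    · exact h3
  · intro h
    exact ⟨h 1 (by norm_num) (by norm_num), h 2 (by norm_num) (by norm_num),
      h 3 (by norm_num) (by norm_num)⟩

theorem isSep_of_findSep {c : (List (List Bool) × ℕ) × ℕ × Dec} {W : List ℕ} {s : List (ℕ × ℕ)}
    (hv : c.2.2.Valid) (hc : c.2.2.Covers (adjP c.1.1)) (hW : ∀ v ∈ W, v ∈ c.2.2.verts)
    (hs : findSep c W = some s) : IsSep c W s := by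
  have hs := List.mem_of_mem_head? hs
  simp only [List.mem_filterMap, List.mem_filter, Option.bind_eq_some_iff] at hs
  obtain ⟨ω, ⟨hω, hbal⟩, s', hs', hcond⟩ := hs
  cases hle : (sepProblem.total (c.1, ω) s').ble (c.2.1 + 1) with
  | false => simp [hle] at hcond
  | true =>
  obtain rfl : s' = s := by simpa [hle] using hcond
  rw [Nat.ble_eq] at hle
  have hsol := Problem.isSol_of_solve (sepProblem_ok (c.1, ω)) hv hc hs'
  have hmem : ∀ v ∈ c.2.2.verts, (v, lbl s' v) ∈ s' := by
    intro v hv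
    obtain ⟨e, he, rfl⟩ := List.mem_map.1 ((hsol.mem v).2 hv)
    rwa [lbl_eq hsol.nodup he]
  refine ⟨?_, ?_, ?_, ?_⟩
  · intro u hu v hv huv
    have := hsol.ok _ (hmem u hu) _ (hmem v hv)
    unfold adjP at huv
    simp only [sepProblem, huv, Bool.and_eq_true] at this
    simpa using this.1
  · intro v hv
    simpa [sepProblem] using hsol.lab _ (hmem v hv)
  · intro l hl hlv
    refine le_trans ?_ hle
    rw [hsol.total_eq (φ := lbl s') fun e he => (lbl_eq hsol.nodup he).symm]
    have h0 : (part s' 0 l).Nodup := hl.filter _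
    rw [← List.toFinset_card_of_nodup h0]
    have h1 : (part s' 0 l).toFinset ⊆ c.2.2.verts.filter fun v => lbl s' v = 0 := by
      intro v hv
      rw [List.mem_toFinset, mem_part] at hv
      exact Finset.mem_filter.2 ⟨hlv v hv.1, hv.2⟩
    refine (Finset.card_le_card h1).trans (le_of_eq ?_)
    rw [Finset.card_filter]
    refine Finset.sum_congr rfl fun v _ => ?_
    by_cases h : lbl s' v = 0
    · simp [sepProblem, h]
    · simp [sepProblem, h, beq_eq_false_iff_ne.2 h]
  · intro d hd hd'
    have h1 := balanced_iff.1 hbal d hd hd'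
    obtain ⟨hWω, -⟩ := map_fst_of_mem_enum hω
    have h2 : ∀ e ∈ ω, lbl s' e.1 = e.2 := by
      intro e he
      have h3 := hmem e.1 (hW _ (hWω ▸ List.mem_map_of_mem he))
      have := hsol.ok _ h3 _ h3
      simp only [sepProblem, beq_self_eq_true, Bool.not_true, Bool.false_or, Bool.and_eq_true] at this
      exact agree_iff.1 this.2 _ (List.mem_singleton.2 rfl) e he rfl
    have h3 : part s' d W = (ω.filter fun e => e.2 == d).map Prod.fst := by
      rw [← hWω, part, List.filter_map]
      congr 1
      refine List.filter_congr fun e he => ?_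
      simp [h2 e he]
    rw [h3, List.length_map, ← hWω, List.length_map]
    exact h1

/-- Two decompositions play different roles. The narrow one, `t`, is not known to the algorithm; it
only shows that a balanced separation with at most `k + 1` separating vertices exists. The wide one,
in the context `c`, is known, and the dynamic program on it finds a separation that is at least as
good and has the same labels on `W`. -/
theorem exists_findSep {c : (List (List Bool) × ℕ) × ℕ × Dec} {W : List ℕ}
    (hv : c.2.2.Valid) (hc : c.2.2.Covers (adjP c.1.1)) (hW : ∀ v ∈ W, v ∈ c.2.2.verts)
    (hWn : W.Nodup) (hW0 : W ≠ []) (hWN : 4 ^ W.length ≤ c.1.2)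
    (hDN : ∀ b ∈ c.2.2.bags, 4 ^ b.length ≤ c.1.2) {t : Dec} (ht : t.Valid)
    (htc : t.Covers (adjP c.1.1)) (htb : ∀ b ∈ t.bags, b.length ≤ c.2.1 + 1)
    (htD : ∀ v ∈ c.2.2.verts, v ∈ t.verts) : ∃ s, findSep c W = some s := by
  have hWt : W.toFinset ∩ t.verts = W.toFinset := by
    rw [Finset.inter_eq_left]
    intro v hv
    exact htD v (hW v (List.mem_toFinset.1 hv))
  have hcard : W.toFinset.card = W.length := List.toFinset_card_of_nodup hWn
  obtain ⟨φ, ⟨b, hb, hb0⟩, h4, -, -, hcomp, hbal⟩ := Dec.exists_isSplit ht (W := W.toFinset) (by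
    rw [hWt, hcard]
    have := List.length_pos_of_ne_nil hW0
    omega)
  set ω := W.map fun v => (v, φ v) with hω
  have h1 : ω ∈ enum (List.range 4) c.1.2 W :=
    mem_enum (by simp) (by simpa using hWN) φ fun v _ => List.mem_range.2 (h4 v)
  have h2 : balanced ω = true := by
    rw [balanced_iff]
    intro d hd _
    have h := hbal d hd
    rw [hcard] at h
    rw [hω, List.length_map, List.filter_map, List.length_map]
    refine le_trans (Nat.mul_le_mul_left 2 (le_of_eq ?_)) h
    have : W.toFinset.filter (fun v => φ v = d) = (W.filter fun v => φ v == d).toFinset := by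
      ext v; simp
    rw [this, List.toFinset_card_of_nodup (hWn.filter _)]
    rfl
  obtain ⟨s, hs, hle⟩ := Problem.exists_solve (sepProblem_ok (c.1, ω)) hv hc (by simp [sepProblem])
    (by simpa [sepProblem] using hDN) (φ := φ) (fun v _ => List.mem_range.2 (h4 v)) (by
      intro u hu v hv
      simp only [sepProblem, Bool.and_eq_true]
      constructor
      · by_cases h : adjB c.1.1 u v = true
        · obtain ⟨b, hb, hub, hvb⟩ := htc u (htD u hu) v (htD v hv) h
          have := hcomp b hb u hub v hvb
          simpa [h] using this
        · simp [h]
      · by_cases h : u = v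
        · subst h
          simp only [beq_self_eq_true, Bool.not_true, Bool.false_or, agree_iff, hω]
          intro e he e' he' hee
          rw [List.mem_singleton.1 he] at hee ⊢
          obtain ⟨w, -, rfl⟩ := List.mem_map.1 he'
          simp only at hee ⊢
          rw [hee]
        · simp [h])
  have h3 : sepProblem.total (c.1, ω) s ≤ c.2.1 + 1 := by
    refine hle.trans (le_trans ?_ (htb b hb))
    rw [show ∑ v ∈ c.2.2.verts, sepProblem.cost ((c.1, ω), (v, φ v)) =
      (c.2.2.verts.filter fun v => φ v = 0).card by
        rw [Finset.card_filter]
        refine Finset.sum_congr rfl fun v _ => ?_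
        by_cases h : φ v = 0
        · simp [sepProblem, h]
        · simp [sepProblem, h, beq_eq_false_iff_ne.2 h]]
    refine le_trans (Finset.card_le_card fun v hv => ?_) b.toFinset_card_le
    exact List.mem_toFinset.2 ((hb0 v).1 (Finset.mem_filter.1 hv).2)
  refine Option.isSome_iff_exists.1 (List.isSome_head?.2 (List.ne_nil_of_mem (a := s) ?_))
  simp only [List.mem_filterMap, List.mem_filter, Option.bind_eq_some_iff]
  exact ⟨ω, ⟨h1, h2⟩, s, hs, by simp [Nat.ble_eq_true_of_le h3]⟩

end ConcSched

/-! ### Invariants of the recursive decomposition and of iterative compression -/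

namespace ConcSched

/-- The vertices and the size of a task fit the tree decomposition in its context. -/
structure Task.Good (b : Task) : Prop where
  valid : b.1.2.2.Valid
  covers : b.1.2.2.Covers (adjP b.1.1.1)
  nodup : (b.2.1 ++ b.2.2).Nodup
  mem : ∀ v ∈ b.2.1 ++ b.2.2, v ∈ b.1.2.2.verts
  length : b.2.2.length ≤ 2 * b.1.2.1 + 4

/-- `t` is a tree decomposition of the vertices of the task `b`. -/
structure Task.IsResult (b : Task) (t : Dec) : Prop where
  valid : t.Valid
  verts : ∀ v, v ∈ t.verts ↔ v ∈ b.2.1 ∨ v ∈ b.2.2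
  root : ∀ v ∈ b.2.2, v ∈ t.root
  covers : t.Covers (adjP b.1.1.1)
  length : ∀ B ∈ t.bags, B.length ≤ 3 * b.1.2.1 + 6
  ne_leaf : t ≠ .leaf

theorem mem_subtask_fst {b : Task} {u v c : ℕ} {U' : List ℕ} {s : List (ℕ × ℕ)}
    (hU : b.2.1 = u :: U') : v ∈ (subtask b u s c).2.1 ↔ v ∈ U' ∧ lbl s v = c := by
  simp [subtask, hU, mem_part]

theorem mem_subtask_snd {b : Task} {u v c : ℕ} {U' : List ℕ} {s : List (ℕ × ℕ)}
    (hU : b.2.1 = u :: U') : v ∈ (subtask b u s c).2.2 ↔ (v ∈ u :: b.2.2 ∧ lbl s v = c) ∨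
      (v ∈ u :: b.2.2 ∧ lbl s v = 0) ∨ (v ∈ U' ∧ lbl s v = 0) := by
  simp only [subtask, hU, List.tail_cons, List.mem_append, mem_part]

theorem part_append (s : List (ℕ × ℕ)) (c : ℕ) (l l' : List ℕ) :
    part s c (l ++ l') = part s c l ++ part s c l' := List.filter_append ..

theorem Task.Good.nodup_append {b : Task} (h : b.Good) {u : ℕ} {U' : List ℕ}
    (hU : b.2.1 = u :: U') : ((u :: b.2.2) ++ U').Nodup :=
  (List.Perm.nodup_iff (by
    rw [hU]
    exact (List.perm_append_comm (l₁ := U')).cons u)).1 h.nodup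

theorem Task.Good.mem_append {b : Task} (h : b.Good) {u : ℕ} {U' : List ℕ}
    (hU : b.2.1 = u :: U') : ∀ v ∈ (u :: b.2.2) ++ U', v ∈ b.1.2.2.verts := by
  intro v hv
  refine h.mem v ?_
  rw [hU]
  simp only [List.cons_append, List.mem_cons, List.mem_append] at *
  tauto

theorem Task.Good.subtask {b : Task} (h : b.Good) {u : ℕ} {U' : List ℕ} {s : List (ℕ × ℕ)} {c : ℕ}
    (hU : b.2.1 = u :: U') (hs : IsSep b.1 (u :: b.2.2) s) (hc : c ≠ 0) (hc' : c < 4) :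
    (subtask b u s c).Good := by
  have hnd := h.nodup_append hU
  have hmem := h.mem_append hU
  obtain ⟨n1, n2, n3⟩ := List.nodup_append'.1 hnd
  refine ⟨h.valid, h.covers, ?_, ?_, ?_⟩
  · refine List.nodup_append'.2 ⟨?_, ?_, ?_⟩
    · simp only [ConcSched.subtask, hU, List.tail_cons]
      exact n2.filter _
    · simp only [ConcSched.subtask, hU, List.tail_cons, ← part_append]
      refine List.nodup_append'.2 ⟨n1.filter _, hnd.filter _, ?_⟩
      intro v hv hv'
      rw [mem_part] at hv hv'
      exact hc (hv.2.symm.trans hv'.2)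
    · intro v hv hv'
      rw [mem_subtask_fst hU] at hv
      rw [mem_subtask_snd hU] at hv'
      rcases hv' with hv' | hv' | hv'
      · exact n3 hv'.1 hv.1
      · exact n3 hv'.1 hv.1
      · exact hc (hv.2.symm.trans hv'.2)
  · intro v hv
    rw [List.mem_append, mem_subtask_fst hU, mem_subtask_snd hU] at hv
    refine hmem v (List.mem_append.2 ?_)
    tauto
  -- The list `u :: b.2.2` has at most `2k + 5` elements, so one part contains at most `k + 2` of
  -- them; with a separator of at most `k + 1` vertices this stays below `2k + 4`.
  · have h1 := hs.sep _ hnd hmem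
    have h2 := hs.balanced c hc hc'
    have h3 := h.length
    simp only [ConcSched.subtask, hU, List.tail_cons, ← part_append, List.length_append,
      List.length_cons] at *
    omega

set_option maxHeartbeats 400000 in
/-- The trees for the three subtasks can be joined. -/
theorem Task.IsResult.join {b : Task} (h : b.Good) {u : ℕ} {U' : List ℕ} {s : List (ℕ × ℕ)}
    (hU : b.2.1 = u :: U') (hs : IsSep b.1 (u :: b.2.2) s) {t₁ t₂ t₃ : Dec}
    (h₁ : (ConcSched.subtask b u s 1).IsResult t₁) (h₂ : (ConcSched.subtask b u s 2).IsResult t₂)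
    (h₃ : (ConcSched.subtask b u s 3).IsResult t₃) :
    b.IsResult (.node ((u :: b.2.2) ++ part s 0 U') t₁
      (.node ((u :: b.2.2) ++ part s 0 U') t₂ t₃)) := by
  have hnd := h.nodup_append hU
  have hmem := h.mem_append hU
  obtain ⟨n1, n2, n3⟩ := List.nodup_append'.1 hnd
  set B := (u :: b.2.2) ++ part s 0 U' with hB
  have hBmem : ∀ v, v ∈ B ↔ v ∈ u :: b.2.2 ∨ (v ∈ U' ∧ lbl s v = 0) := fun v => by
    rw [hB, List.mem_append, mem_part]
  have hBn : B.Nodup := hnd.sublist (List.Sublist.append_left List.filter_sublist _)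
  have hlt : ∀ v, v ∈ u :: b.2.2 ∨ v ∈ U' → lbl s v < 4 := fun v hv =>
    hs.lt v (hmem v (List.mem_append.2 hv))
  -- membership in the subtrees
  have hv : ∀ c t, c ≠ 0 → (ConcSched.subtask b u s c).IsResult t → ∀ v, v ∈ t.verts ↔
      (v ∈ U' ∧ lbl s v = c) ∨ (v ∈ u :: b.2.2 ∧ lbl s v = c) ∨
      (v ∈ u :: b.2.2 ∧ lbl s v = 0) ∨ (v ∈ U' ∧ lbl s v = 0) := fun c t hc ht v => by
    rw [ht.verts, mem_subtask_fst hU, mem_subtask_snd hU]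
  have hroot : ∀ c t, c ≠ 0 → (ConcSched.subtask b u s c).IsResult t → ∀ v ∈ t.verts, v ∈ B →
      v ∈ t.root := fun c t hc ht v hvt hvB => by
    refine ht.root v ?_
    rw [mem_subtask_snd hU]
    rw [hv c t hc ht] at hvt
    rw [hBmem] at hvB
    rcases hvt with h | h
    · rcases hvB with h' | h'
      · exact absurd h.1 (n3 h')
      · exact absurd (h.2.symm.trans h'.2) hc
    · exact h
  have hdisj : ∀ c t c' t', c ≠ 0 → c' ≠ 0 → c ≠ c' → (ConcSched.subtask b u s c).IsResult t →
      (ConcSched.subtask b u s c').IsResult t' → ∀ v ∈ t.verts, v ∈ t'.verts → v ∈ B := by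
    intro c t c' t' hc hc' hcc ht ht' v hvt hvt'
    rw [hv c t hc ht] at hvt
    rw [hv c' t' hc' ht'] at hvt'
    rw [hBmem]
    rcases hvt with h | h | h | h
    · rcases hvt' with h' | h' | h' | h'
      · exact absurd (h.2.symm.trans h'.2) hcc
      · exact .inl h'.1
      · exact .inl h'.1
      · exact .inr h'
    · exact .inl h.1
    · exact .inl h.1
    · exact .inr h
  have hin : ∀ {v}, v ∈ (Dec.node B t₁ (.node B t₂ t₃)).verts ↔ v ∈ u :: b.2.2 ∨ v ∈ U' := by
    intro v
    rw [Dec.mem_verts_node, Dec.mem_verts_node, hBmem, hv 1 t₁ (by norm_num) h₁,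
      hv 2 t₂ (by norm_num) h₂, hv 3 t₃ (by norm_num) h₃]
    constructor
    · have hcase : ∀ c, (v ∈ U' ∧ lbl s v = c) ∨ (v ∈ u :: b.2.2 ∧ lbl s v = c) ∨
          (v ∈ u :: b.2.2 ∧ lbl s v = 0) ∨ (v ∈ U' ∧ lbl s v = 0) → v ∈ u :: b.2.2 ∨ v ∈ U' := by
        rintro c (h | h | h | h)
        exacts [.inr h.1, .inl h.1, .inl h.1, .inr h.1]
      rintro ((h | h) | h | (h | h) | h | h)
      exacts [.inl h, .inr h.1, hcase 1 h, .inl h, .inr h.1, hcase 2 h, hcase 3 h]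
    · intro h
      have h4 := hlt v h
      rcases h with h | h
      · exact .inl (.inl h)
      · have : lbl s v = 0 ∨ lbl s v = 1 ∨ lbl s v = 2 ∨ lbl s v = 3 := by omega
        rcases this with h' | h' | h' | h'
        · exact .inl (.inr ⟨h, h'⟩)
        · exact .inr (.inl (.inl ⟨h, h'⟩))
        · exact .inr (.inr (.inr (.inl (.inl ⟨h, h'⟩))))
        · exact .inr (.inr (.inr (.inr (.inl ⟨h, h'⟩))))
  refine ⟨⟨hBn, h₁.valid, ⟨hBn, h₂.valid, h₃.valid, ?_, ?_, ?_⟩, ?_, ?_, ?_⟩, ?_, ?_, ?_, ?_, ?_⟩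
  · exact hdisj 2 t₂ 3 t₃ (by norm_num) (by norm_num) (by norm_num) h₂ h₃
  · exact hroot 2 t₂ (by norm_num) h₂
  · exact hroot 3 t₃ (by norm_num) h₃
  · intro v hv1 hv2
    rcases Dec.mem_verts_node.1 hv2 with h | h | h
    · exact h
    · exact hdisj 1 t₁ 2 t₂ (by norm_num) (by norm_num) (by norm_num) h₁ h₂ v hv1 h
    · exact hdisj 1 t₁ 3 t₃ (by norm_num) (by norm_num) (by norm_num) h₁ h₃ v hv1 h
  · exact hroot 1 t₁ (by norm_num) h₁
  · exact fun v _ h => h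
  · intro v
    rw [hin, hU, List.mem_cons, List.mem_cons, or_assoc, or_assoc, or_comm (a := v ∈ b.2.2)]
  · intro v hv
    exact (hBmem v).2 (.inl (List.mem_cons_of_mem _ hv))
  · intro x hx y hy hxy
    rw [hin] at hx hy
    have hcomp := hs.compat x (hmem x (List.mem_append.2 hx)) y (hmem y (List.mem_append.2 hy)) hxy
    have hbags : ∀ c, c ∈ (Dec.node B t₁ (.node B t₂ t₃)).bags ↔
        c = B ∨ c ∈ t₁.bags ∨ c ∈ t₂.bags ∨ c ∈ t₃.bags := fun c => by
      simp only [Dec.bags, List.mem_cons, List.mem_append]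
      constructor
      · rintro (h | h | h | h | h)
        exacts [.inl h, .inr (.inl h), .inl h, .inr (.inr (.inl h)), .inr (.inr (.inr h))]
      · rintro (h | h | h | h)
        exacts [.inl h, .inr (.inl h), .inr (.inr (.inr (.inl h))), .inr (.inr (.inr (.inr h)))]
    have hsub : ∀ c t, c ≠ 0 → (ConcSched.subtask b u s c).IsResult t →
        (∀ d ∈ t.bags, d ∈ (Dec.node B t₁ (.node B t₂ t₃)).bags) →
        (lbl s x = c ∨ lbl s x = 0) → (lbl s y = c ∨ lbl s y = 0) →
        ∃ d ∈ (Dec.node B t₁ (.node B t₂ t₃)).bags, x ∈ d ∧ y ∈ d := by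
      intro c t hc ht hd hx' hy'
      have hcase : ∀ v, v ∈ u :: b.2.2 ∨ v ∈ U' → lbl s v = c ∨ lbl s v = 0 → v ∈ t.verts := by
        intro v h h'
        rw [hv c t hc ht]
        rcases h with h | h <;> rcases h' with h' | h'
        exacts [.inr (.inl ⟨h, h'⟩), .inr (.inr (.inl ⟨h, h'⟩)), .inl ⟨h, h'⟩,
          .inr (.inr (.inr ⟨h, h'⟩))]
      obtain ⟨d, hd', h⟩ := ht.covers x (hcase x hx hx') y (hcase y hy hy') hxy
      exact ⟨d, hd d hd', h⟩
    have hx4 := hlt x hx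
    have hy4 := hlt y hy
    -- Adjacent vertices never lie in two different parts, so some part together with the separator
    -- contains both, and the corresponding subtree covers the edge. If both are in the separator,
    -- any part will do.
    have hcase : ∃ c, c ≠ 0 ∧ c < 4 ∧ (lbl s x = c ∨ lbl s x = 0) ∧ (lbl s y = c ∨ lbl s y = 0) := by
      by_cases h0 : lbl s x = 0
      · by_cases h1 : lbl s y = 0
        · exact ⟨1, by omega, by omega, .inr h0, .inr h1⟩
        · exact ⟨lbl s y, h1, hy4, .inr h0, .inl rfl⟩
      · exact ⟨lbl s x, h0, hx4, .inl rfl, by omega⟩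
    obtain ⟨c, hc, hc4, hxc, hyc⟩ := hcase
    have : c = 1 ∨ c = 2 ∨ c = 3 := by omega
    rcases this with rfl | rfl | rfl
    · exact hsub 1 t₁ hc h₁ (fun d hd => (hbags d).2 (.inr (.inl hd))) hxc hyc
    · exact hsub 2 t₂ hc h₂ (fun d hd => (hbags d).2 (.inr (.inr (.inl hd)))) hxc hyc
    · exact hsub 3 t₃ hc h₃ (fun d hd => (hbags d).2 (.inr (.inr (.inr hd)))) hxc hyc
  -- At most `2k + 5` prescribed vertices including `u`, and at most `k + 1` further separator
  -- vertices.
  · have hBlen : B.length ≤ 3 * b.1.2.1 + 6 := by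
      have h1 := hs.sep _ n2 fun v hv => hmem v (List.mem_append.2 (.inr hv))
      have h2 := h.length
      rw [hB, List.length_append, List.length_cons]
      omega
    intro d hd
    simp only [Dec.bags, List.mem_cons, List.mem_append] at hd
    rcases hd with rfl | hd | rfl | hd | hd
    · exact hBlen
    · exact h₁.length d hd
    · exact hBlen
    · exact h₂.length d hd
    · exact h₃.length d hd
  · exact Dec.noConfusion

theorem Task.Good.isResult_baseCase {b : Task} (h : b.Good) {t : Dec} (ht : baseCase b = some t) :
    b.IsResult t := by
  unfold baseCase at ht
  cases hU : b.2.1 with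
  | cons u U' => simp [hU] at ht
  | nil =>
    obtain rfl : Dec.node b.2.2 .leaf .leaf = t := by simpa [hU] using ht
    have hnd := h.nodup
    rw [hU, List.nil_append] at hnd
    refine ⟨⟨hnd, trivial, trivial, ?_, ?_, ?_⟩, ?_, ?_, ?_, ?_, ?_⟩
    · simp [Dec.verts]
    · simp [Dec.verts]
    · simp [Dec.verts]
    · intro v
      simp [Dec.verts, hU]
    · exact fun v hv => hv
    · intro x hx y hy _
      exact ⟨b.2.2, by simp [Dec.bags], by simpa [Dec.verts] using hx, by simpa [Dec.verts] using hy⟩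
    · intro B hB
      obtain rfl : B = b.2.2 := by simpa [Dec.bags] using hB
      have := h.length
      omega
    · exact Dec.noConfusion

/-- Nothing is assumed about the treewidth: if `k` is too small, the recursion may fail, but
whatever it returns is a correct decomposition. -/
theorem Task.Good.isResult_build {n : ℕ} {b : Task} (h : b.Good) {t : Dec}
    (ht : build n b = some t) : b.IsResult t := by
  unfold build at ht
  induction n generalizing b t with
  | zero => exact h.isResult_baseCase ht
  | succ n ih =>
    rw [treeRec] at ht
    cases hb : expand b with
    | none =>
      rw [hb] at ht
      exact h.isResult_baseCase ht
    | some c =>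
      rw [hb] at ht
      obtain ⟨u, U', s, hU, hs, rfl⟩ := expand_eq_some.1 hb
      have hsep := isSep_of_findSep h.valid h.covers
        (fun v hv => h.mem_append hU v (List.mem_append.2 (.inl hv))) hs
      simp only [Option.elim_some, ConcSched.join, Option.bind_eq_some_iff] at ht
      obtain ⟨t₁, ht₁, t₂, ht₂, t₃, ht₃, ht⟩ := ht
      obtain rfl := Option.some.inj ht
      exact .join h hU hsep (ih (h.subtask hU hsep (by norm_num) (by norm_num)) ht₁)
        (ih (h.subtask hU hsep (by norm_num) (by norm_num)) ht₂)
        (ih (h.subtask hU hsep (by norm_num) (by norm_num)) ht₃)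

/-- The only possible failure is a missing separator. `exists_findSep` excludes it once the cap
admits all labelings with four labels of the at most `2k + 5` vertices to be balanced and of the
bags at hand. -/
theorem Task.Good.exists_build {n : ℕ} {b : Task} (h : b.Good) (hn : b.2.1.length ≤ n)
    (hN : 4 ^ (2 * b.1.2.1 + 5) ≤ b.1.1.2) (hDN : ∀ B ∈ b.1.2.2.bags, 4 ^ B.length ≤ b.1.1.2)
    {t : Dec} (ht : t.Valid) (htc : t.Covers (adjP b.1.1.1))
    (htb : ∀ B ∈ t.bags, B.length ≤ b.1.2.1 + 1) (htD : ∀ v ∈ b.1.2.2.verts, v ∈ t.verts) :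
    ∃ t', build n b = some t' := by
  unfold build
  induction n generalizing b with
  | zero =>
    have : b.2.1 = [] := List.length_eq_zero_iff.1 (by omega)
    simp [treeRec, baseCase, this]
  | succ n ih =>
    rw [treeRec]
    cases hU : b.2.1 with
    | nil => simp [expand, hU, baseCase]
    | cons u U' =>
      obtain ⟨n1, n2, n3⟩ := List.nodup_append'.1 (h.nodup_append hU)
      have hmem := fun v hv => h.mem_append hU v (List.mem_append.2 (.inl hv))
      obtain ⟨s, hs⟩ := exists_findSep h.valid h.covers hmem n1 (by simp)
        ((Nat.pow_le_pow_right (by norm_num) (by have := h.length; simp; omega)).trans hN) hDN ht htc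
        htb htD
      have hb := expand_eq_some.2 ⟨u, U', s, hU, hs, rfl⟩
      have hsep := isSep_of_findSep h.valid h.covers hmem hs
      have hlen := length_part_le s U'
      have hsub : ∀ c, (ConcSched.subtask b u s c).2.1 = part s c U' := fun c => by
        simp [ConcSched.subtask, hU]
      have key : ∀ c, c ≠ 0 → c < 4 → (part s c U').length ≤ n → ∃ t',
          treeRec expand baseCase ConcSched.join n (ConcSched.subtask b u s c) = some t' :=
        fun c hc hc' hcn =>
        ih (h.subtask hU hsep hc hc') (by rwa [hsub]) hN hDN htc htb htD
      rw [hU, List.length_cons] at hn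
      obtain ⟨t₁, h₁⟩ := key 1 (by norm_num) (by norm_num) (by omega)
      obtain ⟨t₂, h₂⟩ := key 2 (by norm_num) (by norm_num) (by omega)
      obtain ⟨t₃, h₃⟩ := key 3 (by norm_num) (by norm_num) (by omega)
      rw [hb]
      simp [h₁, h₂, h₃, ConcSched.join]

/-- `t` is a tree decomposition of the vertices in `l`, with bags of size at most `3 * k + 6`. -/
structure IsDecomposition (rows : List (List Bool)) (k : ℕ) (l : List ℕ) (t : Dec) : Prop where
  valid : t.Valid
  verts : ∀ v, v ∈ t.verts ↔ v ∈ l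
  covers : t.Covers (adjP rows)
  length : ∀ B ∈ t.bags, B.length ≤ 3 * k + 6
  ne_leaf : t ≠ .leaf

theorem IsDecomposition.good {c : (List (List Bool) × ℕ) × ℕ} {l : List ℕ} {v : ℕ}
    (hl : (v :: l).Nodup) {t : Dec} (ht : IsDecomposition c.1.1 c.2 l t) :
    Task.Good ((c.1, c.2, addVertex v t), v :: l, []) := by
  rw [List.nodup_cons] at hl
  refine ⟨valid_addVertex ht.valid (by rw [ht.verts]; exact hl.1), covers_addVertex ht.covers, ?_,
    ?_, by simp⟩
  · simpa using hl
  · intro w hw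
    dsimp only at *
    rw [List.append_nil, List.mem_cons] at hw
    rw [mem_verts_addVertex, ht.verts]
    rcases hw with hw | hw
    · exact .inr ⟨hw, ht.ne_leaf⟩
    · exact .inl hw

theorem isDecomposition_decompose {c : (List (List Bool) × ℕ) × ℕ} {l : List ℕ} (hl : l.Nodup)
    {t : Dec} (ht : (decompose c l).2 = some t) : IsDecomposition c.1.1 c.2 l t := by
  induction l generalizing t with
  | nil =>
    obtain rfl : Dec.node [] .leaf .leaf = t := by simpa [decompose] using ht
    exact ⟨by simp [Dec.Valid, Dec.verts], by simp [Dec.verts],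
      fun u hu => by simp [Dec.verts] at hu, by simp [Dec.bags], Dec.noConfusion⟩
  | cons v l ih =>
    rw [decompose, List.foldr_cons, ← decompose, addStep, decompose_fst] at ht
    obtain ⟨t', ht', ht⟩ := Option.bind_eq_some_iff.1 ht
    have h := ih (List.nodup_cons.1 hl).2 ht'
    obtain ⟨h1, h2, -, h4, h5, h6⟩ := (h.good hl).isResult_build ht
    exact ⟨h1, fun w => by simpa using h2 w, h4, h5, h6⟩

theorem exists_decompose {c : (List (List Bool) × ℕ) × ℕ} {l : List ℕ} (hl : l.Nodup)
    (hN : 4 ^ (3 * c.2 + 7) ≤ c.1.2) {t : Dec} (ht : t.Valid) (htc : t.Covers (adjP c.1.1))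
    (htb : ∀ B ∈ t.bags, B.length ≤ c.2 + 1) (htl : ∀ v ∈ l, v ∈ t.verts) :
    ∃ t', (decompose c l).2 = some t' := by
  induction l with
  | nil => simp [decompose]
  | cons v l ih =>
    obtain ⟨t', ht'⟩ := ih (List.nodup_cons.1 hl).2 fun w hw => htl w (List.mem_cons_of_mem _ hw)
    have h := isDecomposition_decompose (List.nodup_cons.1 hl).2 ht'
    rw [decompose, List.foldr_cons, ← decompose, addStep, decompose_fst]
    dsimp only
    rw [ht', Option.bind_some]
    refine (h.good hl).exists_build le_rfl
      ((Nat.pow_le_pow_right (by norm_num) (by dsimp only; omega)).trans hN)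
      ?_ ht htc htb ?_
    · intro B hB
      dsimp only at hB ⊢
      rw [bags_addVertex] at hB
      obtain ⟨B', hB', rfl⟩ := List.mem_map.1 hB
      -- The previous bags have at most `3k + 6` vertices, and the new vertex adds one; this is the
      -- exponent `3k + 7`.
      refine (Nat.pow_le_pow_right (by norm_num) ?_).trans hN
      have := h.length B' hB'
      rw [List.length_cons]
      omega
    · intro w hw
      dsimp only at hw
      rw [mem_verts_addVertex, h.verts] at hw
      rcases hw with hw | ⟨rfl, -⟩
      · exact htl w (List.mem_cons_of_mem _ hw)
      · exact htl _ List.mem_cons_self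

end ConcSched

namespace ConcSched

/-! ### Tree decompositions as rooted binary trees of bags -/

/-- A bag can be attached as a new leaf below any bag that contains all its old vertices. Keeping
the root bag fixed makes the induction go through, since validity at the parent refers to it. -/
theorem Dec.exists_insert {B b : List ℕ} (hB : B.Nodup) {t : Dec} (ht : t.Valid) (hb : b ∈ t.bags)
    (h : ∀ v ∈ B, v ∈ t.verts → v ∈ b) : ∃ t' : Dec, t'.Valid ∧ t'.root = t.root ∧
      (∀ c, c ∈ t'.bags ↔ c ∈ t.bags ∨ c = B) ∧ ∀ v, v ∈ t'.verts ↔ v ∈ t.verts ∨ v ∈ B := by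
  induction t with
  | leaf => cases hb
  | node B₀ l r hl hr =>
    obtain ⟨h1, h2, h3, h4, h5, h6⟩ := ht
    simp only [bags, List.mem_cons, List.mem_append] at hb
    rcases hb with rfl | hb | hb
    -- The bag `b` is repeated on a new node, so that the tree stays binary.
    · refine ⟨node b (node B leaf leaf) (node b l r), ⟨h1, ?_, ⟨h1, h2, h3, h4, h5, h6⟩,
        ?_, ?_, ?_⟩, rfl, ?_, ?_⟩
      · simp [Valid, hB, verts]
      · intro v hv hv'
        exact h v (by simpa [verts] using hv) hv'
      · intro v hv _
        simpa [verts, root] using hv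
      · intro v _ hv
        exact hv
      · intro c
        simp only [bags, List.mem_cons, List.mem_append, List.append_nil, List.not_mem_nil]
        tauto
      · intro v
        rw [mem_verts_node, mem_verts_node (B := B), mem_verts_node (B := b)]
        simp only [verts, Finset.notMem_empty]
        tauto
    · obtain ⟨t', k1, k2, k3, k4⟩ := hl h2 hb fun v hv hv' =>
        h v hv (mem_verts_node.2 (.inr (.inl hv')))
      refine ⟨node B₀ t' r, ⟨h1, k1, h3, ?_, ?_, h6⟩, rfl, ?_, ?_⟩
      · intro v hv hv'
        rcases (k4 v).1 hv with hv | hv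
        · exact h4 v hv hv'
        · exact h4 v (mem_verts_of_mem_bag hb (h v hv (mem_verts_node.2 (.inr (.inr hv'))))) hv'
      · intro v hv hv'
        rw [k2]
        rcases (k4 v).1 hv with hv | hv
        · exact h5 v hv hv'
        · exact h5 v (mem_verts_of_mem_bag hb (h v hv (mem_verts_node.2 (.inl hv')))) hv'
      · intro c
        simp only [bags, List.mem_cons, List.mem_append, k3]
        tauto
      · intro v
        rw [mem_verts_node, mem_verts_node, k4]
        simp only [or_assoc, or_comm, or_left_comm]
    · obtain ⟨t', k1, k2, k3, k4⟩ := hr h3 hb fun v hv hv' =>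
        h v hv (mem_verts_node.2 (.inr (.inr hv')))
      refine ⟨node B₀ l t', ⟨h1, h2, k1, ?_, h5, ?_⟩, rfl, ?_, ?_⟩
      · intro v hv' hv
        rcases (k4 v).1 hv with hv | hv
        · exact h4 v hv' hv
        · exact h4 v hv' (mem_verts_of_mem_bag hb (h v hv (mem_verts_node.2 (.inr (.inl hv')))))
      · intro v hv hv'
        rw [k2]
        rcases (k4 v).1 hv with hv | hv
        · exact h6 v hv hv'
        · exact h6 v (mem_verts_of_mem_bag hb (h v hv (mem_verts_node.2 (.inl hv')))) hv'
      · intro c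
        simp only [bags, List.mem_cons, List.mem_append, k3]
        tauto
      · intro v
        rw [mem_verts_node, mem_verts_node, k4]
        simp only [or_comm, or_left_comm]

theorem Dec.exists_mem_bag {t : Dec} {v : ℕ} (hv : v ∈ t.verts) : ∃ b ∈ t.bags, v ∈ b := by
  induction t with
  | leaf => simp [verts] at hv
  | node B l r hl hr =>
    rw [mem_verts_node] at hv
    simp only [bags, List.mem_cons, List.mem_append]
    rcases hv with hv | hv | hv
    · exact ⟨B, .inl rfl, hv⟩
    · obtain ⟨b, hb, h⟩ := hl hv
      exact ⟨b, .inr (.inl hb), h⟩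
    · obtain ⟨b, hb, h⟩ := hr hv
      exact ⟨b, .inr (.inr hb), h⟩

/-- Remove a leaf `x` of the tree, with neighbour `y`, and attach its bag again below that of `y`: a
vertex of the bag of `x` that occurs elsewhere lies in the bag of `y`, since any walk leaving `x`
goes through `y`. -/
theorem Dec.exists_of_isTree (n : ℕ) : ∀ {α : Type} [Fintype α] {T : SimpleGraph α}
    (_ : T.IsTree) (bag : α → List ℕ) (_ : ∀ x, (bag x).Nodup)
    (_ : ∀ v a b, v ∈ bag a → v ∈ bag b → ∃ p : T.Walk a b, ∀ z ∈ p.support, v ∈ bag z)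
    (_ : Fintype.card α = n), ∃ t : Dec, t.Valid ∧ ∀ b, b ∈ t.bags ↔ ∃ x, b = bag x := by
  classical
  induction n with
  | zero =>
    intro α _ T hT bag hnd hc hn
    have := hT.connected.nonempty
    have := Fintype.card_pos (α := α)
    omega
  | succ n ih =>
    intro α _ T hT bag hnd hc hn
    have hne := hT.connected.nonempty
    rcases subsingleton_or_nontrivial α with hs | hs
    · obtain ⟨x⟩ := hne
      refine ⟨node (bag x) leaf leaf, by simp [Valid, hnd, verts], fun b => ?_⟩
      simp only [bags, List.append_nil, List.mem_singleton]
      exact ⟨fun h => ⟨x, h⟩, fun ⟨y, h⟩ => Subsingleton.elim y x ▸ h⟩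
    · obtain ⟨x, hx⟩ := hT.exists_vert_degree_one_of_nontrivial
      obtain ⟨y, hxy, hy⟩ := SimpleGraph.degree_eq_one_iff_existsUnique_adj.1 hx
      have hsub : (T.neighborSet x).Subsingleton := fun a ha b hb => (hy a ha).trans (hy b hb).symm
      have hT' : (T.induce {x}ᶜ).IsTree :=
        ⟨hT.connected.induce_compl_singleton_of_degree_eq_one hx, hT.isAcyclic.induce _⟩
      obtain ⟨t, ht, hb⟩ := ih hT' (fun z => bag z) (fun z => hnd z) (by
        rintro v ⟨a, ha⟩ ⟨b, hb⟩ hva hvb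
        obtain ⟨p, hp⟩ := hc v a b hva hvb
        -- A path between other nodes cannot pass through the leaf `x`, which has only one
        -- neighbour.
        have hx' : ∀ z ∈ p.toPath.1.support, z ∈ ({x}ᶜ : Set α) := by
          rintro z hz rfl
          exact p.toPath.2.isTrail.not_mem_support_of_subsingleton_neighborSet
            (fun h => ha h.symm) (fun h => hb h.symm) hsub hz
        refine ⟨p.toPath.1.induce _ hx', ?_⟩
        rintro ⟨z, hz⟩ hz'
        refine hp z (p.support_toPath_subset_support ?_)
        rw [SimpleGraph.Walk.support_induce] at hz'
        simpa using hz') (by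
          rw [Fintype.card_compl_set, hn, Set.card_singleton]
          rfl)
      obtain ⟨t', k1, -, k3, -⟩ := exists_insert (hnd x) ht ((hb _).2 ⟨⟨y, hxy.ne'⟩, rfl⟩) (by
        intro v hv hv'
        obtain ⟨c, hc', hvc⟩ := exists_mem_bag hv'
        obtain ⟨⟨z, hz⟩, rfl⟩ := (hb c).1 hc'
        obtain ⟨p, hp⟩ := hc v x z hv hvc
        cases p with
        | nil => exact absurd rfl hz
        | cons h q =>
          obtain rfl := hy _ h
          exact hp _ (by simp))
      refine ⟨t', k1, fun b => ?_⟩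
      rw [k3, hb]
      constructor
      · rintro (⟨z, rfl⟩ | rfl)
        exacts [⟨_, rfl⟩, ⟨_, rfl⟩]
      · rintro ⟨z, rfl⟩
        by_cases hz : z = x
        · exact .inr (by rw [hz])
        · exact .inl ⟨⟨z, hz⟩, rfl⟩

-- The decomposition with a single bag shows that the set of admissible widths is nonempty, so its
-- infimum is attained.
open Classical in
theorem treewidth_spec {n : ℕ} (G : SimpleGraph (Fin n)) :
    treewidth G ≤ n - 1 ∧ ∃ (m : ℕ) (T : SimpleGraph (Fin m)) (bag : Fin m → Finset (Fin n)),
      IsTreeDecomposition G T bag ∧ ∀ x, (bag x).card ≤ treewidth G + 1 := by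
  have h : n - 1 ∈ {k | ∃ (m : ℕ) (T : SimpleGraph (Fin m)) (bag : Fin m → Finset (Fin n)),
      IsTreeDecomposition G T bag ∧ ∀ x, (bag x).card ≤ k + 1} := by
    refine ⟨1, ⊥, fun _ => Finset.univ, ⟨SimpleGraph.IsTree.of_subsingleton, fun v => ⟨0, by simp⟩,
      fun u v _ => ⟨0, by simp⟩, fun v => ?_⟩, fun _ => by
        rw [Finset.card_univ, Fintype.card_fin]
        omega⟩
    have : Nonempty {x : Fin 1 | v ∈ (Finset.univ : Finset (Fin n))} := ⟨⟨0, by simp⟩⟩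
    exact SimpleGraph.IsTree.of_subsingleton.connected
  exact ⟨Nat.sInf_le h, Nat.sInf_mem ⟨n - 1, h⟩⟩

/-- A graph has a rooted tree decomposition whose width is the treewidth. -/
theorem exists_dec_of_treewidth {n : ℕ} (G : SimpleGraph (Fin n)) :
    ∃ t : Dec, t.Valid ∧ (∀ v, v ∈ t.verts ↔ v < n) ∧
      (∀ b ∈ t.bags, b.length ≤ treewidth G + 1) ∧
      ∀ u v : Fin n, G.Adj u v → ∃ b ∈ t.bags, (u : ℕ) ∈ b ∧ (v : ℕ) ∈ b := by
  classical
  obtain ⟨m, T, bag, hT, hc⟩ := (treewidth_spec G).2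
  have hm : ∀ v x, v ∈ (bag x).toList.map Fin.val ↔ ∃ h : v < n, ⟨v, h⟩ ∈ bag x := by
    intro v x
    simp only [List.mem_map, Finset.mem_toList]
    exact ⟨fun ⟨a, ha, h⟩ => h ▸ ⟨a.2, ha⟩, fun ⟨h, ha⟩ => ⟨_, ha, rfl⟩⟩
  obtain ⟨t, ht, hb⟩ := Dec.exists_of_isTree m hT.isTree (fun x => (bag x).toList.map Fin.val)
    (fun x => (Finset.nodup_toList _).map Fin.val_injective) (by
      intro v a b ha hb
      obtain ⟨hv, ha⟩ := (hm v a).1 ha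
      obtain ⟨p⟩ := (hT.connected ⟨v, hv⟩).preconnected ⟨a, ha⟩ ⟨b, ((hm v b).1 hb).2⟩
      refine ⟨p.map (SimpleGraph.Embedding.induce _).toHom, fun z hz => ?_⟩
      obtain ⟨⟨y, hy⟩, -, rfl⟩ := List.mem_map.1 ((SimpleGraph.Walk.support_map _ p) ▸ hz)
      exact (hm v y).2 ⟨hv, hy⟩) (Fintype.card_fin m)
  refine ⟨t, ht, fun v => ⟨fun hv => ?_, fun hv => ?_⟩, fun b h => ?_, fun u v h => ?_⟩
  · obtain ⟨b, h, hvb⟩ := Dec.exists_mem_bag hv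
    obtain ⟨x, rfl⟩ := (hb b).1 h
    exact ((hm v x).1 hvb).1
  · obtain ⟨x, hx⟩ := hT.vertex_mem ⟨v, hv⟩
    exact Dec.mem_verts_of_mem_bag ((hb _).2 ⟨x, rfl⟩) ((hm v x).2 ⟨hv, hx⟩)
  · obtain ⟨x, rfl⟩ := (hb b).1 h
    simpa using hc x
  · obtain ⟨x, hx, hx'⟩ := hT.edge_mem u v h
    exact ⟨_, (hb _).2 ⟨x, rfl⟩, (hm _ x).2 ⟨u.2, hx⟩, (hm _ x).2 ⟨v.2, hx'⟩⟩

/-! ### Orientations with few owned edges per vertex -/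

/-- Every edge covered by the decomposition is owned by one of its ends, at most `w` per vertex. -/
theorem Dec.exists_orientation {w : ℕ} {t : Dec} (ht : t.Valid) (hw : ∀ b ∈ t.bags, b.length ≤ w) :
    ∃ P : ℕ → Finset ℕ, (∀ v, (P v).card ≤ w) ∧ (∀ v ∈ t.root, P v = t.root.toFinset) ∧
      ∀ b ∈ t.bags, ∀ u ∈ b, ∀ v ∈ b, u ∈ P v ∨ v ∈ P u := by
  classical
  induction t with
  | leaf => exact ⟨fun _ => ∅, by simp, by simp [root], by simp [bags]⟩
  | node B l r hl hr =>
    obtain ⟨h1, h2, h3, h4, h5, h6⟩ := ht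
    simp only [bags, List.mem_cons, List.mem_append] at hw
    obtain ⟨Pl, l1, l2, l3⟩ := hl h2 fun b hb => hw b (.inr (.inl hb))
    obtain ⟨Pr, r1, r2, r3⟩ := hr h3 fun b hb => hw b (.inr (.inr hb))
    -- `P v` is the topmost bag that contains `v`. If two vertices share a bag, the topmost bag of
    -- one of them contains the other.
    refine ⟨fun v => if v ∈ B then B.toFinset else if v ∈ l.verts then Pl v else Pr v,
      fun v => ?_, fun v hv => ?_, fun b hb u hu v hv => ?_⟩
    · dsimp only
      split_ifs
      exacts [(List.toFinset_card_le B).trans (hw B (.inl rfl)), l1 v, r1 v]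
    · exact if_pos hv
    · have key (s : Dec) (P : ℕ → Finset ℕ) (hb : b ∈ s.bags)
          (hs : ∀ v ∈ s.verts, v ∈ B → v ∈ s.root) (hP : ∀ v ∈ s.root, P v = s.root.toFinset)
          (h : ∀ b ∈ s.bags, ∀ u ∈ b, ∀ v ∈ b, u ∈ P v ∨ v ∈ P u) {Q : ℕ → Finset ℕ}
          (hQ : ∀ v ∈ B, Q v = B.toFinset) (hQ' : ∀ v ∈ s.verts, v ∉ B → Q v = P v) :
          u ∈ Q v ∨ v ∈ Q u := by
        have hus := mem_verts_of_mem_bag hb hu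
        have hvs := mem_verts_of_mem_bag hb hv
        -- Moving the topmost bag of `x` up to `B` loses no edge: if the subtree recorded the edge
        -- as `y ∈ P x`, then `y` is in the root bag of the subtree, which is therefore also `P y`
        -- and contains `x`.
        have aux : ∀ x ∈ s.verts, ∀ y ∈ s.verts, x ∈ B → y ∉ B → x ∈ P y ∨ y ∈ P x → x ∈ Q y := by
          intro x hx y hy hxB hyB hxy
          have hxr := hs x hx hxB
          rw [hQ' y hy hyB]
          refine hxy.elim id fun hyx => ?_
          rw [hP x hxr, List.mem_toFinset] at hyx
          rwa [hP y hyx, List.mem_toFinset]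
        have huv := h b hb u hu v hv
        by_cases huB : u ∈ B <;> by_cases hvB : v ∈ B
        · exact .inl (by rwa [hQ v hvB, List.mem_toFinset])
        · exact .inl (aux u hus v hvs huB hvB huv)
        · exact .inr (aux v hvs u hus hvB huB huv.symm)
        · rwa [hQ' u hus huB, hQ' v hvs hvB]
      simp only [bags, List.mem_cons, List.mem_append] at hb
      rcases hb with rfl | hb | hb
      · exact .inl (by dsimp only; rwa [if_pos hv, List.mem_toFinset])
      · refine key l Pl hb h5 l2 l3 (Q := fun v => if v ∈ B then B.toFinset else
          if v ∈ l.verts then Pl v else Pr v) (fun v hv => if_pos hv) fun v hv hvB => ?_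
        rw [if_neg hvB, if_pos hv]
      · refine key r Pr hb h6 r2 r3 (Q := fun v => if v ∈ B then B.toFinset else
          if v ∈ l.verts then Pl v else Pr v) (fun v hv => if_pos hv) fun v hv hvB => ?_
        rw [if_neg hvB, if_neg fun hl => hvB (h4 v hl hv)]

end ConcSched

namespace ConcSched

/-! ### Schedules that cannot be shifted to the left -/

theorem Instance.feasible_iff {I : Instance} {C : I.Schedule} : I.Feasible C ↔
    (∀ j, I.p j ≤ C j) ∧
      ∀ i j, I.graph.Adj i j → C i + I.p j ≤ C j ∨ C j + I.p i ≤ C i := by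
  constructor
  · rintro ⟨h1, h2⟩
    refine ⟨fun j => by have := h1 j; omega, fun i j hij => ?_⟩
    by_contra hc
    push Not at hc
    have hi := I.p_pos i
    have hj := I.p_pos j
    -- If neither job precedes the other, the later of the two starting times lies in both
    -- intervals, as these are nonempty.
    have : max ((C i : ℤ) - I.p i) ((C j : ℤ) - I.p j) ∈
        Set.Ico ((C i : ℤ) - I.p i) (C i) ∩ Set.Ico ((C j : ℤ) - I.p j) (C j) := by
      simp only [Set.mem_inter_iff, Set.mem_Ico]
      omega
    rw [h2 i j hij] at this
    exact this
  · rintro ⟨h1, h2⟩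
    refine ⟨fun j => by have := h1 j; omega, fun i j hij => ?_⟩
    rw [Set.eq_empty_iff_forall_notMem]
    rintro x ⟨⟨a, b⟩, c, d⟩
    have := h2 i j hij
    omega

/-- Every feasible schedule can be shifted to the left until no job can start earlier. -/
theorem Instance.exists_shifted {I : Instance} {C : I.Schedule} (hC : I.Feasible C) :
    ∃ C' : I.Schedule, I.Feasible C' ∧ (∀ j, C' j ≤ C j) ∧
      ∀ j s, s + I.p j < C' j → ∃ i, I.graph.Adj i j ∧ s < C' i ∧ C' i < s + I.p j + I.p i := by
  classical
  -- Among the feasible schedules below `C`, one with minimum sum of completion times: moving a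
  -- single job to an earlier free place would decrease the sum.
  obtain ⟨C', ⟨h1, h2⟩, h3⟩ := (measure fun C : I.Schedule => ∑ j, C j).wf.has_min
    {C' | I.Feasible C' ∧ ∀ j, C' j ≤ C j} ⟨C, hC, fun _ => le_rfl⟩
  refine ⟨C', h1, h2, fun j s hs => ?_⟩
  by_contra hc
  push Not at hc
  obtain ⟨f1, f2⟩ := feasible_iff.1 h1
  refine h3 (Function.update C' j (s + I.p j)) ⟨feasible_iff.2 ⟨fun i => ?_, fun i k hik => ?_⟩,
    fun i => ?_⟩ ?_
  · rw [Function.update_apply]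
    split_ifs with h
    · subst h
      omega
    · exact f1 i
  · rw [Function.update_apply, Function.update_apply]
    split_ifs with hi hk hk
    · subst hi hk
      exact absurd hik (I.graph.loopless.irrefl _)
    · subst hi
      have := hc k hik.symm
      omega
    · subst hk
      have := hc i hik
      omega
    · exact f2 i k hik
  · rw [Function.update_apply]
    split_ifs with h
    · subst h
      exact hs.le.trans (h2 i)
    · exact h2 i
  · change ∑ i, Function.update C' j (s + I.p j) i < ∑ i, C' i
    refine Finset.sum_lt_sum (fun i _ => ?_) ⟨j, Finset.mem_univ j, ?_⟩
    · rw [Function.update_apply]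
      split_ifs with h
      · subst h
        exact hs.le
      · exact le_rfl
    · rw [Function.update_self]
      exact hs

/-- If the graph has an orientation of indegree at most `w`, then at most half of the jobs that
start at time `s` or later start at time `s + 12 w p` or later. -/
theorem Instance.card_late_le {I : Instance} {C : I.Schedule} {p w : ℕ} (hp : ∀ j, I.p j ≤ p)
    (hC : ∀ j s, s + I.p j < C j → ∃ i, I.graph.Adj i j ∧ s < C i ∧ C i < s + I.p j + I.p i)
    (P : Fin I.n → Finset (Fin I.n)) (hw : ∀ j, (P j).card ≤ w) (hw0 : 0 < w)
    (hP : ∀ i j, I.graph.Adj i j → i ∈ P j ∨ j ∈ P i) (s : ℕ) :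
    2 * (Finset.univ.filter fun j => s + 12 * w * p + I.p j ≤ C j).card ≤
      (Finset.univ.filter fun j => s + I.p j ≤ C j).card := by
  classical
  set X' := Finset.univ.filter fun j => s + 12 * w * p + I.p j ≤ C j with hX'
  set X := Finset.univ.filter fun j => s + I.p j ≤ C j with hX
  have hsub : X' ⊆ X := by
    intro j hj
    simp only [hX', hX, Finset.mem_filter, Finset.mem_univ, true_and] at *
    omega
  have h1 : ∀ j ∈ X', 4 * w ≤ (X.filter fun i => i ∈ P j).card +
      (X.filter fun i => j ∈ P i).card := by
    intro j hj
    simp only [hX', Finset.mem_filter, Finset.mem_univ, true_and] at hj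
    have hpj := I.p_pos j
    have hpj' := hp j
    -- The tested starting times `s + 3pq + p` are early enough for `j`, as `3p(q + 1) ≤ 12wp`. A
    -- blocking job completes more than `p` after `s`, so it starts after `s`; and it completes
    -- before the time tested for `q + 1`, so different `q` have different blocking jobs. For `q ≥
    -- 4w` the witness is a dummy.
    have h : ∀ q, ∃ i, q < 4 * w → I.graph.Adj i j ∧ s + 3 * (p * q) + p < C i ∧
        C i < s + 3 * (p * q) + p + I.p j + I.p i := by
      intro q
      by_cases hq : q < 4 * w
      · have h2 : p * (q + 1) ≤ p * (4 * w) := Nat.mul_le_mul le_rfl hq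
        have h3 : 12 * w * p = 3 * (p * (4 * w)) := by ring
        obtain ⟨i, hi⟩ := hC j (s + 3 * (p * q) + p) (by rw [h3] at hj; rw [mul_add] at h2; omega)
        exact ⟨i, fun _ => hi⟩
      · exact ⟨j, fun h => absurd h hq⟩
    choose f hf using h
    rw [← Finset.card_range (4 * w)]
    refine (Finset.card_le_card_of_injOn f (t := (X.filter fun i => i ∈ P j) ∪
      (X.filter fun i => j ∈ P i)) ?_ ?_).trans (Finset.card_union_le _ _)
    · intro q hq
      obtain ⟨k1, k2, k3⟩ := hf q (Finset.mem_range.1 hq)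
      have := hp (f q)
      have hfX : f q ∈ X := by
        simp only [hX, Finset.mem_filter, Finset.mem_univ, true_and]
        omega
      simp only [Finset.coe_union, Finset.coe_filter, Set.mem_union, Set.mem_ofPred_eq]
      rcases hP _ _ k1 with h | h
      · exact .inl ⟨hfX, h⟩
      · exact .inr ⟨hfX, h⟩
    · have aux : ∀ q q', q < 4 * w → q' < 4 * w → q < q' → f q ≠ f q' := by
        intro q q' hq hq' hlt he
        obtain ⟨-, -, a⟩ := hf q hq
        obtain ⟨-, b, -⟩ := hf q' hq'
        have h2 : p * (q + 1) ≤ p * q' := Nat.mul_le_mul le_rfl hlt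
        have := hp (f q')
        rw [he] at a
        rw [mul_add] at h2
        omega
      intro q hq q' hq' he
      by_contra hne
      rcases Nat.lt_or_gt_of_ne hne with h | h
      · exact aux q q' (Finset.mem_range.1 hq) (Finset.mem_range.1 hq') h he
      · exact aux q' q (Finset.mem_range.1 hq') (Finset.mem_range.1 hq) h he.symm
  -- Double counting: a job of `X'` has at most `w` neighbours in its own set `P j`, and the
  -- remaining pairs are counted at their other end in `X`, again at most `w` each.
  have h2 : X'.card * (4 * w) ≤ X.card * w + X.card * w := by
    calc X'.card * (4 * w) ≤ ∑ j ∈ X', ((X.filter fun i => i ∈ P j).card +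
          (X.filter fun i => j ∈ P i).card) := Finset.card_nsmul_le_sum _ _ _ h1
      _ = ∑ j ∈ X', (X.filter fun i => i ∈ P j).card +
          ∑ i ∈ X, (X'.filter fun j => j ∈ P i).card := by
        rw [Finset.sum_add_distrib]
        congr 1
        exact (Finset.sum_card_bipartiteAbove_eq_sum_card_bipartiteBelow (s := X) (t := X')
          fun i j => j ∈ P i).symm
      _ ≤ X'.card * w + X.card * w := by
        refine add_le_add (Finset.sum_le_card_nsmul _ _ _ fun j _ => ?_)
          (Finset.sum_le_card_nsmul _ _ _ fun j _ => ?_)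
        all_goals
          refine (Finset.card_le_card fun i hi => ?_).trans (hw j)
          exact (Finset.mem_filter.1 hi).2
      _ ≤ X.card * w + X.card * w := by
        gcongr
  refine Nat.le_of_mul_le_mul_right (c := 2 * w) ?_ (by omega)
  calc 2 * X'.card * (2 * w) = X'.card * (4 * w) := by ring
    _ ≤ _ := h2
    _ = X.card * (2 * w) := by ring

/-- A schedule that cannot be shifted to the left is short. -/
theorem Instance.exists_short_of_orientation {I : Instance} {C : I.Schedule} (h : I.Feasible C)
    {p w L : ℕ} (hp : ∀ j, I.p j ≤ p) (P : Fin I.n → Finset (Fin I.n))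
    (hw : ∀ j, (P j).card ≤ w) (hw0 : 0 < w)
    (hP : ∀ i j, I.graph.Adj i j → i ∈ P j ∨ j ∈ P i) (hL : I.n < 2 ^ L) :
    ∃ C' : I.Schedule, I.Feasible C' ∧ (∀ j, C' j ≤ C j) ∧ ∀ j, C' j ≤ 12 * w * p * L + p := by
  obtain ⟨C', h1, h2, h3⟩ := exists_shifted h
  refine ⟨C', h1, h2, fun j => ?_⟩
  -- Each further stretch of length `12wp` halves the number of jobs that start later; since `n < 2
  -- ^ L`, none is left after `L` stretches.
  have key : ∀ q, 2 ^ q *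
      (Finset.univ.filter fun j => 12 * w * p * q + I.p j ≤ C' j).card ≤ I.n := by
    intro q
    induction q with
    | zero =>
      simpa using Finset.card_le_univ (Finset.univ.filter fun j => 12 * w * p * 0 + I.p j ≤ C' j)
    | succ q ih =>
      have := card_late_le hp h3 P hw hw0 hP (12 * w * p * q)
      calc _ = 2 ^ q * (2 * (Finset.univ.filter fun j =>
            12 * w * p * q + 12 * w * p + I.p j ≤ C' j).card) := by
              rw [pow_succ, mul_assoc]
              rfl
        _ ≤ _ := (Nat.mul_le_mul le_rfl this).trans ih
  have h4 := key L
  have h5 : (Finset.univ.filter fun j => 12 * w * p * L + I.p j ≤ C' j) = ∅ := by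
    rw [← Finset.card_eq_zero]
    by_contra h0
    have := Nat.mul_le_mul (le_refl (2 ^ L)) (Nat.pos_of_ne_zero h0)
    omega
  have h6 : j ∉ Finset.univ.filter fun j => 12 * w * p * L + I.p j ≤ C' j := by
    rw [h5]
    exact Finset.notMem_empty j
  simp only [Finset.mem_filter, Finset.mem_univ, true_and] at h6
  have := hp j
  omega

theorem Instance.exists_short {I : Instance} {C : I.Schedule} (h : I.Feasible C) {p w L : ℕ}
    (hp : ∀ j, I.p j ≤ p) {t : Dec} (ht : t.Valid) (hw : ∀ b ∈ t.bags, b.length ≤ w) (hw0 : 0 < w)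
    (hc : ∀ u v : Fin I.n, I.graph.Adj u v → ∃ b ∈ t.bags, (u : ℕ) ∈ b ∧ (v : ℕ) ∈ b)
    (hL : I.n < 2 ^ L) :
    ∃ C' : I.Schedule, I.Feasible C' ∧ (∀ j, C' j ≤ C j) ∧ ∀ j, C' j ≤ 12 * w * p * L + p := by
  obtain ⟨P, h1, -, h2⟩ := Dec.exists_orientation ht hw
  refine exists_short_of_orientation h hp
    (fun j => Finset.univ.filter fun i => (i : ℕ) ∈ P j) (fun j => ?_) hw0 (fun i j hij => ?_) hL
  · refine (Finset.card_le_card_of_injOn Fin.val (fun i hi => ?_) Fin.val_injective.injOn).trans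
      (h1 j)
    simpa using hi
  · obtain ⟨b, hb, hi, hj⟩ := hc i j hij
    simpa using h2 b hb i hi j hj

end ConcSched

namespace ConcSched
open Polynomial
open Enc (enc)
variable {α β γ δ σ : Type} [Enc α] [Enc β] [Enc γ] [Enc δ] [Enc σ]

/-! ### Running times that are polynomial in a given parameter -/

/-- `f` is computable in time polynomial in `ν` and has values of size polynomial in `ν`. -/
def PTIn (ν : α → ℕ) (f : α → β) : Prop :=
  ∃ q : ℕ[X], (∀ x, sz (f x) ≤ q.eval (ν x)) ∧ RunsIn f fun x => q.eval (ν x)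

theorem PT.ptIn {ν : α → ℕ} {f : α → β} (hf : PT f) (hν : ∀ x, sz x ≤ ν x) : PTIn ν f := by
  obtain ⟨q, h1, h2⟩ := hf
  exact ⟨q, fun x => (h1 x).trans (eval_le_eval q (hν x)), h2.mono fun x => eval_le_eval q (hν x)⟩

theorem PTIn.comp {ν : α → ℕ} {μ : β → ℕ} {f : α → β} {g : β → γ} (hg : PTIn μ g) (hf : PTIn ν f)
    (r : ℕ[X]) (hr : ∀ x, μ (f x) ≤ r.eval (ν x)) : PTIn ν (fun x => g (f x)) := by
  obtain ⟨q, h1, h2⟩ := hg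
  obtain ⟨q', -, h2'⟩ := hf
  refine ⟨q.comp r + q' + 1, fun x => ?_, (h2.comp h2').mono fun x => ?_⟩
  all_goals
    have h3 := eval_le_eval q (hr x)
    have h4 := h1 (f x)
    simp only [eval_add, eval_comp, eval_one]
    omega

theorem PT.comp_ptIn {ν : α → ℕ} {f : α → β} {g : β → γ} (hg : PT g) (hf : PTIn ν f) :
    PTIn ν (fun x => g (f x)) :=
  (hg.ptIn (fun _ => le_rfl)).comp hf hf.choose hf.choose_spec.1

theorem PTIn.pair {ν : α → ℕ} {f : α → β} {g : α → γ} (hf : PTIn ν f) (hg : PTIn ν g) :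
    PTIn ν (fun x => (f x, g x)) := by
  obtain ⟨q, h1, h2⟩ := hf
  obtain ⟨q', h1', h2'⟩ := hg
  refine ⟨q + q' + 1, fun x => ?_, (h2.pair h2').mono fun x => ?_⟩
  · have := h1 x
    have := h1' x
    simp only [eval_add, eval_one, sz_pair]
    omega
  · simp

/-- The power is exponentially large in unary, so the time is measured in the argument together with
the value. -/
theorem ptIn_pow : PTIn (fun p : ℕ × ℕ => sz p + p.1 ^ p.2) fun p => p.1 ^ p.2 := by
  obtain ⟨q, -, hq⟩ := show PT fun p : ℕ × Unit × ℕ => p.1 * p.2.2 by fun_prop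
  obtain ⟨q', -, hq'⟩ := show PT fun p : ℕ × ℕ => ((p.1, 1), List.replicate p.2 ()) by fun_prop
  have hpow : ∀ b e : ℕ, (List.replicate e ()).foldr (fun _ s => b * s) 1 = b ^ e := by
    intro b e
    induction e with
    | zero => rfl
    | succ e ih => rw [List.replicate_succ, List.foldr_cons, ih, pow_succ, mul_comm]
  refine ⟨2 * X + 1 + q' + X * (q.comp (4 * X + 4) + 30) + 11, fun p => ?_, ?_⟩
  · simp only [eval_add, eval_mul, eval_X, eval_one, eval_ofNat, sz_nat]
    omega
  · have h1 := RunsIn.list_foldr (h := fun (b : ℕ) (_ : Unit) (s : ℕ) => b * s) hq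
    have h2 := h1.comp hq'
    simp only [hpow] at h2
    refine h2.mono fun p => ?_
    obtain ⟨b, e⟩ := p
    have h3 := foldTime_le (h := fun (_ : Unit) (s : ℕ) => b * s)
      (τ := fun u s => q.eval (sz (b, u, s))) (s := 1) (l := List.replicate e ())
      (c := q.eval (4 * (sz (b, e) + b ^ e) + 4)) (by
        intro u l' hl
        apply eval_le_eval
        obtain ⟨e', he', rfl⟩ : ∃ e' < e, l' = List.replicate e' () := by
          have h4 := List.eq_replicate_of_mem (a := ()) (l := l') fun c _ => rfl
          refine ⟨l'.length, ?_, h4⟩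
          have := hl.length_le
          simp only [List.length_cons, List.length_replicate] at this
          omega
        rw [hpow]
        -- The extra `1` is for `b = 0`, where `0 ^ 0 = 1` exceeds the final value.
        have h5 : b ^ e' ≤ b ^ e + 1 := by
          rcases Nat.eq_zero_or_pos b with rfl | hb
          · rcases Nat.eq_zero_or_pos e' with rfl | he
            · simp
            · simp [he.ne']
          · exact (Nat.pow_le_pow_right hb he'.le).trans (Nat.le_succ _)
        simp only [sz_pair, sz_nat, sz_unit]
        omega)
    have h4 := eval_le_eval q' (show sz (b, e) ≤ sz (b, e) + b ^ e by omega)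
    have h5 : e ≤ sz (b, e) + b ^ e := by simp only [sz_pair, sz_nat]; omega
    rw [List.length_replicate] at h3
    have h6 := Nat.mul_le_mul_right (q.eval (4 * (sz (b, e) + b ^ e) + 4) + 30) h5
    simp only [eval_add, eval_mul, eval_comp, eval_X, eval_one, eval_ofNat] at *
    omega

/-! ### Binary logarithms -/

/-- The state `(c, 2 ^ c)` after `m` steps of doubling until `n` is exceeded. -/
def logState (n m : ℕ) : ℕ × ℕ :=
  (List.replicate m ()).foldr (fun _ s => bif s.2.ble n then (s.1 + 1, s.2 + s.2) else s) (0, 1)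

theorem logState_succ (n m : ℕ) : logState n (m + 1) = bif (logState n m).2.ble n then
    ((logState n m).1 + 1, (logState n m).2 + (logState n m).2) else logState n m := by
  simp [logState, List.replicate_succ]

theorem logState_spec (n m : ℕ) : (logState n m).2 = 2 ^ (logState n m).1 ∧
    (logState n m).2 ≤ max 1 (2 * n) ∧ ((logState n m).1 = m ∨ n < (logState n m).2) ∧
    (logState n m).1 ≤ m := by
  induction m with
  | zero => simp [logState]
  | succ m ih =>
    obtain ⟨h1, h2, h3, h4⟩ := ih
    rw [logState_succ]
    cases hb : (logState n m).2.ble n with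
    | true =>
      have := Nat.le_of_ble_eq_true hb
      refine ⟨?_, ?_, .inl ?_, ?_⟩
      · simp only [cond_true]
        rw [pow_succ, ← h1]
        omega
      all_goals
        simp only [cond_true]
        omega
    | false =>
      have : ¬(logState n m).2 ≤ n := fun h => by rw [Nat.ble_eq_true_of_le h] at hb; cases hb
      simp only [cond_false]
      exact ⟨h1, h2, .inr (by omega), by omega⟩

/-- The number of binary digits. -/
def numDigits (n : ℕ) : ℕ := (logState n (n + 1)).1

theorem lt_two_pow_numDigits (n : ℕ) : n < 2 ^ numDigits n := by
  obtain ⟨h1, -, h3, -⟩ := logState_spec n (n + 1)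
  unfold numDigits
  rcases h3 with h3 | h3
  · rw [h3]
    exact (Nat.lt_succ_self n).trans Nat.lt_two_pow_self
  · omega

theorem two_pow_numDigits_le {n : ℕ} (hn : 0 < n) : 2 ^ numDigits n ≤ 2 * n := by
  obtain ⟨h1, h2, -⟩ := logState_spec n (n + 1)
  unfold numDigits
  omega

theorem numDigits_le (n : ℕ) : numDigits n ≤ n + 1 := (logState_spec n (n + 1)).2.2.2

@[fun_prop]
theorem PT.numDigits {f : α → ℕ} (hf : PT f) : PT fun x => numDigits (f x) := by
  have h : PT fun p : ℕ × ℕ => logState p.1 p.2 := by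
    refine PT.foldr (h := fun (p : ℕ × ℕ) (_ : Unit) (s : ℕ × ℕ) =>
      bif s.2.ble p.1 then (s.1 + 1, s.2 + s.2) else s) (by fun_prop) (by fun_prop) (by fun_prop)
      (3 * X + 5) fun p l => ?_
    have hl := List.eq_replicate_of_mem (a := ()) (l := l) fun c _ => rfl
    obtain ⟨-, h2, -, h4⟩ := logState_spec p.1 l.length
    have h5 := length_le_sz l
    rw [hl]
    change sz (logState p.1 l.length) ≤ _
    simp only [sz_prod, sz_nat, eval_add, eval_mul, eval_X, eval_ofNat] at *
    rw [← hl]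
    omega
  exact (h.comp (f := fun x => (f x, f x + 1)) (by fun_prop)).fst

/-- The list `[m - 1, …, 1, 0]`. -/
def descending (m : ℕ) : List ℕ := (List.replicate m ()).foldr (fun _ l => l.length :: l) []

theorem length_descending (m : ℕ) : (descending m).length = m := by
  induction m with
  | zero => rfl
  | succ m ih =>
    rw [descending, List.replicate_succ, List.foldr_cons, ← descending, List.length_cons, ih]

theorem descending_succ (m : ℕ) : descending (m + 1) = m :: descending m := by
  conv_lhs => rw [descending, List.replicate_succ, List.foldr_cons, ← descending, length_descending]

@[fun_prop]
theorem PT.descending {f : α → ℕ} (hf : PT f) : PT fun x => descending (f x) := by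
  refine PT.foldr (h := fun (_ : α) (_ : Unit) (l : List ℕ) => l.length :: l) (by fun_prop)
    (by fun_prop) (by fun_prop) (X * (2 * X + 2) + 1) fun a l => ?_
  have hl := List.eq_replicate_of_mem (a := ()) (l := l) fun c _ => rfl
  have h5 := length_le_sz l
  have h6 : sz (ConcSched.descending l.length) ≤ l.length * (2 * l.length + 2) + 1 := by
    have h7 : ∀ m, sz (ConcSched.descending m) ≤ m * (2 * m + 2) + 1 := by
      intro m
      induction m with
      | zero => simp [ConcSched.descending]
      | succ m ih =>
        rw [descending_succ, sz_cons, sz_nat]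
        nlinarith
    exact h7 _
  have h8 : l.foldr (fun (_ : Unit) (l : List ℕ) => l.length :: l) [] =
      ConcSched.descending l.length := by
    conv_lhs => rw [hl]
    rfl
  rw [h8]
  refine h6.trans ?_
  simp only [eval_add, eval_mul, eval_X, eval_one, eval_ofNat]
  gcongr <;> omega

/-! ### Programs for computable functions -/

/-- The expression with all function numbers increased by `1`. -/
def Code.shift : Code → Code
  | var i => var i
  | nil => nil
  | cons a b => cons a.shift b.shift
  | hd a => hd a.shift
  | tl a => tl a.shift
  | ite a b c => ite a.shift b.shift c.shift
  | bind a b => bind a.shift b.shift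
  | call f a => call (f + 1) a.shift

theorem Eval.shift {P : Program} {env : List Tree} {e : Code} {v : Tree} {t : ℕ} (b : Code)
    (h : Eval P env e v t) : Eval (b :: P.map Code.shift) env e.shift v t := by
  induction h with
  | var env i => exact .var env i
  | nil env => exact .nil env
  | cons _ _ h1 h2 => exact .cons h1 h2
  | hd _ h => exact .hd h
  | tl _ h => exact .tl h
  | ite_cons _ _ h1 h2 => exact .ite_cons h1 h2
  | ite_nil _ _ h1 h2 => exact .ite_nil h1 h2
  | bind _ _ h1 h2 => exact .bind h1 h2
  | call hb _ _ h1 h2 =>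
    refine .call ?_ h1 h2
    rw [List.getElem?_cons_succ, List.getElem?_map, hb, Option.map_some]

/-- The main function must have number `0`; it is put in front and all calls are renumbered. -/
theorem RunsIn.exists_program {f : α → β} {τ : α → ℕ} (h : RunsIn f τ) :
    ∃ P : Program, ∀ x, ∃ t ≤ τ x, P.Outputs (enc x) (enc (f x)) t := by
  obtain ⟨R, e, he⟩ := h []
  refine ⟨e.shift :: R.map Code.shift, fun x => ?_⟩
  obtain ⟨t, ht, h⟩ := he x
  exact ⟨t, ht, e.shift, rfl, h.shift _⟩

end ConcSched

namespace ConcSched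
open Polynomial
open Enc (enc)
variable {α β γ δ σ : Type} [Enc α] [Enc β] [Enc γ] [Enc δ] [Enc σ]

/-! ### The algorithm -/

/-- An instance as a list of jobs: processing time, weight, due date (sign and absolute value), and
the row of the adjacency matrix. -/
abbrev Jobs : Type := List (ℕ × ℕ × (Bool × ℕ) × List Bool × Unit)

namespace Jobs

/-- The processing time of a job. -/
def proc (J : Jobs) (v : ℕ) : ℕ := (J.getD v (0, 0, (false, 0), [], ())).1

/-- The weight of a job. -/
def weight (J : Jobs) (v : ℕ) : ℕ := (J.getD v (0, 0, (false, 0), [], ())).2.1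

/-- The due date of a job. -/
def due (J : Jobs) (v : ℕ) : Bool × ℕ := (J.getD v (0, 0, (false, 0), [], ())).2.2.1

/-- The adjacency matrix of the conflict graph. -/
def rows (J : Jobs) : List (List Bool) := J.map fun j => j.2.2.2.1

/-- The maximum processing time. -/
def maxProc (J : Jobs) : ℕ := J.foldr (fun j m => max j.1 m) 0

/-- A bound for the completion times if the treewidth is at most `k`. -/
def horizon (J : Jobs) (k : ℕ) : ℕ :=
  12 * (3 * k + 6) * J.maxProc * numDigits J.length + J.maxProc

/-- A bound for the number of labelings of a bag if the treewidth is at most `k`. -/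
def capacity (J : Jobs) (k : ℕ) : ℕ := (J.horizon k + 4) ^ (3 * k + 7)

end Jobs

@[fun_prop]
theorem PT.proc {J : α → Jobs} {v : α → ℕ} (hJ : PT J) (hv : PT v) :
    PT fun x => (J x).proc (v x) := by
  unfold Jobs.proc
  fun_prop

@[fun_prop]
theorem PT.weight {J : α → Jobs} {v : α → ℕ} (hJ : PT J) (hv : PT v) :
    PT fun x => (J x).weight (v x) := by
  unfold Jobs.weight
  fun_prop

@[fun_prop]
theorem PT.due {J : α → Jobs} {v : α → ℕ} (hJ : PT J) (hv : PT v) :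
    PT fun x => (J x).due (v x) := by
  unfold Jobs.due
  fun_prop

@[fun_prop]
theorem PT.rows {J : α → Jobs} (hJ : PT J) : PT fun x => (J x).rows := by
  unfold Jobs.rows
  fun_prop

@[fun_prop]
theorem PT.maxProc {J : α → Jobs} (hJ : PT J) : PT fun x => (J x).maxProc :=
  PT.foldr_of_add (h := fun (_ : α) (j : ℕ × ℕ × (Bool × ℕ) × List Bool × Unit) (m : ℕ) =>
    Max.max j.1 m)
    (by fun_prop) hJ (by fun_prop) X fun a b s => by
      simp only [eval_X, sz_prod, sz_nat]
      omega

@[fun_prop]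
theorem PT.horizon {J : α → Jobs} {k : α → ℕ} (hJ : PT J) (hk : PT k) :
    PT fun x => (J x).horizon (k x) := by
  unfold Jobs.horizon
  fun_prop

variable {M : Type} [AddCommMonoid M] [LinearOrder M] [Enc M]

/-- The problem to find completion times with minimum total cost.  The context consists of the
jobs, a bound for the completion times, and a bound for the number of labelings of a bag. -/
def schedProblem {M : Type} (cost : Jobs × ℕ × ℕ → M) : Problem (Jobs × ℕ × ℕ) M where
  ok x := bif x.2.1.1 == x.2.2.1 then (x.1.1.proc x.2.1.1).ble x.2.1.2 else
    !(adjB x.1.1.rows x.2.1.1 x.2.2.1) || ((x.2.1.2 + x.1.1.proc x.2.2.1).ble x.2.2.2 ||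
      (x.2.2.2 + x.1.1.proc x.2.1.1).ble x.2.1.2)
  cost x := cost (x.1.1, x.2)
  lab a := List.range (a.2.1 + 1)
  cap a := a.2.2

omit [AddCommMonoid M] [LinearOrder M] in
theorem isPT_schedProblem {cost : Jobs × ℕ × ℕ → M} (hc : PT cost) :
    (schedProblem cost).IsPT where
  ok := by
    unfold schedProblem
    fun_prop
  cost := hc.comp (f := fun x : (Jobs × ℕ × ℕ) × ℕ × ℕ => (x.1.1, x.2)) (by fun_prop)
  lab := by
    unfold schedProblem
    fun_prop
  cap := by
    unfold schedProblem
    fun_prop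

/-- An optimal assignment with bags of size `O(k)` and at most `N` labelings per bag. -/
def boundedAttempt (cost : Jobs × ℕ × ℕ → M) (x : (Jobs × ℕ) × ℕ) : Option (List (ℕ × ℕ)) :=
  (decompose ((x.1.1.rows, x.2), x.1.2) (List.range x.1.1.length)).2.bind fun t =>
    (schedProblem cost).solve (x.1.1, x.1.1.horizon x.1.2, x.2) t

/-- An optimal assignment if the treewidth is at most `k`. -/
def attempt (cost : Jobs × ℕ × ℕ → M) (x : Jobs × ℕ) : Option (List (ℕ × ℕ)) :=
  boundedAttempt cost (x, x.1.capacity x.2)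

/-- The first success among the attempts with `k = 0, …, m - 1`. -/
def firstSuccess (cost : Jobs × ℕ × ℕ → M) (J : Jobs) (m : ℕ) : Option (List (ℕ × ℕ)) :=
  (descending m).foldr (fun k r => r.elim (attempt cost (J, k)) some) none

/-- The completion times of an optimal schedule. -/
def completionTimes (cost : Jobs × ℕ × ℕ → M) (J : Jobs) : List ℕ :=
  (List.range J.length).map fun v => lbl ((firstSuccess cost J (J.length + 1)).getD []) v

theorem pt_boundedAttempt [CostMonoid M] {cost : Jobs × ℕ × ℕ → M} (hc : PT cost) :
    PT (boundedAttempt cost) := by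
  have h := (isPT_schedProblem hc).solve
    (a := fun p : ((Jobs × ℕ) × ℕ) × Dec => (p.1.1.1, p.1.1.1.horizon p.1.1.2, p.1.2))
    (t := fun p => p.2) (by fun_prop) (by fun_prop)
  exact PT.option_bind (o := fun x : (Jobs × ℕ) × ℕ =>
    (decompose ((x.1.1.rows, x.2), x.1.2) (List.range x.1.1.length)).2)
    (g := fun x t => (schedProblem cost).solve (x.1.1, x.1.1.horizon x.1.2, x.2) t) (by fun_prop) h

/-- The time for one attempt is polynomial in this number. -/
def attemptSize (x : Jobs × ℕ) : ℕ := sz x + x.1.capacity x.2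

theorem ptIn_capacity : PTIn attemptSize fun x : Jobs × ℕ => x.1.capacity x.2 := by
  obtain ⟨q, h1, h2⟩ := show PT fun x : Jobs × ℕ => (x.1.horizon x.2 + 4, 3 * x.2 + 7) by fun_prop
  refine PTIn.comp (f := fun x : Jobs × ℕ => (x.1.horizon x.2 + 4, 3 * x.2 + 7)) ptIn_pow
    (PT.ptIn ⟨q, h1, h2⟩ fun x => Nat.le_add_right _ _) (q + X) fun x => ?_
  rw [eval_add, eval_X]
  exact add_le_add ((h1 x).trans (eval_le_eval q (Nat.le_add_right _ _))) (Nat.le_add_left _ _)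

/-- All exponential behaviour sits in the capacity. Once it has been computed and passed on in
unary, the rest of the attempt runs in time polynomial in its input. -/
theorem ptIn_attempt [CostMonoid M] {cost : Jobs × ℕ × ℕ → M} (hc : PT cost) :
    PTIn attemptSize (attempt cost) :=
  (pt_boundedAttempt hc).comp_ptIn
    ((PT.id.ptIn fun _ => Nat.le_add_right _ _).pair ptIn_capacity)

theorem Jobs.capacity_mono (J : Jobs) {k k' : ℕ} (h : k ≤ k') : J.capacity k ≤ J.capacity k' := by
  unfold capacity horizon
  have h1 : 12 * (3 * k + 6) * J.maxProc * numDigits J.length + J.maxProc + 4 ≤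
      12 * (3 * k' + 6) * J.maxProc * numDigits J.length + J.maxProc + 4 := by gcongr
  exact (Nat.pow_le_pow_left h1 _).trans (Nat.pow_le_pow_right (by omega) (by omega))

theorem attemptSize_mono (J : Jobs) {k k' : ℕ} (h : k ≤ k') :
    attemptSize (J, k) ≤ attemptSize (J, k') := by
  have := J.capacity_mono h
  simp only [attemptSize, sz_pair, sz_nat]
  omega

-- The fold starts at the right end of the descending list, so `k = 0` is tried first.
omit [Enc M] in
theorem firstSuccess_succ (cost : Jobs × ℕ × ℕ → M) (J : Jobs) (m : ℕ) :
    firstSuccess cost J (m + 1) =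
      (firstSuccess cost J m).elim (attempt cost (J, m)) some := by
  rw [firstSuccess, descending_succ, List.foldr_cons, ← firstSuccess]

omit [Enc M] in
theorem firstSuccess_spec {cost : Jobs × ℕ × ℕ → M} {J : Jobs} {k : ℕ}
    (hk : attempt cost (J, k) ≠ none) (m : ℕ) : (firstSuccess cost J m = none → m ≤ k) ∧
      ∀ s, firstSuccess cost J m = some s → ∃ k' ≤ k, attempt cost (J, k') = some s := by
  induction m with
  | zero => exact ⟨fun _ => Nat.zero_le _, fun s hs => by cases hs⟩
  | succ m ih =>
    rw [firstSuccess_succ]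
    cases h : firstSuccess cost J m with
    | none =>
      have hm := ih.1 h
      refine ⟨fun h => ?_, fun s hs => ⟨m, hm, hs⟩⟩
      rcases hm.lt_or_eq with hm | rfl
      exacts [hm, absurd h hk]
    | some s => exact ⟨fun h => (by cases h), fun s' hs => ih.2 s' (by rw [h]; exact hs)⟩

/-- The time of the algorithm is polynomial in the time of any successful attempt. -/
theorem exists_runsIn_completionTimes [CostMonoid M] {cost : Jobs × ℕ × ℕ → M} (hc : PT cost) :
    ∃ (τ : Jobs → ℕ) (q : ℕ[X]), RunsIn (completionTimes cost) τ ∧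
      ∀ J k, k ≤ J.length → attempt cost (J, k) ≠ none → τ J ≤ q.eval (sz J + J.capacity k) := by
  obtain ⟨qa, ha, hra⟩ := ptIn_attempt hc
  -- Only one branch is evaluated, so a step after the first success takes constant time. Polynomial
  -- bounds for the whole step would hide this, hence the explicit running time.
  have hst : RunsIn (fun p : Jobs × ℕ × Option (List (ℕ × ℕ)) =>
      p.2.2.elim (attempt cost (p.1, p.2.1)) some)
      (fun p => 3 + (p.2.2.elim (7 + qa.eval (attemptSize (p.1, p.2.1))) fun _ => 3) + 1) := by
    have h1 : RunsIn (fun p : Jobs × ℕ × Option (List (ℕ × ℕ)) => p.2.2) fun _ => 3 :=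
      .of_code (.tl (.tl (.var 0))) fun P x => ⟨3, le_rfl, .tl (.tl (.var _ _))⟩
    have h2 : RunsIn (fun p : Jobs × ℕ × Option (List (ℕ × ℕ)) => (p.1, p.2.1)) fun _ => 6 :=
      .of_code (.cons (.hd (.var 0)) (.hd (.tl (.var 0)))) fun P x =>
        ⟨6, le_rfl, .cons (.hd (.var _ _)) (.hd (.tl (.var _ _)))⟩
    refine h1.branch h1 (hra.comp h2) fun ⟨J, k, r⟩ => ?_
    cases r with
    | none => exact .inr ⟨rfl, rfl, by simp⟩
    | some s => exact .inl ⟨by simp [enc], rfl, le_rfl⟩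
  obtain ⟨qi, hqi, hri⟩ := show PT fun J : Jobs =>
    ((J, (none : Option (List (ℕ × ℕ)))), descending (J.length + 1)) by fun_prop
  obtain ⟨qo, hqo, hro⟩ := show PT fun p : Jobs × Option (List (ℕ × ℕ)) =>
    (List.range p.1.length).map fun v => lbl (p.2.getD []) v by fun_prop
  obtain ⟨qd, -, hrd⟩ := PT.id (α := Jobs)
  have hst' := hst.list_foldr (h := fun (J : Jobs) (k : ℕ) (r : Option (List (ℕ × ℕ))) =>
    r.elim (attempt cost (J, k)) some)
  have hmain := hro.comp (hrd.pair (hst'.comp hri))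
  refine ⟨_, qd + qi + ((X + 1) * (41 + qa.comp (3 * X + 2)) + 10) +
    qo.comp (X + qa.comp (3 * X + 2) + 2) + 3, hmain, fun J k hk hka => ?_⟩
  -- By `firstSuccess_spec`, an attempt is run only for parameters up to `k`, and by monotonicity
  -- none of them takes longer than the bound for `k`.
  have key : ∀ m, foldTime (fun k r => r.elim (attempt cost (J, k)) some)
      (fun k r => 3 + (r.elim (7 + qa.eval (attemptSize (J, k))) fun _ => 3) + 1) none
      (descending m) ≤ m * (41 + qa.eval (attemptSize (J, k))) + 10 := by
    intro m
    induction m with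
    | zero => simp [descending, foldTime]
    | succ m ih =>
      rw [descending_succ, foldTime, ← firstSuccess, add_mul, one_mul]
      have h1 := (firstSuccess_spec hka m).1
      cases h : firstSuccess cost J m with
      | none =>
        have := eval_le_eval qa (attemptSize_mono J (h1 h))
        simp only [Option.elim_none]
        omega
      | some s =>
        simp only [Option.elim_some]
        omega
  have h1 := key (J.length + 1)
  have h2 : sz (firstSuccess cost J (J.length + 1)) ≤ qa.eval (attemptSize (J, k)) + 1 := by
    cases h : firstSuccess cost J (J.length + 1) with
    | none => simp
    | some s =>
      obtain ⟨k', hk', hs⟩ := (firstSuccess_spec hka _).2 s h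
      rw [← hs]
      exact (ha _).trans ((eval_le_eval qa (attemptSize_mono J hk')).trans (Nat.le_succ _))
  have h3 := length_le_sz J
  have h4 : attemptSize (J, k) ≤ 3 * (sz J + J.capacity k) + 2 := by
    simp only [attemptSize, sz_pair, sz_nat]
    omega
  have h5 := eval_le_eval qa h4
  have h6 : (J.length + 1) * (41 + qa.eval (attemptSize (J, k))) ≤ (sz J + J.capacity k + 1) *
      (41 + qa.eval (3 * (sz J + J.capacity k) + 2)) := by
    gcongr
    omega
  have h7 := eval_le_eval qo (show sz (J, firstSuccess cost J (J.length + 1)) ≤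
    sz J + J.capacity k + qa.eval (3 * (sz J + J.capacity k) + 2) + 2 by
      rw [sz_pair]
      omega)
  have h8 := eval_le_eval qd (Nat.le_add_right (sz J) (J.capacity k))
  have h9 := eval_le_eval qi (Nat.le_add_right (sz J) (J.capacity k))
  simp only [eval_add, eval_mul, eval_comp, eval_X, eval_one, eval_ofNat]
  rw [firstSuccess] at h7
  omega

end ConcSched

namespace ConcSched
open Polynomial
open Enc (enc)

/-! ### Correctness of the algorithm -/

open Classical in
/-- The list of jobs of an instance. -/
noncomputable def Instance.toJobs (I : Instance) : Jobs :=
  List.ofFn fun j : Fin I.n => (I.p j, I.w j, (decide (I.d j < 0), (I.d j).natAbs),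
    List.ofFn fun i : Fin I.n => decide (I.graph.Adj j i), ())

/-- The trailing unit in `Jobs` is the `nil` that ends the list of four entries. So nested pairs and
list are the same tree, and the input needs no conversion. -/
theorem Instance.enc_toJobs (I : Instance) : enc I.toJobs = I.encode := by
  simp only [toJobs, encode, enc, List.map_ofFn, Function.comp_def, encodeList, encodeInt,
    List.foldr_cons, List.foldr_nil]

theorem Instance.length_toJobs (I : Instance) : I.toJobs.length = I.n := by
  simp [toJobs]

theorem Instance.getD_toJobs (I : Instance) (j : Fin I.n)
    (d : ℕ × ℕ × (Bool × ℕ) × List Bool × Unit) : I.toJobs.getD j d = I.toJobs.get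
      ⟨j, by rw [length_toJobs]; exact j.2⟩ := by
  simp [List.getD_eq_getElem?_getD, length_toJobs]

theorem Instance.proc_toJobs (I : Instance) (j : Fin I.n) : I.toJobs.proc j = I.p j := by
  rw [Jobs.proc, getD_toJobs]
  simp [toJobs]

theorem Instance.weight_toJobs (I : Instance) (j : Fin I.n) : I.toJobs.weight j = I.w j := by
  rw [Jobs.weight, getD_toJobs]
  simp [toJobs]

theorem Instance.due_toJobs (I : Instance) (j : Fin I.n) :
    I.toJobs.due j = (decide (I.d j < 0), (I.d j).natAbs) := by
  rw [Jobs.due, getD_toJobs]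
  simp [toJobs]

theorem Instance.adjP_toJobs (I : Instance) (i j : Fin I.n) :
    adjP I.toJobs.rows i j ↔ I.graph.Adj i j := by
  simp [adjP, adjB, Jobs.rows, toJobs, List.getD_eq_getElem?_getD]

theorem Instance.proc_le_maxProc (I : Instance) (j : Fin I.n) : I.p j ≤ I.toJobs.maxProc := by
  have h : ∀ (J : Jobs), ∀ x ∈ J, x.1 ≤ J.maxProc := by
    intro J
    induction J with
    | nil => intro x hx; cases hx
    | cons y J ih =>
      intro x hx
      rw [Jobs.maxProc, List.foldr_cons, ← Jobs.maxProc]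
      rcases List.mem_cons.1 hx with rfl | hx
      exacts [le_max_left _ _, (ih x hx).trans (le_max_right _ _)]
  exact h I.toJobs (I.p j, _, _, _, ()) (List.mem_ofFn.2 ⟨j, rfl⟩)

theorem Jobs.maxProc_le {J : Jobs} {p : ℕ} (h : ∀ x ∈ J, x.1 ≤ p) : J.maxProc ≤ p := by
  induction J with
  | nil => exact Nat.zero_le _
  | cons y J ih =>
    rw [maxProc, List.foldr_cons, ← maxProc]
    exact max_le (h y List.mem_cons_self) (ih fun x hx => h x (List.mem_cons_of_mem _ hx))

theorem Instance.maxProc_toJobs_le {I : Instance} {p : ℕ} (h : ∀ j, I.p j ≤ p) :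
    I.toJobs.maxProc ≤ p := Jobs.maxProc_le fun x hx => by
  obtain ⟨j, rfl⟩ := List.mem_ofFn.1 hx
  exact h j

/-- Processing the jobs one after the other is feasible. -/
theorem Instance.exists_feasible (I : Instance) : ∃ C : I.Schedule, I.Feasible C := by
  have key : ∀ i j, i < j → ∑ k ∈ Finset.Iic i, I.p k + I.p j ≤ ∑ k ∈ Finset.Iic j, I.p k := by
    intro i j hij
    rw [add_comm, ← Finset.sum_insert (by simpa using hij)]
    refine Finset.sum_le_sum_of_subset fun k hk => ?_
    rw [Finset.mem_insert, Finset.mem_Iic] at hk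
    rw [Finset.mem_Iic]
    rcases hk with rfl | hk
    exacts [le_rfl, hk.trans hij.le]
  refine ⟨fun j => ∑ i ∈ Finset.Iic j, I.p i, feasible_iff.2 ⟨fun j => ?_, fun i j hij => ?_⟩⟩
  · exact Finset.single_le_sum (f := I.p) (fun _ _ => Nat.zero_le _) (Finset.mem_Iic.2 le_rfl)
  · rcases lt_or_gt_of_ne hij.ne with h | h
    exacts [.inl (key i j h), .inr (key j i h)]

/-- The pairs with `u = v` carry the condition that no job starts before time `0`. -/
theorem ok_schedProblem {M : Type} {cost : Jobs × ℕ × ℕ → M} {J : Jobs} {T N u x v y : ℕ} :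
    (schedProblem cost).ok ((J, T, N), (u, x), (v, y)) = true ↔ (u = v → J.proc u ≤ x) ∧
      (u ≠ v → adjP J.rows u v → x + J.proc v ≤ y ∨ y + J.proc u ≤ x) := by
  by_cases h : u = v
  · simp [schedProblem, h]
  · have h' : (u == v) = false := by simpa using h
    simp only [schedProblem, h', cond_false, Bool.or_eq_true, Bool.not_eq_true', Nat.ble_eq, adjP,
      h, false_implies, ne_eq, not_false_eq_true, true_implies, true_and]
    cases adjB J.rows u v <;> simp

variable {M : Type} [AddCommMonoid M] [LinearOrder M] [IsOrderedAddMonoid M]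
  {cost : Jobs × ℕ × ℕ → M} {I : Instance} {k : ℕ}

theorem ok_of_not_adj {M : Type} {cost : Jobs × ℕ × ℕ → M} {a : Jobs × ℕ × ℕ} (e e' : ℕ × ℕ)
    (h : e.1 ≠ e'.1) (h' : ¬adjP a.1.rows e.1 e'.1) : (schedProblem cost).ok (a, e, e') = true :=
  ok_schedProblem.2 ⟨fun h'' => absurd h'' h, fun _ h'' => absurd h'' h'⟩

omit [LinearOrder M] [IsOrderedAddMonoid M] in
theorem IsDecomposition.sum_verts {t : Dec} {rows : List (List Bool)} {n : ℕ}
    (ht : IsDecomposition rows k (List.range n) t) (f : ℕ → M) :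
    ∑ v ∈ t.verts, f v = ∑ j : Fin n, f j := by
  rw [← Finset.sum_range]
  refine Finset.sum_congr ?_ fun _ _ => rfl
  ext v
  rw [ht.verts, List.mem_range, Finset.mem_range]

/-- The horizon is computed from the bag size `3k + 6` of the decomposition that was found, not from
the treewidth. So the short schedule below `C` is among the labelings considered, and the table
competes with every feasible schedule, for any `k`. -/
theorem exists_solve_of_feasible (hmono : ∀ J v x y, x ≤ y → cost (J, v, x) ≤ cost (J, v, y))
    {t : Dec} (ht : IsDecomposition I.toJobs.rows k (List.range I.n) t) {C : I.Schedule}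
    (hC : I.Feasible C) :
    ∃ s, (schedProblem cost).solve (I.toJobs, I.toJobs.horizon k, I.toJobs.capacity k) t = some s ∧
      (schedProblem cost).total (I.toJobs, I.toJobs.horizon k, I.toJobs.capacity k) s ≤
        ∑ j : Fin I.n, cost (I.toJobs, j, C j) := by
  have hv : ∀ v, v ∈ t.verts ↔ v < I.n := fun v => by rw [ht.verts, List.mem_range]
  obtain ⟨C', h1, h2, h3⟩ := I.exists_short hC I.proc_le_maxProc ht.valid ht.length (by omega)
    (fun u v huv => ht.covers u ((hv u).2 u.2) v ((hv v).2 v.2) ((I.adjP_toJobs u v).2 huv))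
    (L := numDigits I.n) (lt_two_pow_numDigits I.n)
  obtain ⟨f1, f2⟩ := I.feasible_iff.1 h1
  set φ : ℕ → ℕ := fun v => if h : v < I.n then C' ⟨v, h⟩ else 0 with hφ
  have hφj : ∀ j : Fin I.n, φ j = C' j := fun j => dif_pos j.2
  obtain ⟨s, hs, hle⟩ := Problem.exists_solve (p := schedProblem cost)
    (a := (I.toJobs, I.toJobs.horizon k, I.toJobs.capacity k)) (ok_of_not_adj) ht.valid ht.covers
    (by simp [schedProblem]) (fun b hb => by
      simp only [schedProblem, List.length_range, Jobs.capacity]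
      have := ht.length b hb
      exact (Nat.pow_le_pow_left (by omega) _).trans (Nat.pow_le_pow_right (by omega) (by omega)))
    (φ := φ) (fun v hv' => by
      have := h3 ⟨v, (hv v).1 hv'⟩
      rw [← hφj] at this
      simp only [schedProblem, List.mem_range, Jobs.horizon, I.length_toJobs]
      exact Nat.lt_succ_of_le this) (fun u hu v hv' => by
      obtain ⟨u, rfl⟩ : ∃ j : Fin I.n, (j : ℕ) = u := ⟨⟨u, (hv u).1 hu⟩, rfl⟩
      obtain ⟨v, rfl⟩ : ∃ j : Fin I.n, (j : ℕ) = v := ⟨⟨v, (hv v).1 hv'⟩, rfl⟩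
      rw [ok_schedProblem, hφj, hφj, I.proc_toJobs, I.proc_toJobs, I.adjP_toJobs]
      exact ⟨fun _ => f1 u, fun _ => f2 u v⟩)
  refine ⟨s, hs, hle.trans ?_⟩
  rw [ht.sum_verts]
  refine Finset.sum_le_sum fun j _ => ?_
  rw [hφj]
  exact hmono _ _ _ _ (h2 j)

omit [IsOrderedAddMonoid M] in
theorem feasible_of_solve {t : Dec}
    (ht : IsDecomposition I.toJobs.rows k (List.range I.n) t) {T N : ℕ} {s : List (ℕ × ℕ)}
    (hs : (schedProblem cost).solve (I.toJobs, T, N) t = some s) :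
    I.Feasible (fun j => lbl s j) ∧ (schedProblem cost).total (I.toJobs, T, N) s =
      ∑ j : Fin I.n, cost (I.toJobs, j, lbl s j) := by
  have h := Problem.isSol_of_solve ok_of_not_adj ht.valid ht.covers hs
  refine ⟨?_, ?_⟩
  · have hmem : ∀ j : Fin I.n, ((j : ℕ), lbl s j) ∈ s := by
      intro j
      obtain ⟨e, he, hej⟩ := List.mem_map.1 ((h.mem j).2 ((ht.verts j).2 (List.mem_range.2 j.2)))
      rw [← hej, lbl_eq h.nodup he]
      exact he
    refine I.feasible_iff.2 ⟨fun j => ?_, fun i j hij => ?_⟩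
    · have := (ok_schedProblem.1 (h.ok _ (hmem j) _ (hmem j))).1 rfl
      rwa [I.proc_toJobs] at this
    · have := (ok_schedProblem.1 (h.ok _ (hmem i) _ (hmem j))).2
        (fun h => hij.ne (Fin.ext h)) ((I.adjP_toJobs i j).2 hij)
      rwa [I.proc_toJobs, I.proc_toJobs] at this
  · rw [h.total_eq (φ := fun v => lbl s v) fun e he => (lbl_eq h.nodup he).symm, ht.sum_verts]
    rfl

/-- A success is optimal even if `k` is smaller than the treewidth, because both the decomposition
and the horizon are justified by the success itself. -/
theorem attempt_eq_some (hmono : ∀ J v x y, x ≤ y → cost (J, v, x) ≤ cost (J, v, y))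
    {s : List (ℕ × ℕ)} (hs : attempt cost (I.toJobs, k) = some s) :
    I.Feasible (fun j => lbl s j) ∧ ∀ C : I.Schedule, I.Feasible C →
      ∑ j : Fin I.n, cost (I.toJobs, j, lbl s j) ≤ ∑ j : Fin I.n, cost (I.toJobs, j, C j) := by
  obtain ⟨t, ht, hs⟩ := Option.bind_eq_some_iff.1 hs
  have ht := isDecomposition_decompose List.nodup_range ht
  simp only [I.length_toJobs] at ht
  obtain ⟨h1, h2⟩ := feasible_of_solve ht hs
  refine ⟨h1, fun C hC => ?_⟩
  obtain ⟨s', hs', hle⟩ := exists_solve_of_feasible hmono ht hC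
  obtain rfl : s = s' := Option.some.inj (hs.symm.trans hs')
  rwa [h2] at hle

theorem attempt_ne_none (hmono : ∀ J v x y, x ≤ y → cost (J, v, x) ≤ cost (J, v, y))
    (hk : treewidth I.graph ≤ k) : attempt cost (I.toJobs, k) ≠ none := by
  obtain ⟨t, h1, h2, h3, h4⟩ := exists_dec_of_treewidth I.graph
  -- The summand `4` in the base of the capacity is for the four labels of the separator search; the
  -- schedules need only `horizon + 1`.
  obtain ⟨t', ht'⟩ := exists_decompose (c := ((I.toJobs.rows, I.toJobs.capacity k), k))
    (List.nodup_range (n := I.toJobs.length))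
    (Nat.pow_le_pow_left (by omega) _) h1 (fun u hu v hv huv => by
      obtain ⟨u, rfl⟩ : ∃ j : Fin I.n, (j : ℕ) = u := ⟨⟨u, (h2 u).1 hu⟩, rfl⟩
      obtain ⟨v, rfl⟩ : ∃ j : Fin I.n, (j : ℕ) = v := ⟨⟨v, (h2 v).1 hv⟩, rfl⟩
      exact h4 u v ((I.adjP_toJobs u v).1 huv)) (fun B hB => (h3 B hB).trans (by dsimp only; omega))
    (fun v hv => by rwa [h2, ← I.length_toJobs, ← List.mem_range])
  have ht := isDecomposition_decompose List.nodup_range ht'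
  simp only [I.length_toJobs] at ht
  obtain ⟨C, hC⟩ := I.exists_feasible
  obtain ⟨s, hs, -⟩ := exists_solve_of_feasible hmono ht hC
  rw [attempt, boundedAttempt, ht', Option.bind_some, hs]
  exact Option.some_ne_none s

/-- The algorithm finds a feasible schedule of minimum total cost. -/
theorem completionTimes_spec (hmono : ∀ J v x y, x ≤ y → cost (J, v, x) ≤ cost (J, v, y))
    (I : Instance) : ∃ C : I.Schedule, completionTimes cost I.toJobs = List.ofFn C ∧
      I.Feasible C ∧ ∀ C' : I.Schedule, I.Feasible C' →
        ∑ j : Fin I.n, cost (I.toJobs, j, C j) ≤ ∑ j : Fin I.n, cost (I.toJobs, j, C' j) := by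
  have hk := attempt_ne_none hmono (le_refl (treewidth I.graph))
  have hn := (treewidth_spec I.graph).1
  obtain ⟨h1, h2⟩ := firstSuccess_spec hk (I.toJobs.length + 1)
  cases h : firstSuccess cost I.toJobs (I.toJobs.length + 1) with
  | none =>
    have := h1 h
    rw [I.length_toJobs] at this
    omega
  | some s =>
    obtain ⟨k', -, hs⟩ := h2 s h
    refine ⟨fun j => lbl s j, ?_, attempt_eq_some hmono hs⟩
    rw [completionTimes, h, I.length_toJobs, Option.getD_some, List.ofFn_eq_map,
      ← List.map_coe_finRange_eq_range, List.map_map]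
    rfl

end ConcSched

namespace ConcSched
open Polynomial
open Enc (enc)

/-! ### The objective functions -/

/-- The weighted tardiness of a job with a given completion time. -/
def tardCost (x : Jobs × ℕ × ℕ) : ℕ := x.1.weight x.2.1 *
  bif (x.1.due x.2.1).1 then x.2.2 + (x.1.due x.2.1).2 else x.2.2 - (x.1.due x.2.1).2

theorem pt_tardCost : PT tardCost := by
  unfold tardCost
  fun_prop

theorem tardCost_mono (J : Jobs) (v x y : ℕ) (h : x ≤ y) :
    tardCost (J, v, x) ≤ tardCost (J, v, y) := by
  simp only [tardCost]
  refine Nat.mul_le_mul le_rfl ?_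
  cases (J.due v).1
  · exact Nat.sub_le_sub_right h _
  · exact Nat.add_le_add_right h _

/-- For a negative due date the lateness is positive and the maximum with `0` is irrelevant;
otherwise truncated subtraction is that maximum. -/
theorem cast_tardCost (I : Instance) (C : I.Schedule) (j : Fin I.n) :
    (tardCost (I.toJobs, j, C j) : ℤ) = I.w j * I.tardiness C j := by
  simp only [tardCost, I.weight_toJobs, I.due_toJobs, Instance.tardiness]
  rw [Nat.cast_mul]
  congr 1
  by_cases h : I.d j < 0
  · simp only [h, decide_true, cond_true]
    omega
  · simp only [h, decide_false, cond_false]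
    omega

theorem sum_tardCost (I : Instance) (C : I.Schedule) :
    ((∑ j : Fin I.n, tardCost (I.toJobs, j, C j) : ℕ) : ℤ) = I.totalWeightedTardiness C := by
  rw [Nat.cast_sum, Instance.totalWeightedTardiness]
  exact Finset.sum_congr rfl fun j _ => cast_tardCost I C j

/-- The natural numbers with the maximum as addition. -/
def MaxNat : Type := ℕ

namespace MaxNat

instance : LinearOrder MaxNat := inferInstanceAs (LinearOrder ℕ)

instance : Enc MaxNat := inferInstanceAs (Enc ℕ)

instance : Zero MaxNat := inferInstanceAs (Zero ℕ)

instance : Add MaxNat := ⟨max⟩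

instance : AddCommMonoid MaxNat where
  add_assoc a b c := max_assoc a b c
  zero_add a := Nat.zero_max (a : ℕ)
  add_zero a := Nat.max_zero (a : ℕ)
  add_comm a b := max_comm a b
  nsmul := nsmulRec

theorem add_def (a b : MaxNat) : a + b = max a b := rfl

instance : CostMonoid MaxNat where
  add_le_add_left a b h c := max_le_max h le_rfl
  pt_add := show PT fun p : ℕ × ℕ => max p.1 p.2 by fun_prop
  pt_le := CostMonoid.pt_le (M := ℕ)
  sz_add_le a b := by
    have h : ∀ a b : ℕ, sz (max a b) ≤ sz a + sz b := fun a b => by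
      simp only [sz_nat]
      omega
    exact h a b

/-- Sums in `MaxNat` are maxima, the empty one being `0`. That `0` is neutral is the reason why the
latenesses are made nonnegative by an offset. -/
theorem sum_le_iff {ι : Type} (s : Finset ι) (f : ι → MaxNat) (a : MaxNat) :
    ∑ i ∈ s, f i ≤ a ↔ ∀ i ∈ s, f i ≤ a := by
  classical
  induction s using Finset.induction_on with
  | empty => exact iff_of_true (Nat.zero_le (a : ℕ)) (by simp)
  | insert i s hi ih =>
    rw [Finset.sum_insert hi, add_def, max_le_iff, ih]
    simp

end MaxNat

/-- A number that makes the weighted latenesses nonnegative. -/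
def Jobs.offset (J : Jobs) : ℕ := J.foldr (fun j z => j.2.1 * j.2.2.1.2 + z) 0

/-- The weighted lateness of a job with a given completion time, plus the offset. -/
def lateCost (x : Jobs × ℕ × ℕ) : ℕ := bif (x.1.due x.2.1).1 then
  x.1.weight x.2.1 * (x.2.2 + (x.1.due x.2.1).2) + x.1.offset else
  x.1.weight x.2.1 * x.2.2 + x.1.offset - x.1.weight x.2.1 * (x.1.due x.2.1).2

theorem pt_offset : PT Jobs.offset :=
  PT.foldr_of_add (h := fun (_ : Jobs) (j : ℕ × ℕ × (Bool × ℕ) × List Bool × Unit) (z : ℕ) =>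
    j.2.1 * j.2.2.1.2 + z) (by fun_prop) PT.id (by fun_prop) (2 * (X * X)) fun a b s => by
      simp only [eval_mul, eval_ofNat, eval_X, sz_nat]
      have h : b.2.1 * b.2.2.1.2 ≤ (sz a + sz b) * (sz a + sz b) := by
        simp only [sz_prod b, sz_prod b.2, sz_prod b.2.2, sz_prod b.2.2.1, sz_nat]
        gcongr <;> omega
      omega

theorem pt_lateCost : PT lateCost := by
  have h := pt_offset
  unfold lateCost
  have h' : PT fun x : Jobs × ℕ × ℕ => x.1.offset := h.comp (f := fun x : Jobs × ℕ × ℕ => x.1)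
    (by fun_prop)
  fun_prop

theorem lateCost_mono (J : Jobs) (v x y : ℕ) (h : x ≤ y) :
    lateCost (J, v, x) ≤ lateCost (J, v, y) := by
  simp only [lateCost]
  cases (J.due v).1
  · exact Nat.sub_le_sub_right (Nat.add_le_add_right (Nat.mul_le_mul le_rfl h) _) _
  · exact Nat.add_le_add_right (Nat.mul_le_mul le_rfl (Nat.add_le_add_right h _)) _

theorem Jobs.le_offset {J : Jobs} : ∀ x ∈ J, x.2.1 * x.2.2.1.2 ≤ J.offset := by
  induction J with
  | nil => intro x hx; cases hx
  | cons y J ih =>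
    intro x hx
    rw [offset, List.foldr_cons, ← offset]
    rcases List.mem_cons.1 hx with rfl | hx
    exacts [Nat.le_add_right _ _, (ih x hx).trans (Nat.le_add_left _ _)]

theorem cast_lateCost (I : Instance) (C : I.Schedule) (j : Fin I.n) :
    (lateCost (I.toJobs, j, C j) : ℤ) = I.w j * I.lateness C j + I.toJobs.offset := by
  have h : I.w j * (I.d j).natAbs ≤ I.toJobs.offset :=
    Jobs.le_offset (J := I.toJobs) (I.p j, I.w j, (_, (I.d j).natAbs), _, ())
      (List.mem_ofFn.2 ⟨j, rfl⟩)
  simp only [lateCost, I.weight_toJobs, I.due_toJobs, Instance.lateness]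
  by_cases hd : I.d j < 0
  · have h1 : ((I.d j).natAbs : ℤ) = -I.d j := by omega
    simp only [hd, decide_true, cond_true]
    push_cast
    rw [Int.abs_eq_natAbs, h1]
    ring
  · have h1 : ((I.d j).natAbs : ℤ) = I.d j := by omega
    simp only [hd, decide_false, cond_false]
    rw [Nat.cast_sub (h.trans (Nat.le_add_left _ _))]
    push_cast
    rw [Int.abs_eq_natAbs, h1]
    ring

/-- The costs of the jobs, to be combined by taking their maximum. -/
def maxLateCost : Jobs × ℕ × ℕ → MaxNat := lateCost

theorem pt_maxLateCost : PT maxLateCost := pt_lateCost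

theorem maxLateCost_mono (J : Jobs) (v x y : ℕ) (h : x ≤ y) :
    maxLateCost (J, v, x) ≤ maxLateCost (J, v, y) := lateCost_mono J v x y h

/-- The offset is the same for all jobs and cancels when each job under `C` is compared with a job
of maximum cost under `C'`. Without jobs there is nothing to compare. -/
theorem maxWeightedLateness_le {I : Instance} {C C' : I.Schedule}
    (h : ∑ j : Fin I.n, maxLateCost (I.toJobs, j, C j) ≤
      ∑ j : Fin I.n, maxLateCost (I.toJobs, j, C' j)) :
    I.maxWeightedLateness C ≤ I.maxWeightedLateness C' := by
  refine Finset.sup_le fun j hj => ?_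
  obtain ⟨i, -, hi⟩ := Finset.exists_max_image Finset.univ
    (fun i : Fin I.n => maxLateCost (I.toJobs, i, C' i)) ⟨j, hj⟩
  have h1 := (MaxNat.sum_le_iff _ _ _).1 (h.trans ((MaxNat.sum_le_iff _ _ _).2 hi)) j hj
  have h2 : (lateCost (I.toJobs, j, C j) : ℤ) ≤ lateCost (I.toJobs, i, C' i) := Int.ofNat_le.2 h1
  rw [cast_lateCost, cast_lateCost] at h2
  refine le_trans ?_ (Finset.le_sup (Finset.mem_univ i))
  exact WithBot.coe_le_coe.2 (by omega)

/-! ### The time bound -/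

theorem eval_le_mul_pow (q : ℕ[X]) {x : ℕ} (hx : 1 ≤ x) :
    q.eval x ≤ q.eval 1 * x ^ q.natDegree := by
  rw [eval_eq_sum_range, eval_eq_sum_range, Finset.sum_mul]
  refine Finset.sum_le_sum fun i hi => ?_
  rw [one_pow, mul_one]
  exact Nat.mul_le_mul le_rfl (Nat.pow_le_pow_right hx (Nat.lt_succ_iff.1 (Finset.mem_range.1 hi)))

theorem Jobs.horizon_zero_add_le (J : Jobs) : J.horizon 0 + 4 ≤ 256 * sz J ^ 2 := by
  have h1 : J.maxProc ≤ sz J := maxProc_le fun x hx => by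
    have := sz_le_of_mem hx
    rw [sz_prod, sz_nat] at this
    omega
  have h2 : numDigits J.length ≤ sz J + 1 :=
    (numDigits_le _).trans (Nat.add_le_add_right (length_le_sz J) 1)
  have h3 := sz_pos J
  have h4 : J.maxProc * numDigits J.length ≤ sz J * (sz J + 1) := Nat.mul_le_mul h1 h2
  unfold horizon
  nlinarith

theorem horizon_add_le {I : Instance} {p k : ℕ} (hp : ∀ j, I.p j ≤ p) (hk : 1 ≤ k) (hp1 : 1 ≤ p)
    (hn : 2 ≤ I.n) : ((I.toJobs.horizon k + 4 : ℕ) : ℝ) ≤ 256 * (k * p * Real.logb 2 I.n) := by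
  have hn' : (2 : ℝ) ≤ I.n := by exact_mod_cast hn
  have h1 : (1 : ℝ) ≤ Real.logb 2 I.n := by
    rw [Real.le_logb_iff_rpow_le (by norm_num) (by linarith), Real.rpow_one]
    exact hn'
  have h2 : (numDigits I.n : ℝ) ≤ Real.logb 2 I.n + 1 := by
    have h := two_pow_numDigits_le (n := I.n) (by omega)
    have h' : (2 : ℝ) ^ (numDigits I.n : ℝ) ≤ 2 * I.n := by
      rw [Real.rpow_natCast]
      exact_mod_cast h
    rw [← Real.le_logb_iff_rpow_le (by norm_num) (by linarith),
      Real.logb_mul (by norm_num) (by linarith), Real.logb_self_eq_one (by norm_num)] at h'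
    linarith
  have h3 : (I.toJobs.maxProc : ℝ) ≤ p := by exact_mod_cast I.maxProc_toJobs_le hp
  have hk' : (1 : ℝ) ≤ k := by exact_mod_cast hk
  have hp' : (1 : ℝ) ≤ p := by exact_mod_cast hp1
  set l := Real.logb 2 I.n
  have h4 : (1 : ℝ) ≤ k * p := one_le_mul_of_one_le_of_one_le hk' hp'
  have h5 : (p : ℝ) ≤ k * p * l := by
    calc (p : ℝ) = 1 * p * 1 := by ring
      _ ≤ k * p * l := by gcongr
  have h6 : 1 ≤ k * p * l := one_le_mul_of_one_le_of_one_le h4 h1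
  simp only [Jobs.horizon, I.length_toJobs]
  push_cast
  calc (12 * (3 * (k : ℝ) + 6) * I.toJobs.maxProc * numDigits I.n + I.toJobs.maxProc + 4 : ℝ)
      ≤ 12 * (3 * k + 6 * k) * p * (l + l) + k * p * l + 4 * (k * p * l) := by
        gcongr <;> linarith
    _ = 221 * (k * p * l) := by ring
    _ ≤ 256 * (k * p * l) := by linarith

theorem exists_time_bound (q : ℕ[X]) : ∃ c : ℕ, ∀ (I : Instance) (p : ℕ), (∀ j, I.p j ≤ p) →
    ((q.eval (sz I.toJobs + I.toJobs.capacity (treewidth I.graph)) : ℕ) : ℝ) ≤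
      c * ((treewidth I.graph : ℝ) * p * Real.logb 2 I.n) ^ (c * treewidth I.graph) *
        (I.size : ℝ) ^ c := by
  set B := q.natDegree
  set A := q.eval 1
  -- The first summand serves as the leading factor, the second one for the exponents. The number
  -- `90` is `9 * 10`: the capacity has exponent `3k + 7 ≤ 10k` for `k ≥ 1`, and `256 * x` is at
  -- most `x ^ 9` if `x ≥ 2`.
  refine ⟨A * 2 ^ B * 256 ^ (10 * B) + 90 * B, fun I p hp => ?_⟩
  set c := A * 2 ^ B * 256 ^ (10 * B) + 90 * B with hc
  set k := treewidth I.graph with hk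
  set S := sz I.toJobs with hS
  have hsize : I.size = S := by rw [hS, sz, I.enc_toJobs, Instance.size]
  have hS1 : 1 ≤ S := sz_pos _
  have hS1' : (1 : ℝ) ≤ S := by exact_mod_cast hS1
  have hN1 : 1 ≤ I.toJobs.capacity k := Nat.one_le_pow _ _ (by omega)
  have hBc : 90 * B ≤ c := Nat.le_add_left _ _
  have hAc : ((A * 2 ^ B * 256 ^ (10 * B) : ℕ) : ℝ) ≤ c := by
    exact_mod_cast Nat.le_add_right _ _
  have h1 : q.eval (S + I.toJobs.capacity k) ≤ A * 2 ^ B * S ^ B * I.toJobs.capacity k ^ B := by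
    refine (eval_le_mul_pow q (by omega)).trans ?_
    calc A * (S + I.toJobs.capacity k) ^ B ≤ A * (2 * S * I.toJobs.capacity k) ^ B := by
          gcongr
          nlinarith
      _ = _ := by rw [mul_pow, mul_pow]; ring
  rw [hsize]
  rcases Nat.eq_zero_or_pos k with hk0 | hk1
  -- For treewidth `0` the parameter factor is an empty power, equal to `1`; the capacity is then
  -- the seventh power of a number quadratic in the input length.
  · have h2 : I.toJobs.capacity k ^ B ≤ 256 ^ (10 * B) * S ^ (14 * B) := by
      rw [hk0]
      calc I.toJobs.capacity 0 ^ B ≤ ((256 * S ^ 2) ^ 7) ^ B := by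
            unfold Jobs.capacity
            gcongr
            exact I.toJobs.horizon_zero_add_le
        _ = 256 ^ (7 * B) * S ^ (14 * B) := by rw [← pow_mul, mul_pow, ← pow_mul]; ring_nf
        _ ≤ _ := by
            gcongr
            · norm_num
            · norm_num
    have h3 : q.eval (S + I.toJobs.capacity k) ≤ A * 2 ^ B * 256 ^ (10 * B) * S ^ (15 * B) := by
      refine h1.trans ((Nat.mul_le_mul le_rfl h2).trans (le_of_eq ?_))
      ring
    have h4 : ((q.eval (S + I.toJobs.capacity k) : ℕ) : ℝ) ≤
        ((A * 2 ^ B * 256 ^ (10 * B) : ℕ) : ℝ) * (S : ℝ) ^ (15 * B) := by exact_mod_cast h3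
    rw [hk0, Nat.mul_zero, pow_zero, mul_one, ← hk0]
    refine h4.trans ?_
    gcongr
    omega
  -- Positive treewidth forces two jobs, hence `p ≥ 1` and `log₂ n ≥ 1`: all factors of `x` are at
  -- least `1`.
  · have hn : 2 ≤ I.n := by have := (treewidth_spec I.graph).1; omega
    have hp1 : 1 ≤ p := (I.p_pos ⟨0, by omega⟩).trans (hp _)
    have hT := horizon_add_le hp hk1 hp1 hn
    set x : ℝ := k * p * Real.logb 2 I.n with hx
    have hkx : (k : ℝ) ≤ x := by
      have hn' : (2 : ℝ) ≤ I.n := by exact_mod_cast hn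
      have h1 : (1 : ℝ) ≤ Real.logb 2 I.n := by
        rw [Real.le_logb_iff_rpow_le (by norm_num) (by linarith), Real.rpow_one]
        exact hn'
      have hp' : (1 : ℝ) ≤ p := by exact_mod_cast hp1
      calc (k : ℝ) = k * 1 * 1 := by ring
        _ ≤ x := by rw [hx]; gcongr
    have hk1' : (1 : ℝ) ≤ k := by exact_mod_cast hk1
    have hx1 : 1 ≤ x := hk1'.trans hkx
    have h2 : ((I.toJobs.capacity k : ℕ) : ℝ) ^ B ≤ (256 * x) ^ (10 * k * B) := by
      rw [Jobs.capacity, Nat.cast_pow, ← pow_mul]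
      calc ((I.toJobs.horizon k + 4 : ℕ) : ℝ) ^ ((3 * k + 7) * B)
          ≤ (256 * x) ^ ((3 * k + 7) * B) := by
            gcongr
        _ ≤ _ := pow_le_pow_right₀ (by linarith) (Nat.mul_le_mul_right _ (by omega))
    -- For `k ≥ 2` also `x ≥ 2`, and `256 ≤ x ^ 8` goes into the exponent. For `k = 1` possibly `x =
    -- 1`, but then the exponent of `256` is the constant `10 * B`, and the power goes into the
    -- leading factor.
    have h3 : (256 * x) ^ (10 * k * B) ≤ 256 ^ (10 * B) * x ^ (c * k) := by
      rcases Nat.lt_or_eq_of_le (show 1 ≤ k from hk1) with hk2 | hk2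
      · have hx2 : 2 ≤ x := le_trans (by exact_mod_cast hk2) hkx
        have h256 : (256 : ℝ) ≤ x ^ 8 := by
          calc (256 : ℝ) = 2 ^ 8 := by norm_num
            _ ≤ x ^ 8 := by gcongr
        calc (256 * x) ^ (10 * k * B) ≤ (x ^ 8 * x) ^ (10 * k * B) := by gcongr
          _ = x ^ (90 * B * k) := by rw [← pow_succ, ← pow_mul]; ring_nf
          _ ≤ x ^ (c * k) := pow_le_pow_right₀ hx1 (Nat.mul_le_mul_right _ hBc)
          _ ≤ _ := le_mul_of_one_le_left (by positivity) (one_le_pow₀ (by norm_num))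
      · rw [← hk2, mul_pow, mul_one, mul_one]
        gcongr
        omega
    have h4 : ((q.eval (S + I.toJobs.capacity k) : ℕ) : ℝ) ≤
        A * 2 ^ B * S ^ B * ((I.toJobs.capacity k : ℕ) : ℝ) ^ B := by exact_mod_cast h1
    calc ((q.eval (S + I.toJobs.capacity k) : ℕ) : ℝ)
        ≤ A * 2 ^ B * S ^ B * (256 ^ (10 * B) * x ^ (c * k)) :=
          h4.trans (mul_le_mul_of_nonneg_left (h2.trans h3) (by positivity))
      _ = ((A * 2 ^ B * 256 ^ (10 * B) : ℕ) : ℝ) * x ^ (c * k) * S ^ B := by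
          push_cast
          ring
      _ ≤ c * x ^ (c * k) * S ^ c := by
          gcongr
          omega

/-- The algorithm solves the scheduling problem for every objective function that is monotone in the
sum of the costs. -/
theorem exists_solvesWithin {M α : Type} [AddCommMonoid M] [LinearOrder M] [Enc M] [CostMonoid M]
    [LE α] {cost : Jobs × ℕ × ℕ → M} (hc : PT cost)
    (hmono : ∀ J v x y, x ≤ y → cost (J, v, x) ≤ cost (J, v, y))
    (f : (I : Instance) → I.Schedule → α)
    (hf : ∀ (I : Instance) (C C' : I.Schedule), ∑ j : Fin I.n, cost (I.toJobs, j, C j) ≤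
      ∑ j : Fin I.n, cost (I.toJobs, j, C' j) → f I C ≤ f I C') :
    ∃ (P : Program) (c : ℕ), P.SolvesWithin f (fun I p =>
      c * ((treewidth I.graph : ℝ) * p * Real.logb 2 I.n) ^ (c * treewidth I.graph) *
        (I.size : ℝ) ^ c) := by
  obtain ⟨τ, q, hτ, hq⟩ := exists_runsIn_completionTimes hc
  obtain ⟨P, hP⟩ := hτ.exists_program
  obtain ⟨c, hcb⟩ := exists_time_bound q
  refine ⟨P, c, fun I p hp => ?_⟩
  obtain ⟨C, h1, h2, h3⟩ := completionTimes_spec hmono I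
  obtain ⟨t, ht, hout⟩ := hP I.toJobs
  rw [h1, I.enc_toJobs] at hout
  refine ⟨C, t, ⟨h2, fun C' hC' => hf I C C' (h3 C' hC')⟩, ?_, ?_⟩
  · simpa only [enc, List.map_ofFn, Function.comp_def, encodeSchedule] using hout
  · have hn := (treewidth_spec I.graph).1
    have h4 := ht.trans (hq I.toJobs (treewidth I.graph) (by rw [I.length_toJobs]; omega)
      (attempt_ne_none hmono le_rfl))
    exact le_trans (by exact_mod_cast h4) (hcb I p hp)

end ConcSched

theorem mainTheorem9 :
    (∃ (P : ConcSched.Program) (c : ℕ),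
      P.SolvesWithin (fun I => I.maxWeightedLateness) (fun I p =>
        c * ((ConcSched.treewidth I.graph : ℝ) * p * Real.logb 2 I.n)
          ^ (c * ConcSched.treewidth I.graph) * (I.size : ℝ) ^ c)) ∧
    (∃ (P : ConcSched.Program) (c : ℕ),
      P.SolvesWithin (fun I => I.totalWeightedTardiness) (fun I p =>
        c * ((ConcSched.treewidth I.graph : ℝ) * p * Real.logb 2 I.n)
          ^ (c * ConcSched.treewidth I.graph) * (I.size : ℝ) ^ c)) := by
  exact ⟨ConcSched.exists_solvesWithin ConcSched.pt_maxLateCost ConcSched.maxLateCost_mono _ fun _ _ _ => ConcSched.maxWeightedLateness_le,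
    ConcSched.exists_solvesWithin (cost := ConcSched.tardCost) ConcSched.pt_tardCost
      ConcSched.tardCost_mono _ fun I C C' h => by
        rw [← ConcSched.sum_tardCost, ← ConcSched.sum_tardCost]
        exact_mod_cast h⟩
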